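/- Let $k$ be a field and $d\ge 0$. Let $\mathcal V$ be the category of finite-dimensional $k$-vector spaces, and let $\Gamma^d\mathcal V$ be the category with the same objects and with $\mathrm{Hom}_{\Gamma^d\mathcal V}(V,W)=\Gamma^d\mathrm{Hom}_k(V,W)$, where $\Gamma^dM=(M^{\otimes d})^{\Sigma_d}$ and composition is induced by $(\bigotimes_m g_m)\circ(\bigotimes_m f_m)=\bigotimes_m (g_m\circ f_m)$. Let $\mathcal P_d$ be the abelian category of $k$-linear functors $\Gamma^d\mathcal V\to\mathcal V$ (classical $d$-homogeneous strict polynomial functors), and let $\mathcal P_d^*$ be the category of $\mathbb Z$-graded objects in the category of $k$-linear functors from $\Gamma^d\mathcal V$ to all $k$-vector spaces. If $W=\bigoplus_i W^i$ is a $\mathbb Z$-graded vector space of finite total dimension and $F\in\mathcal P_d$, then $F(W)$ is graded by weights: $F(W)^j$ is the subspace of weight $j$ for the action of $\mathbb G_m$ on $F(W)$ induced by the action of weight $i$ on each $W^i$. For a graded vector space $E$ of finite total dimension, $V\mapsto F(E\otimes V)$ ($V$ in degree $0$) is thus an object of $\mathcal P_d^*$. For an arbitrary $\mathbb Z$-graded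 vector space $E$, the *lower parametrisation* of $F$ by $E$ is $$F_E=\mathop{\mathrm{colim}}_{S\subseteq E}\,F(S\otimes -)\in\mathcal P_d^*,$$ the colimit being over the poset of graded subspaces $S\subseteq E$ of finite total dimension, and the *upper parametrisation* is $F^E=F_{E^\vee}$, where $(E^\vee)^i=\mathrm{Hom}_k(E^{-i},k)$. Then: 1. For every $\mathbb Z$-graded vector space $E$, the assignments $F\mapsto F_E$ and $F\mapsto F^E$ are exact functors $\mathcal P_d\to\mathcal P_d^*$. They are natural in $E$: a degree-preserving map $f\colon E\to E'$ induces a natural transformation $F_E\to F_{E'}$, which restricts on $F(S\otimes -)$ to $F(f|_S\otimes -)\colon F(S\otimes -)\to F(f(S)\otimes -)$ followed by the canonical map to $F_{E'}$; this makes $(E,F)\mapsto F_E$ a functor covariant in $E$, and consequently $(E,F)\mapsto F^E$ a functor contravariant in $E$. 2. If $E$ has finite total dimension, then $F_E(V)=F(E\otimes V)$ as graded strict polynomial functors, where $F(E\otimes V)=\bigoplus_jF(E\otimes V)^j$ is graded by weights as above. That is, there is an isomorphism $F_E\simeq F(E\otimes-)$, natural in $E$ and $F$, whose composite with the canonical map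 $F(S\otimes -)\to F_E$ is induced by the inclusion $S\subseteq E$, for each graded subspace $S\subseteq E$. 3. Let $E$ be degreewise finite-dimensional and zero in negative degrees. For $i\in\mathbb Z$ let $E^{\le i}\subseteq E$ be the graded subspace equal to $E$ in degrees $\le i$ and zero in degrees $>i$. Then the inclusion $E^{\le i}\hookrightarrow E$ induces a monomorphism $F_{E^{\le i}}\to F_E$ which is an isomorphism in all degrees $\le i$. 4. For $E$ as in (3) and $F,G\in\mathcal P_d$, the functors $F^E$ and $G_E$ have finite-dimensional values in each degree, i.e. are degreewise in $\mathcal P_d$, and there are bigraded $k$-linear isomorphisms $$\mathrm{Ext}^*_{\mathcal P}(F^E,G)\simeq\mathrm{Ext}^*_{\mathcal P}(F,G_E),$$ that is, isomorphisms $\mathrm{Ext}^i_{\mathcal P_d}((F^E)^{-j},G)\simeq\mathrm{Ext}^i_{\mathcal P_d}(F,(G_E)^j)$ for all $i\ge0$ and $j\in\mathbb Z$, natural in $F$, $G$ and $E$. -/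

import Mathlib

open CategoryTheory Limits Opposite
open scoped TensorProduct DirectSum

universe v u

set_option linter.unusedVariables false

noncomputable section

namespace StrictPolynomial

section DividedPower

variable (k : Type u) [Field k] (d : ℕ)

/-- The permutation of the factors of `M^{⊗ d}`. -/
def permTensor (M : Type v) [AddCommGroup M] [Module k M] (σ : Equiv.Perm (Fin d)) :
    (⨂[k] _ : Fin d, M) →ₗ[k] ⨂[k] _ : Fin d, M :=
  (PiTensorProduct.reindex k (fun _ => M) σ).toLinearMap

lemma permTensor_tprod (M : Type v) [AddCommGroup M] [Module k M] (σ : Equiv.Perm (Fin d))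
    (f : Fin d → M) :
    permTensor k d M σ (PiTensorProduct.tprod k f) =
      PiTensorProduct.tprod k fun i => f (σ.symm i) :=
  PiTensorProduct.reindex_tprod σ f

/-- The divided power `Γ^d M`: the invariants of the symmetric group `Σ_d` acting on `M^{⊗ d}`
by permutation of the factors. -/
def gammaPow (M : Type v) [AddCommGroup M] [Module k M] :
    Submodule k (⨂[k] _ : Fin d, M) where
  carrier := {x | ∀ σ : Equiv.Perm (Fin d), permTensor k d M σ x = x}
  add_mem' hx hy σ := by rw [map_add, hx σ, hy σ]
  zero_mem' σ := map_zero _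
  smul_mem' c x hx σ := by rw [map_smul, hx σ]

variable {k}

/-- `x ↦ x ⊗ ⋯ ⊗ x ∈ Γ^d M`. -/
def gammaDiag {M : Type v} [AddCommGroup M] [Module k M] (x : M) : gammaPow k d M :=
  ⟨PiTensorProduct.tprod k fun _ => x, fun σ => permTensor_tprod k d M σ fun _ => x⟩

variable {M N L : Type v} [AddCommGroup M] [Module k M] [AddCommGroup N] [Module k N]
  [AddCommGroup L] [Module k L]

lemma permTensor_map (f : M →ₗ[k] N) (σ : Equiv.Perm (Fin d)) (x : ⨂[k] _ : Fin d, M) :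
    permTensor k d N σ (PiTensorProduct.map (fun _ => f) x) =
      PiTensorProduct.map (fun _ => f) (permTensor k d M σ x) := by
  induction x using PiTensorProduct.induction_on with
  | smul_tprod r g => simp only [map_smul, PiTensorProduct.map_tprod, permTensor_tprod]
  | add x x' hx hx' => simp only [map_add, hx, hx']

/-- `Γ^d` on linear maps: the restriction of `f ⊗ ⋯ ⊗ f`. -/
def gammaMap (f : M →ₗ[k] N) : gammaPow k d M →ₗ[k] gammaPow k d N :=
  (PiTensorProduct.map fun _ : Fin d => f).restrict fun x hx σ => by
    rw [permTensor_map, hx σ]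

lemma permTensor_map₂ (B : M →ₗ[k] N →ₗ[k] L) (σ : Equiv.Perm (Fin d))
    (x : ⨂[k] _ : Fin d, M) (y : ⨂[k] _ : Fin d, N) :
    permTensor k d L σ (PiTensorProduct.map₂ (fun _ => B) x y) =
      PiTensorProduct.map₂ (fun _ => B) (permTensor k d M σ x) (permTensor k d N σ y) := by
  induction x using PiTensorProduct.induction_on with
  | smul_tprod r f =>
    induction y using PiTensorProduct.induction_on with
    | smul_tprod s g =>
      simp only [map_smul, LinearMap.smul_apply, permTensor_tprod,
        PiTensorProduct.map₂_tprod_tprod]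
    | add y y' hy hy' => simp only [map_add, hy, hy']
  | add x x' hx hx' => simp only [map_add, LinearMap.add_apply, hx, hx']

/-- The bilinear map `Γ^d M × Γ^d N → Γ^d L` which is the restriction of
`(⊗ xᵢ, ⊗ yᵢ) ↦ ⊗ B(xᵢ, yᵢ)`, for `B : M × N → L` bilinear. -/
def gammaMap₂ (B : M →ₗ[k] N →ₗ[k] L) :
    gammaPow k d M →ₗ[k] gammaPow k d N →ₗ[k] gammaPow k d L :=
  LinearMap.mk₂ k (fun x y => ⟨PiTensorProduct.map₂ (fun _ => B) x.1 y.1, fun σ => by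
      rw [permTensor_map₂, x.2 σ, y.2 σ]⟩)
    (fun _ _ _ => Subtype.ext (by simp)) (fun _ _ _ => Subtype.ext (by simp))
    (fun _ _ _ => Subtype.ext (by simp)) (fun _ _ _ => Subtype.ext (by simp))

end DividedPower

section GammaCat

/-- For a `k`-linear category `C`, the category `Γ^d C`: it has the same objects as `C`, and
`Hom_{Γ^d C}(X, Y) = Γ^d Hom_C(X, Y)`. -/
structure GammaCat (k : Type u) (d : ℕ) (C : Type*) where
  /-- the underlying object of `C` -/
  of : C

variable {k : Type u} [Field k] {d : ℕ} {C : Type*} [Category.{v} C] [Preadditive C] [Linear k C]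

lemma map₂_comp_assoc {X Y Z W : C} (x : ⨂[k] _ : Fin d, X ⟶ Y) (y : ⨂[k] _ : Fin d, Y ⟶ Z)
    (z : ⨂[k] _ : Fin d, Z ⟶ W) :
    PiTensorProduct.map₂ (fun _ => Linear.comp (S := k) X Z W)
      (PiTensorProduct.map₂ (fun _ => Linear.comp (S := k) X Y Z) x y) z =
    PiTensorProduct.map₂ (fun _ => Linear.comp (S := k) X Y W) x
      (PiTensorProduct.map₂ (fun _ => Linear.comp (S := k) Y Z W) y z) := by
  induction x using PiTensorProduct.induction_on with
  | smul_tprod r f =>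
    induction y using PiTensorProduct.induction_on with
    | smul_tprod s g =>
      induction z using PiTensorProduct.induction_on with
      | smul_tprod t h =>
        simp [PiTensorProduct.map₂_tprod_tprod]
      | add y y' hy hy' => simp only [map_add, hy, hy']
    | add y y' hy hy' => simp only [map_add, LinearMap.add_apply, hy, hy']
  | add x x' hx hx' => simp only [map_add, LinearMap.add_apply, hx, hx']

lemma map₂_id_comp {X Y : C} (x : ⨂[k] _ : Fin d, X ⟶ Y) :
    PiTensorProduct.map₂ (fun _ => Linear.comp (S := k) X X Y)
      (PiTensorProduct.tprod k fun _ => 𝟙 X) x = x := by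
  induction x using PiTensorProduct.induction_on with
  | smul_tprod r f => simp [PiTensorProduct.map₂_tprod_tprod]
  | add x x' hx hx' => simp only [map_add, hx, hx']

lemma map₂_comp_id {X Y : C} (x : ⨂[k] _ : Fin d, X ⟶ Y) :
    PiTensorProduct.map₂ (fun _ => Linear.comp (S := k) X Y Y) x
      (PiTensorProduct.tprod k fun _ => 𝟙 Y) = x := by
  induction x using PiTensorProduct.induction_on with
  | smul_tprod r f => simp [PiTensorProduct.map₂_tprod_tprod]
  | add x x' hx hx' => simp only [map_add, LinearMap.add_apply, hx, hx']

/-- The composition of `Γ^d C` is induced by `(⊗ fᵢ, ⊗ gᵢ) ↦ ⊗ (gᵢ ∘ fᵢ)`. For `C = 𝒱` it is the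
composition of maps under `Γ^d Hom(V, W) ≃ Hom_{Σ_d}(V^{⊗ d}, W^{⊗ d})`. -/
instance : Category.{max u v} (GammaCat k d C) where
  Hom X Y := gammaPow k d (X.of ⟶ Y.of)
  id X := gammaDiag d (𝟙 X.of)
  comp x y := gammaMap₂ d (Linear.comp (S := k) _ _ _) x y
  id_comp _ := Subtype.ext (map₂_id_comp _)
  comp_id _ := Subtype.ext (map₂_comp_id _)
  assoc _ _ _ := Subtype.ext (map₂_comp_assoc _ _ _)

instance : Preadditive (GammaCat k d C) where
  homGroup X Y := inferInstanceAs (AddCommGroup (gammaPow k d (X.of ⟶ Y.of)))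
  add_comp X Y Z x x' y :=
    LinearMap.map_add₂ (gammaMap₂ d (Linear.comp (S := k) X.of Y.of Z.of))
      (x : gammaPow k d (X.of ⟶ Y.of)) (x' : gammaPow k d (X.of ⟶ Y.of)) y
  comp_add X Y Z x y y' :=
    (gammaMap₂ d (Linear.comp (S := k) X.of Y.of Z.of) x).map_add y y'

instance : Linear k (GammaCat k d C) where
  homModule X Y := inferInstanceAs (Module k (gammaPow k d (X.of ⟶ Y.of)))
  smul_comp X Y Z r x y :=
    LinearMap.map_smul₂ (gammaMap₂ d (Linear.comp (S := k) X.of Y.of Z.of)) r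
      (x : gammaPow k d (X.of ⟶ Y.of)) y
  comp_smul X Y Z x r y :=
    (gammaMap₂ d (Linear.comp (S := k) X.of Y.of Z.of) x).map_smul r y

@[simp] lemma comp_val {X Y Z : GammaCat k d C} (x : X ⟶ Y) (y : Y ⟶ Z) :
    (x ≫ y).1 = PiTensorProduct.map₂ (fun _ => Linear.comp (S := k) X.of Y.of Z.of) x.1 y.1 :=
  rfl

variable {D : Type*} [Category.{v} D] [Preadditive D] [Linear k D]

lemma map_map₂_comp (G : C ⥤ D) [G.Additive] [G.Linear k] {X Y Z : C}
    (x : ⨂[k] _ : Fin d, X ⟶ Y) (y : ⨂[k] _ : Fin d, Y ⟶ Z) :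
    PiTensorProduct.map (fun _ => G.mapLinearMap k)
      (PiTensorProduct.map₂ (fun _ => Linear.comp (S := k) X Y Z) x y) =
    PiTensorProduct.map₂ (fun _ => Linear.comp (S := k) (G.obj X) (G.obj Y) (G.obj Z))
      (PiTensorProduct.map (fun _ => G.mapLinearMap k) x)
      (PiTensorProduct.map (fun _ => G.mapLinearMap k) y) := by
  induction x using PiTensorProduct.induction_on with
  | smul_tprod r f =>
    induction y using PiTensorProduct.induction_on with
    | smul_tprod s g => simp [PiTensorProduct.map₂_tprod_tprod]
    | add y y' hy hy' => simp only [map_add, hy, hy']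
  | add x x' hx hx' => simp only [map_add, LinearMap.add_apply, hx, hx']

variable (d) in
/-- The linear functor `Γ^d G : Γ^d C ⥤ Γ^d D` induced by a linear functor `G : C ⥤ D`. -/
def gammaFunctor (G : C ⥤ D) [G.Additive] [G.Linear k] : GammaCat k d C ⥤ GammaCat k d D where
  obj X := ⟨G.obj X.of⟩
  map {X Y} x := gammaMap d (G.mapLinearMap k : (X.of ⟶ Y.of) →ₗ[k] _) x
  map_id X := Subtype.ext <| by
    change PiTensorProduct.map _ (PiTensorProduct.tprod k _) = PiTensorProduct.tprod k _
    simp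
  map_comp x y := Subtype.ext (map_map₂_comp G x.1 y.1)

instance (G : C ⥤ D) [G.Additive] [G.Linear k] :
    (gammaFunctor (k := k) d G).Additive where
  map_add {X Y x y} :=
    (gammaMap d (G.mapLinearMap k : (X.of ⟶ Y.of) →ₗ[k] _)).map_add x y

instance (G : C ⥤ D) [G.Additive] [G.Linear k] :
    (gammaFunctor (k := k) d G).Linear k where
  map_smul {X Y} x r :=
    (gammaMap d (G.mapLinearMap k : (X.of ⟶ Y.of) →ₗ[k] _)).map_smul r x

lemma map₂_diag_comm {G G' : C ⥤ D} [G.Additive] [G.Linear k] [G'.Additive] [G'.Linear k]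
    (α : G ⟶ G') {X Y : C} (x : ⨂[k] _ : Fin d, X ⟶ Y) :
    PiTensorProduct.map₂ (fun _ => Linear.comp (S := k) _ _ _)
      (PiTensorProduct.map (fun _ => G.mapLinearMap k) x)
      (PiTensorProduct.tprod k fun _ => α.app Y) =
    PiTensorProduct.map₂ (fun _ => Linear.comp (S := k) _ _ _)
      (PiTensorProduct.tprod k fun _ => α.app X)
      (PiTensorProduct.map (fun _ => G'.mapLinearMap k) x) := by
  induction x using PiTensorProduct.induction_on with
  | smul_tprod r f => simp [PiTensorProduct.map₂_tprod_tprod]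
  | add x x' hx hx' => simp only [map_add, LinearMap.add_apply, hx, hx']

variable (k d) in
/-- The morphism `f ⊗ ⋯ ⊗ f` of `Γ^d C`, for a morphism `f` of `C`. -/
def diagHom {X Y : C} (f : X ⟶ Y) : (⟨X⟩ : GammaCat k d C) ⟶ ⟨Y⟩ := gammaDiag d f

lemma diagHom_comp {X Y Z : C} (f : X ⟶ Y) (g : Y ⟶ Z) :
    diagHom k d (f ≫ g) = diagHom k d f ≫ diagHom k d g :=
  Subtype.ext <| by
    rw [comp_val]
    simp [diagHom, gammaDiag, PiTensorProduct.map₂_tprod_tprod]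

variable (k d) in
/-- The natural transformation `Γ^d G ⟶ Γ^d G'` with components `α_X ⊗ ⋯ ⊗ α_X`, for a natural
transformation `α : G ⟶ G'` of linear functors. -/
def gammaNatTrans {G G' : C ⥤ D} [G.Additive] [G.Linear k] [G'.Additive] [G'.Linear k]
    (α : G ⟶ G') : gammaFunctor (k := k) d G ⟶ gammaFunctor d G' where
  app X := diagHom k d (α.app X.of)
  naturality _ _ x := Subtype.ext (map₂_diag_comm α x.1)

lemma gammaNatTrans_id (G : C ⥤ D) [G.Additive] [G.Linear k] :
    gammaNatTrans k d (𝟙 G) = 𝟙 _ := rfl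

lemma gammaNatTrans_comp {G G' G'' : C ⥤ D} [G.Additive] [G.Linear k] [G'.Additive] [G'.Linear k]
    [G''.Additive] [G''.Linear k] (α : G ⟶ G') (β : G' ⟶ G'') :
    gammaNatTrans k d (α ≫ β) = gammaNatTrans k d α ≫ gammaNatTrans k d β := by
  ext X
  exact diagHom_comp _ _

end GammaCat

section Graded

variable (k : Type u) [Field k]

/-- The category of `ℤ`-graded vector spaces, with degree-preserving morphisms. -/
abbrev GrVect := GradedObject ℤ (ModuleCat.{u} k)

instance : Preadditive (GrVect k) where
  homGroup E E' := inferInstanceAs (AddCommGroup (∀ i, E i ⟶ E' i))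
  add_comp _ _ _ f f' g := funext fun i => Preadditive.add_comp _ _ _ (f i) (f' i) (g i)
  comp_add _ _ _ f g g' := funext fun i => Preadditive.comp_add _ _ _ (f i) (g i) (g' i)

instance : Linear k (GrVect k) where
  homModule E E' := inferInstanceAs (Module k (∀ i, E i ⟶ E' i))
  smul_comp _ _ _ r f g := funext fun i => Linear.smul_comp _ _ _ r (f i) (g i)
  comp_smul _ _ _ f r g := funext fun i => Linear.comp_smul _ _ _ (f i) r (g i)

variable {k}

@[simp] lemma grVect_comp_apply {E E' E'' : GrVect k} (f : E ⟶ E') (g : E' ⟶ E'') (i : ℤ) :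
    (f ≫ g) i = f i ≫ g i := rfl

@[simp] lemma grVect_id_apply (E : GrVect k) (i : ℤ) : (𝟙 E : E ⟶ E) i = 𝟙 (E i) := rfl

@[simp] lemma grVect_add_apply {E E' : GrVect k} (f g : E ⟶ E') (i : ℤ) :
    (f + g) i = f i + g i := rfl

@[simp] lemma grVect_smul_apply {E E' : GrVect k} (r : k) (f : E ⟶ E') (i : ℤ) :
    (r • f) i = r • f i := rfl

variable (k)

/-- The graded vector spaces of finite total dimension. -/
def isFinTotal : ObjectProperty (GrVect k) := fun E => Module.Finite k (⨁ i, E i)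

/-- The category of `ℤ`-graded vector spaces of finite total dimension. -/
abbrev GrFin := (isFinTotal k).FullSubcategory

instance (W : GrFin k) : Module.Finite k (⨁ i, W.obj i) := W.property

/-- The functor which forgets the grading. -/
def total : GrFin k ⥤ FGModuleCat.{u} k where
  obj W := FGModuleCat.of k (⨁ i, W.obj i)
  map f := FGModuleCat.ofHom (DirectSum.lmap fun i => (f.hom i).hom)
  map_id W := FGModuleCat.hom_ext (by exact DirectSum.lmap_id)
  map_comp f g := FGModuleCat.hom_ext (by exact DirectSum.lmap_comp _ _)

instance : (total k).Additive where
  map_add := FGModuleCat.hom_ext <| LinearMap.ext fun x => DFinsupp.ext fun i => rfl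

instance : (total k).Linear k where
  map_smul _ _ := FGModuleCat.hom_ext <| LinearMap.ext fun x => DFinsupp.ext fun i => rfl

variable {k}

/-- The graded vector space `E ⊗ V`, with `(E ⊗ V)^i = E^i ⊗ V`: the vector space `V` is placed in
degree `0`. -/
def tensorObj (E : GrFin k) (V : FGModuleCat.{u} k) : GrFin k where
  obj i := ModuleCat.of k (E.obj i ⊗[k] V)
  property := Module.Finite.equiv
    (TensorProduct.directSumLeft k k (fun i => (E.obj i : Type u)) (V : Type u))

/-- The linear functor `V ↦ E ⊗ V`. -/
def tensorFunctor (E : GrFin k) : FGModuleCat.{u} k ⥤ GrFin k where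
  obj V := tensorObj E V
  map f := ⟨fun i => ModuleCat.ofHom (f.hom.hom.lTensor (E.obj i))⟩
  map_id V := ObjectProperty.hom_ext _ <| funext fun i =>
    ModuleCat.hom_ext (LinearMap.lTensor_id _ _)
  map_comp f g := ObjectProperty.hom_ext _ <| funext fun i =>
    ModuleCat.hom_ext (LinearMap.lTensor_comp _ _ _)

instance (E : GrFin k) : (tensorFunctor E).Additive where
  map_add := ObjectProperty.hom_ext _ <| funext fun i =>
    ModuleCat.hom_ext (LinearMap.lTensor_add _ _ _)

instance (E : GrFin k) : (tensorFunctor E).Linear k where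
  map_smul _ r := ObjectProperty.hom_ext _ <| funext fun i =>
    ModuleCat.hom_ext (LinearMap.lTensor_smul _ r _)

/-- The natural transformation `f ⊗ V : E ⊗ V ⟶ E' ⊗ V`. -/
def tensorNatTrans {E E' : GrFin k} (f : E ⟶ E') : tensorFunctor E ⟶ tensorFunctor E' where
  app V := ⟨fun i => ModuleCat.ofHom ((f.hom i).hom.rTensor V)⟩
  naturality V W g := ObjectProperty.hom_ext _ <| funext fun i => ModuleCat.hom_ext <|
    TensorProduct.ext' fun x y => rfl

lemma tensorNatTrans_id (E : GrFin k) : tensorNatTrans (𝟙 E) = 𝟙 _ := by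
  refine NatTrans.ext (funext fun V => ObjectProperty.hom_ext _ ?_)
  exact funext fun i => ModuleCat.hom_ext (TensorProduct.ext' fun x y => rfl)

lemma tensorNatTrans_comp {E E' E'' : GrFin k} (f : E ⟶ E') (g : E' ⟶ E'') :
    tensorNatTrans (f ≫ g) = tensorNatTrans f ≫ tensorNatTrans g := by
  refine NatTrans.ext (funext fun V => ObjectProperty.hom_ext _ ?_)
  exact funext fun i => ModuleCat.hom_ext (TensorProduct.ext' fun x y => rfl)

end Graded

section Weights

variable {k : Type u} [Field k] (d : ℕ)

/-- The projection of (the underlying vector space of) `W` onto its component of degree `i`. -/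
def gradProj (W : GrFin k) (i : ℤ) : (total k).obj W ⟶ (total k).obj W :=
  FGModuleCat.ofHom (DirectSum.lof k ℤ (fun i => W.obj i) i ∘ₗ DirectSum.component k ℤ _ i)

lemma gradProj_comm {W W' : GrFin k} (f : W ⟶ W') (i : ℤ) :
    gradProj W i ≫ (total k).map f = (total k).map f ≫ gradProj W' i :=
  FGModuleCat.hom_ext <| LinearMap.ext fun (x : ⨁ i, W.obj i) => by
    change DirectSum.lmap _ (DirectSum.lof k ℤ (fun i => W.obj i) i (x i)) =
      DirectSum.lof k ℤ (fun i => W'.obj i) i ((f.hom i).hom (x i))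
    rw [DirectSum.lmap_lof]

lemma finite_support (W : GrFin k) : {i | gradProj W i ≠ 0}.Finite := by
  obtain ⟨s, hs⟩ := Module.Finite.fg_top (R := k) (M := ⨁ i, W.obj i)
  classical
  refine (s.biUnion fun x => DFinsupp.support x).finite_toSet.subset fun i hi => ?_
  by_contra h
  refine hi (FGModuleCat.hom_ext ?_)
  let p : (⨁ i, W.obj i) →ₗ[k] ⨁ i, W.obj i :=
    DirectSum.lof k ℤ (fun i => W.obj i) i ∘ₗ DirectSum.component k ℤ _ i
  have : (⊤ : Submodule k (⨁ i, W.obj i)) ≤ LinearMap.ker p := by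
    rw [← hs, Submodule.span_le]
    intro x hx
    have hx0 : x i = 0 := by
      by_contra h0
      exact h (by simpa using ⟨x, hx, h0⟩)
    change DirectSum.lof k ℤ (fun i => W.obj i) i (x i) = 0
    rw [hx0, map_zero]
  exact LinearMap.ext fun x => this (Submodule.mem_top (x := x))

/-- The finite set of degrees in which `W` is nonzero. -/
def gradSupport (W : GrFin k) : Finset ℤ := (finite_support W).toFinset

lemma gradProj_eq_zero {W : GrFin k} {i : ℤ} (hi : i ∉ gradSupport W) : gradProj W i = 0 := by
  simpa [gradSupport] using hi

/-- The sum of the `π_{a₁} ⊗ ⋯ ⊗ π_{a_d}` over the `d`-tuples of degrees taken in `s` with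
`a₁ + ⋯ + a_d = j`, where `π_a` is the projection onto the component of degree `a`. -/
def weightTensor (W : GrFin k) (j : ℤ) (s : Finset ℤ) :
    ⨂[k] _ : Fin d, (total k).obj W ⟶ (total k).obj W :=
  ∑ a ∈ Fintype.piFinset (fun _ : Fin d => s) with ∑ m, a m = j,
    PiTensorProduct.tprod k fun m => gradProj W (a m)

lemma weightTensor_eq {W : GrFin k} (j : ℤ) {s : Finset ℤ} (hs : gradSupport W ⊆ s) :
    weightTensor d W j s = weightTensor d W j (gradSupport W) := by
  symm
  refine Finset.sum_subset (Finset.filter_subset_filter _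
    (Fintype.piFinset_subset _ _ fun _ => hs)) fun a ha hna => ?_
  have : ∃ m, a m ∉ gradSupport W := by
    by_contra! h
    exact hna (Finset.mem_filter.2 ⟨Fintype.mem_piFinset.2 h, (Finset.mem_filter.1 ha).2⟩)
  obtain ⟨m, hm⟩ := this
  exact MultilinearMap.map_coord_zero _ m (gradProj_eq_zero hm)

lemma permTensor_weightTensor (W : GrFin k) (j : ℤ) (s : Finset ℤ) (σ : Equiv.Perm (Fin d)) :
    permTensor k d _ σ (weightTensor d W j s) = weightTensor d W j s := by
  simp only [weightTensor, map_sum, permTensor_tprod]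
  refine Finset.sum_equiv (Equiv.arrowCongr σ (Equiv.refl ℤ)) (fun a => ?_) (fun a _ => rfl)
  simp only [Finset.mem_filter, Fintype.mem_piFinset]
  refine and_congr ⟨fun h m => h _, fun h m => ?_⟩ ?_
  · simpa using h (σ m)
  · rw [← Equiv.sum_comp σ.symm a]
    rfl

/-- The weight `j` component of the action of the multiplicative group on `W`.

The element `t` of the multiplicative group acts on `W` by `∑ₐ tᵃ πₐ`, where `πₐ` is the projection
onto the component of degree `a`. Expanding, `(∑ₐ tᵃ πₐ)^{⊗ d} = ∑ⱼ tʲ wⱼ` with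
`wⱼ = ∑_{a₁ + ⋯ + a_d = j} π_{a₁} ⊗ ⋯ ⊗ π_{a_d}`, and `wⱼ` is the morphism of `Γ^d 𝒱` defined here. -/
def weightHom (W : GrFin k) (j : ℤ) :
    (gammaFunctor (k := k) d (total k)).obj ⟨W⟩ ⟶ (gammaFunctor d (total k)).obj ⟨W⟩ :=
  (⟨weightTensor d W j (gradSupport W), permTensor_weightTensor d W j _⟩ :
    gammaPow k d ((total k).obj W ⟶ (total k).obj W))

lemma map₂_weightTensor_comm {W W' : GrFin k} (j : ℤ) (s : Finset ℤ)
    (x : ⨂[k] _ : Fin d, W ⟶ W') :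
    PiTensorProduct.map₂ (fun _ => Linear.comp (S := k) _ _ _) (weightTensor d W j s)
      (PiTensorProduct.map (fun _ => (total k).mapLinearMap k) x) =
    PiTensorProduct.map₂ (fun _ => Linear.comp (S := k) _ _ _)
      (PiTensorProduct.map (fun _ => (total k).mapLinearMap k) x) (weightTensor d W' j s) := by
  induction x using PiTensorProduct.induction_on with
  | smul_tprod r f =>
    simp only [weightTensor, map_smul, map_sum, LinearMap.sum_apply, LinearMap.smul_apply,
      PiTensorProduct.map_tprod, PiTensorProduct.map₂_tprod_tprod, Finset.smul_sum]
    refine Finset.sum_congr rfl fun a _ => ?_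
    congr 2
    funext m
    exact gradProj_comm (f m) (a m)
  | add x x' hx hx' => simp only [map_add, LinearMap.add_apply, hx, hx']

/-- The morphisms `weightHom` commute with the morphisms of `Γ^d` of the category of graded vector
spaces. -/
lemma weightHom_comm {W W' : GammaCat k d (GrFin k)} (x : W ⟶ W') (j : ℤ) :
    weightHom d W.of j ≫ (gammaFunctor d (total k)).map x =
      (gammaFunctor d (total k)).map x ≫ weightHom d W'.of j :=
  Subtype.ext <| by
    have h := map₂_weightTensor_comm d j (gradSupport W.of ∪ gradSupport W'.of) x.1
    rw [weightTensor_eq d j Finset.subset_union_left,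
      weightTensor_eq d j Finset.subset_union_right] at h
    exact h

end Weights

section StrictPolynomialFunctors

variable (k : Type u) [Field k] (d : ℕ)

section Closure

variable {C : Type*} [Category* C] [Preadditive C] [Linear k C]

/-- A functor `F : C ⥤ Vect` is linear if all maps `Hom(X, Y) → Hom(F X, F Y)` are `k`-linear. -/
def isLinearFunctor : ObjectProperty (C ⥤ ModuleCat.{u} k) := fun F => F.Additive ∧ F.Linear k

variable (C) in
/-- A functor `F : C ⥤ Vect` has finite-dimensional values. -/
def hasFiniteValues : ObjectProperty (C ⥤ ModuleCat.{u} k) :=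
  fun F => ∀ X, Module.Finite k (F.obj X)

variable {k}

/-- Linearity can be tested on jointly monic families of natural transformations to
linear functors. -/
lemma isLinearFunctor_of_jointly_mono {F : C ⥤ ModuleCat.{u} k} {J : Type*}
    {G : J → C ⥤ ModuleCat.{u} k} (hG : ∀ j, isLinearFunctor k (G j)) (p : ∀ j, F ⟶ G j)
    (hp : ∀ (Y : C) {Z : ModuleCat.{u} k} (a b : Z ⟶ F.obj Y),
      (∀ j, a ≫ (p j).app Y = b ≫ (p j).app Y) → a = b) : isLinearFunctor k F := by
  refine ⟨⟨fun {X Y f g} => hp _ _ _ fun j => ?_⟩, ⟨fun {X Y} f r => hp _ _ _ fun j => ?_⟩⟩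
  · have := (hG j).1
    simp [Preadditive.add_comp]
  · have := (hG j).1
    have := (hG j).2
    simp

lemma isLinearFunctor_of_jointly_epi {F : C ⥤ ModuleCat.{u} k} {J : Type*}
    {G : J → C ⥤ ModuleCat.{u} k} (hG : ∀ j, isLinearFunctor k (G j)) (p : ∀ j, G j ⟶ F)
    (hp : ∀ (X : C) {Z : ModuleCat.{u} k} (a b : F.obj X ⟶ Z),
      (∀ j, (p j).app X ≫ a = (p j).app X ≫ b) → a = b) : isLinearFunctor k F := by
  refine ⟨⟨fun {X Y f g} => hp _ _ _ fun j => ?_⟩, ⟨fun {X Y} f r => hp _ _ _ fun j => ?_⟩⟩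
  · have := (hG j).1
    simp only [← NatTrans.naturality, Preadditive.comp_add, Functor.map_add,
      Preadditive.add_comp]
  · have := (hG j).1
    have := (hG j).2
    simp only [← NatTrans.naturality, Linear.comp_smul, Functor.map_smul, Linear.smul_comp]

instance : (isLinearFunctor k (C := C)).IsClosedUnderSubobjects where
  prop_of_mono f hf hY := isLinearFunctor_of_jointly_mono (J := Unit) (fun _ => hY) (fun _ => f)
    fun Y Z a b h => (cancel_mono (f.app Y)).1 (h ())

instance : (isLinearFunctor k (C := C)).IsClosedUnderQuotients where
  prop_of_epi f hf hX := isLinearFunctor_of_jointly_epi (J := Unit) (fun _ => hX) (fun _ => f)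
    fun Y Z a b h => (cancel_epi (f.app Y)).1 (h ())

instance (J : Type*) [Category* J] [HasLimitsOfShape J (ModuleCat.{u} k)] :
    (isLinearFunctor k (C := C)).IsClosedUnderLimitsOfShape J where
  limitsOfShape_le := by
    rintro F ⟨p⟩
    exact isLinearFunctor_of_jointly_mono p.prop_diag_obj (fun j => p.π.app j) fun Y Z a b h =>
      (isLimitOfPreserves ((evaluation _ _).obj Y) p.isLimit).hom_ext h

instance (J : Type*) [Category* J] [HasColimitsOfShape J (ModuleCat.{u} k)] :
    (isLinearFunctor k (C := C)).IsClosedUnderColimitsOfShape J where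
  colimitsOfShape_le := by
    rintro F ⟨p⟩
    exact isLinearFunctor_of_jointly_epi p.prop_diag_obj (fun j => p.ι.app j) fun Y Z a b h =>
      (isColimitOfPreserves ((evaluation _ _).obj Y) p.isColimit).hom_ext h

instance : (hasFiniteValues k C).IsClosedUnderSubobjects where
  prop_of_mono {F G} f hf hY X := by
    have := hY X
    exact Module.Finite.of_injective (f.app X).hom ((ModuleCat.mono_iff_injective _).1 inferInstance)

instance : (hasFiniteValues k C).IsClosedUnderQuotients where
  prop_of_epi {F G} f hf hY X := by
    have := hY X
    exact Module.Finite.of_surjective (f.app X).hom ((ModuleCat.epi_iff_surjective _).1 inferInstance)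

instance : (hasFiniteValues k C).IsClosedUnderFiniteProducts where
  isClosedUnderLimitsOfShape J _ := ⟨by
    rintro F ⟨p⟩ X
    have hfin (j : Discrete J) : Module.Finite k ((p.diag.obj j).obj X) := p.prop_diag_obj j X
    refine Module.Finite.of_injective (LinearMap.pi fun j : Discrete J => ((p.π.app j).app X).hom) ?_
    rw [← LinearMap.ker_eq_bot, LinearMap.ker_eq_bot']
    intro x hx
    have h := (isLimitOfPreserves ((evaluation _ _).obj X) p.isLimit).hom_ext
      (f := ModuleCat.ofHom (LinearMap.toSpanSingleton k (F.obj X) x)) (f' := 0) fun j =>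
        ModuleCat.hom_ext <| LinearMap.ext_ring <| by
          simpa using congrFun hx j
    simpa using congr($(h).hom 1)⟩

end Closure

/-- The category `Γ^d 𝒱`, where `𝒱` is the category of finite-dimensional vector spaces. -/
abbrev GammaV := GammaCat k d (FGModuleCat.{u} k)

/-- The category of linear functors from `Γ^d 𝒱` to the category of all vector spaces: the
`d`-homogeneous strict polynomial functors whose values may be infinite-dimensional. -/
abbrev StrictPolyVect := (isLinearFunctor k (C := GammaV k d)).FullSubcategory

/-- The property of a functor `Γ^d 𝒱 ⥤ Vect` to be linear with finite-dimensional values. -/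
def isStrictPoly : ObjectProperty (GammaV k d ⥤ ModuleCat.{u} k) :=
  isLinearFunctor k ⊓ hasFiniteValues k (GammaV k d)

/-- The category `𝒫_d` of `d`-homogeneous strict polynomial functors, i.e. of linear functors
`Γ^d 𝒱 ⥤ 𝒱`. -/
abbrev StrictPoly := (isStrictPoly k d).FullSubcategory

/-- The category `𝒫_d^*` of `ℤ`-graded `d`-homogeneous strict polynomial functors. -/
abbrev GrStrictPoly := GradedObject ℤ (StrictPolyVect k d)

instance : (isStrictPoly k d).IsClosedUnderSubobjects where
  prop_of_mono f _ h := ⟨(isLinearFunctor k).prop_of_mono f h.1,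
    (hasFiniteValues k (GammaV k d)).prop_of_mono f h.2⟩

instance : (isStrictPoly k d).IsClosedUnderQuotients where
  prop_of_epi f _ h := ⟨(isLinearFunctor k).prop_of_epi f h.1,
    (hasFiniteValues k (GammaV k d)).prop_of_epi f h.2⟩

instance : (isStrictPoly k d).IsClosedUnderFiniteProducts where
  isClosedUnderLimitsOfShape J _ := ⟨by
    rintro F ⟨p⟩
    exact ⟨(isLinearFunctor k).prop_of_isLimit p.isLimit fun j => (p.prop_diag_obj j).1,
      (hasFiniteValues k (GammaV k d)).prop_of_isLimit p.isLimit fun j => (p.prop_diag_obj j).2⟩⟩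

instance : (isStrictPoly k d).ContainsZero where
  exists_zero := ⟨(Functor.const _).obj (ModuleCat.of k PUnit), by
    rw [Functor.isZero_iff]
    exact fun X => ModuleCat.isZero_of_subsingleton (ModuleCat.of k PUnit),
    ⟨⟨(ModuleCat.isZero_of_subsingleton (ModuleCat.of k PUnit)).eq_of_src _ _⟩,
      ⟨fun _ _ => (ModuleCat.isZero_of_subsingleton (ModuleCat.of k PUnit)).eq_of_src _ _⟩⟩,
    fun X => inferInstanceAs (Module.Finite k PUnit.{u + 1})⟩

/-- `𝒫_d` is an abelian category; its `Ext` groups are taken in the category `𝒫_d` itself. -/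
instance : HasExt.{u + 1} (StrictPoly k d) := HasExt.standard _

/-- Colimits in `𝒫_d^*` are computed degreewise. -/
instance (J : Type u) [SmallCategory J] : HasColimitsOfShape J (GrStrictPoly k d) where
  has_colimit F := HasColimit.mk
    { cocone :=
        { pt i := colimit (F ⋙ Pi.eval _ i)
          ι := { app j i := colimit.ι (F ⋙ Pi.eval _ i) j
                 naturality j j' f := by
                  funext i
                  exact (colimit.w (F ⋙ Pi.eval (fun _ => StrictPolyVect k d) i) f).trans
                    (Category.comp_id _).symm } }
      isColimit :=
        { desc s i := colimit.desc (F ⋙ Pi.eval _ i)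
            { pt := s.pt i
              ι := { app j := s.ι.app j i
                     naturality j j' f := congrFun (s.ι.naturality f) i } }
          fac s j := by
            funext i
            exact colimit.ι_desc (F := F ⋙ Pi.eval (fun _ => StrictPolyVect k d) i) _ _
          uniq s m w := by
            funext i
            refine colimit.hom_ext (F := F ⋙ Pi.eval (fun _ => StrictPolyVect k d) i) fun j => ?_
            exact (congrFun (w j) i).trans
              (colimit.ι_desc (F := F ⋙ Pi.eval (fun _ => StrictPolyVect k d) i)
                { pt := s.pt i
                  ι := { app j := s.ι.app j i
                         naturality j j' f := congrFun (s.ι.naturality f) i } } j).symm } }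

end StrictPolynomialFunctors

section Evaluation

variable {k : Type u} [Field k] {d : ℕ}

/-- The subspace of weight `j` of `F(W)`, for the action of the multiplicative group on `F(W)`
induced by its action of weight `i` on `W^i`, for all `i`. The coaction
`F(W) → F(W) ⊗ k[t, t⁻¹]` is `v ↦ ∑ᵢ F(wᵢ)(v) ⊗ tⁱ`, and `v` has weight `j` if it is
mapped to `v ⊗ tʲ`. -/
def weightSpace (F : GammaV k d ⥤ ModuleCat.{u} k) (W : GrFin k) (j : ℤ) :
    Submodule k (F.obj ((gammaFunctor d (total k)).obj ⟨W⟩)) where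
  carrier := {v | ∀ i, (F.map (weightHom d W i)).hom v = if i = j then v else 0}
  add_mem' {v w} hv hw i := by rw [map_add, hv i, hw i]; split_ifs <;> simp
  zero_mem' i := by simp
  smul_mem' c v hv i := by rw [map_smul, hv i]; split_ifs <;> simp

/-- The evaluation of `F` on graded vector spaces of finite total dimension, in degree `j`:
`F(W)^j` is the subspace of weight `j` of `F(W)`. It is a functor on `Γ^d 𝒱^*`. -/
def gradedEval (F : GammaV k d ⥤ ModuleCat.{u} k) (j : ℤ) :
    GammaCat k d (GrFin k) ⥤ ModuleCat.{u} k where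
  obj W := ModuleCat.of k (weightSpace F W.of j)
  map {W W'} x := ModuleCat.ofHom <|
    (F.map ((gammaFunctor d (total k)).map x)).hom.restrict
      (p := weightSpace F W.of j) (q := weightSpace F W'.of j) fun v hv i => by
      have h := congr($(congrArg F.map (weightHom_comm d x i)).hom v)
      rw [F.map_comp, F.map_comp] at h
      refine h.symm.trans ?_
      refine (congrArg (F.map ((gammaFunctor d (total k)).map x)).hom (hv i)).trans ?_
      split_ifs
      · rfl
      · exact map_zero _
  map_id W := ModuleCat.hom_ext <| LinearMap.ext fun v => Subtype.ext <| by
    change (F.map ((gammaFunctor d (total k)).map (𝟙 W))).hom v.1 = v.1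
    simp
  map_comp x y := ModuleCat.hom_ext <| LinearMap.ext fun v => Subtype.ext <| by
    change (F.map ((gammaFunctor d (total k)).map (x ≫ y))).hom v.1 =
      (F.map ((gammaFunctor d (total k)).map y)).hom
        ((F.map ((gammaFunctor d (total k)).map x)).hom v.1)
    simp

lemma isLinearFunctor_gradedEval {F : GammaV k d ⥤ ModuleCat.{u} k} (hF : isLinearFunctor k F)
    (j : ℤ) : isLinearFunctor k (gradedEval F j) := by
  have := hF.1
  have := hF.2
  refine ⟨⟨fun {X Y x y} => ?_⟩, ⟨fun {X Y} x r => ?_⟩⟩ <;>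
    refine ModuleCat.hom_ext <| LinearMap.ext fun v => Subtype.ext ?_
  · change (F.map ((gammaFunctor d (total k)).map (x + y))).hom v.1 =
      (F.map ((gammaFunctor d (total k)).map x)).hom v.1 +
        (F.map ((gammaFunctor d (total k)).map y)).hom v.1
    rw [Functor.map_add, Functor.map_add]
    rfl
  · change (F.map ((gammaFunctor d (total k)).map (r • x))).hom v.1 =
      r • (F.map ((gammaFunctor d (total k)).map x)).hom v.1
    rw [Functor.map_smul, Functor.map_smul]
    rfl

/-- The evaluation on graded vector spaces is natural in the functor. -/
def gradedEvalMap {F G : GammaV k d ⥤ ModuleCat.{u} k} (α : F ⟶ G) (j : ℤ) :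
    gradedEval F j ⟶ gradedEval G j where
  app W := ModuleCat.ofHom <|
    (α.app ((gammaFunctor d (total k)).obj W)).hom.restrict
      (p := weightSpace F W.of j) (q := weightSpace G W.of j) fun v hv i => by
      have h := congr($(α.naturality (weightHom d W.of i)).hom v)
      refine h.symm.trans ?_
      refine (congrArg (α.app ((gammaFunctor d (total k)).obj W)).hom (hv i)).trans ?_
      split_ifs
      · rfl
      · exact map_zero _
  naturality W W' x := ModuleCat.hom_ext <| LinearMap.ext fun v => Subtype.ext <|
    congr($(α.naturality ((gammaFunctor d (total k)).map x)).hom v.1)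

variable (k d) in
/-- The linear functors `Γ^d(E ⊗ -) : Γ^d 𝒱 ⥤ Γ^d 𝒱^*`, for `E` of finite total dimension. -/
def gammaTensor : GrFin k ⥤ GammaV k d ⥤ GammaCat k d (GrFin k) where
  obj E := gammaFunctor d (tensorFunctor E)
  map f := gammaNatTrans k d (tensorNatTrans f)
  map_id E := by rw [tensorNatTrans_id, gammaNatTrans_id]
  map_comp f g := by rw [tensorNatTrans_comp, gammaNatTrans_comp]

instance (E : GrFin k) : ((gammaTensor k d).obj E).Additive :=
  inferInstanceAs (gammaFunctor d (tensorFunctor E)).Additive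

instance (E : GrFin k) : ((gammaTensor k d).obj E).Linear k :=
  inferInstanceAs ((gammaFunctor d (tensorFunctor E)).Linear k)

/-- For `E` of finite total dimension, the functor `V ↦ F(E ⊗ V)^j`. -/
def paramObj (E : GrFin k) (F : StrictPoly k d) (j : ℤ) : StrictPolyVect k d where
  obj := (gammaTensor k d).obj E ⋙ gradedEval F.obj j
  property := by
    have := (isLinearFunctor_gradedEval F.property.1 j).1
    have := (isLinearFunctor_gradedEval F.property.1 j).2
    exact ⟨inferInstance, inferInstance⟩

lemma gradedEvalMap_id (F : GammaV k d ⥤ ModuleCat.{u} k) (j : ℤ) :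
    gradedEvalMap (𝟙 F) j = 𝟙 _ :=
  NatTrans.ext <| funext fun W => ModuleCat.hom_ext <| LinearMap.ext fun v => rfl

lemma gradedEvalMap_comp {F G H : GammaV k d ⥤ ModuleCat.{u} k} (α : F ⟶ G) (β : G ⟶ H) (j : ℤ) :
    gradedEvalMap (α ≫ β) j = gradedEvalMap α j ≫ gradedEvalMap β j :=
  NatTrans.ext <| funext fun W => ModuleCat.hom_ext <| LinearMap.ext fun v => rfl

/-- The morphism `F(E ⊗ V)^j ⟶ G(E ⊗ V)^j` induced by `α : F ⟶ G`. -/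
def paramObjMap (E : GrFin k) {F G : StrictPoly k d} (α : F ⟶ G) (j : ℤ) :
    paramObj E F j ⟶ paramObj E G j :=
  ObjectProperty.homMk
    (Functor.whiskerLeft ((gammaTensor k d).obj E) (gradedEvalMap α.hom j))

lemma paramObjMap_id (E : GrFin k) (F : StrictPoly k d) (j : ℤ) :
    paramObjMap E (𝟙 F) j = 𝟙 _ := by
  apply ObjectProperty.hom_ext
  change Functor.whiskerLeft _ (gradedEvalMap (𝟙 F.obj) j) = 𝟙 (_ ⋙ _)
  rw [gradedEvalMap_id, Functor.whiskerLeft_id']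

lemma paramObjMap_comp (E : GrFin k) {F G H : StrictPoly k d} (α : F ⟶ G) (β : G ⟶ H) (j : ℤ) :
    paramObjMap E (α ≫ β) j = paramObjMap E α j ≫ paramObjMap E β j := by
  apply ObjectProperty.hom_ext
  change Functor.whiskerLeft _ (gradedEvalMap (α.hom ≫ β.hom) j) = _
  rw [gradedEvalMap_comp, Functor.whiskerLeft_comp]
  rfl

variable (d) in
/-- For `E` of finite total dimension, the functor `F ↦ (V ↦ F(E ⊗ V))`. -/
def paramAt (E : GrFin k) : StrictPoly k d ⥤ GrStrictPoly k d where
  obj F j := paramObj E F j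
  map {F G} α j := paramObjMap E α j
  map_id F := funext fun j => paramObjMap_id E F j
  map_comp α β := funext fun j => paramObjMap_comp E α β j

/-- The morphism `F(E ⊗ V)^j ⟶ F(E' ⊗ V)^j` induced by `f : E ⟶ E'`. -/
def paramMap {E E' : GrFin k} (f : E ⟶ E') (F : StrictPoly k d) (j : ℤ) :
    paramObj E F j ⟶ paramObj E' F j :=
  ObjectProperty.homMk
    (Functor.whiskerRight ((gammaTensor k d).map f) (gradedEval F.obj j))

lemma whisker_comm {A B C : Type*} [Category* A] [Category* B] [Category* C] {P Q : A ⥤ B}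
    (γ : P ⟶ Q) {H K : B ⥤ C} (β : H ⟶ K) :
    Functor.whiskerLeft P β ≫ Functor.whiskerRight γ K =
      Functor.whiskerRight γ H ≫ Functor.whiskerLeft Q β := by
  ext V : 2
  exact (β.naturality (γ.app V)).symm

lemma paramMap_naturality {E E' : GrFin k} (f : E ⟶ E') {F G : StrictPoly k d} (α : F ⟶ G)
    (j : ℤ) : paramObjMap E α j ≫ paramMap f G j = paramMap f F j ≫ paramObjMap E' α j := by
  apply ObjectProperty.hom_ext
  rw [ObjectProperty.FullSubcategory.comp_hom, ObjectProperty.FullSubcategory.comp_hom]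
  exact whisker_comm ((gammaTensor k d).map f) (gradedEvalMap α.hom j)

lemma paramMap_id (E : GrFin k) (F : StrictPoly k d) (j : ℤ) : paramMap (𝟙 E) F j = 𝟙 _ := by
  apply ObjectProperty.hom_ext
  change Functor.whiskerRight ((gammaTensor k d).map (𝟙 E)) (gradedEval F.obj j) =
    𝟙 ((gammaTensor k d).obj E ⋙ gradedEval F.obj j)
  rw [CategoryTheory.Functor.map_id, Functor.whiskerRight_id']

lemma paramMap_comp {E E' E'' : GrFin k} (f : E ⟶ E') (g : E' ⟶ E'') (F : StrictPoly k d)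
    (j : ℤ) : paramMap (f ≫ g) F j = paramMap f F j ≫ paramMap g F j := by
  apply ObjectProperty.hom_ext
  change Functor.whiskerRight ((gammaTensor k d).map (f ≫ g)) (gradedEval F.obj j) =
    Functor.whiskerRight ((gammaTensor k d).map f) (gradedEval F.obj j) ≫
      Functor.whiskerRight ((gammaTensor k d).map g) (gradedEval F.obj j)
  rw [Functor.map_comp, Functor.whiskerRight_comp]

variable (k d) in
/-- For `E` of finite total dimension, the graded strict polynomial functor `V ↦ F(E ⊗ V)`,
as a functor of `E` and `F`. -/
def param : GrFin k ⥤ StrictPoly k d ⥤ GrStrictPoly k d where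
  obj E := paramAt d E
  map f :=
    { app F j := paramMap f F j
      naturality F G α := funext fun j => paramMap_naturality f α j }
  map_id E := NatTrans.ext <| funext fun F => funext fun j => paramMap_id E F j
  map_comp f g := NatTrans.ext <| funext fun F => funext fun j => paramMap_comp f g F j

end Evaluation

section Parametrisation

variable {k : Type u} [Field k]

/-- A family of subspaces `S^i ⊆ E^i`, as a graded vector space. -/
def subGr (E : GrVect k) (S : ∀ i, Submodule k (E i)) : GrVect k := fun i => ModuleCat.of k (S i)

/-- The inclusion of a graded subspace. -/
def subGrIncl (E : GrVect k) (S : ∀ i, Submodule k (E i)) : subGr E S ⟶ E :=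
  fun i => ModuleCat.ofHom (S i).subtype

/-- The poset of the graded subspaces of `E` of finite total dimension, ordered by inclusion. -/
abbrev FinSub (E : GrVect k) := {S : ∀ i, Submodule k (E i) // isFinTotal k (subGr E S)}

/-- The graded subspaces of finite total dimension, as a diagram. -/
def finSubDiagram (E : GrVect k) : FinSub E ⥤ GrFin k where
  obj S := ⟨subGr E S.1, S.2⟩
  map h := ⟨fun i => ModuleCat.ofHom (Submodule.inclusion (h.le i))⟩
  map_id _ := rfl
  map_comp _ _ := rfl

/-- The image of a graded subspace under a morphism. -/
def FinSub.map {E E' : GrVect k} (f : E ⟶ E') (S : FinSub E) : FinSub E' :=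
  ⟨fun i => (S.1 i).map (f i).hom, by
    have : Module.Finite k (⨁ i, S.1 i) := S.2
    exact Module.Finite.of_surjective
      (DirectSum.lmap fun i => (f i).hom.submoduleMap (S.1 i))
      ((DirectSum.lmap_surjective _).2 fun i => LinearMap.submoduleMap_surjective _ _)⟩

lemma FinSub.map_mono {E E' : GrVect k} (f : E ⟶ E') {S T : FinSub E} (h : S ≤ T) :
    S.map f ≤ T.map f := fun i => Submodule.map_mono (h i)

/-- The morphism `S ⟶ f(S)` induced by `f`. -/
def FinSub.restr {E E' : GrVect k} (f : E ⟶ E') (S : FinSub E) :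
    (finSubDiagram E).obj S ⟶ (finSubDiagram E').obj (S.map f) :=
  ⟨fun i => ModuleCat.ofHom ((f i).hom.submoduleMap (S.1 i))⟩

variable {d : ℕ}

variable (d) in
/-- The lower parametrisation by `E`, as a functor `𝒫_d ⥤ 𝒫_d^*`: on objects,
`F_E = colim F_S` over the poset of the graded subspaces `S ⊆ E` of finite total dimension. -/
def lowerAt (E : GrVect k) : StrictPoly k d ⥤ GrStrictPoly k d :=
  (param k d).flip ⋙ (Functor.whiskeringLeft _ _ _).obj (finSubDiagram E) ⋙ colim

/-- The canonical morphism `F_S ⟶ F_E`. -/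
def lowerι (E : GrVect k) (F : StrictPoly k d) (S : FinSub E) :
    ((param k d).obj ((finSubDiagram E).obj S)).obj F ⟶ (lowerAt d E).obj F :=
  colimit.ι (finSubDiagram E ⋙ (param k d).flip.obj F) S

lemma lowerι_w (E : GrVect k) (F : StrictPoly k d) {S T : FinSub E} (h : S ⟶ T) :
    ((param k d).map ((finSubDiagram E).map h)).app F ≫ lowerι E F T = lowerι E F S :=
  colimit.w (finSubDiagram E ⋙ (param k d).flip.obj F) h

lemma lowerι_naturality (E : GrVect k) {F G : StrictPoly k d} (α : F ⟶ G) (S : FinSub E) :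
    lowerι E F S ≫ (lowerAt d E).map α =
      ((param k d).obj ((finSubDiagram E).obj S)).map α ≫ lowerι E G S :=
  ι_colimMap _ _

lemma lower_hom_ext {E : GrVect k} {F : StrictPoly k d} {X : GrStrictPoly k d}
    {a b : (lowerAt d E).obj F ⟶ X} (h : ∀ S, lowerι E F S ≫ a = lowerι E F S ≫ b) : a = b :=
  colimit.hom_ext h

/-- The morphism `F_E ⟶ F_E'` induced by `f : E ⟶ E'`. -/
def lowerMap {E E' : GrVect k} (f : E ⟶ E') (F : StrictPoly k d) :
    (lowerAt d E).obj F ⟶ (lowerAt d E').obj F :=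
  colimit.desc (finSubDiagram E ⋙ (param k d).flip.obj F)
    { pt := (lowerAt d E').obj F
      ι :=
        { app S := ((param k d).map (S.restr f)).app F ≫ lowerι E' F (S.map f)
          naturality S T h := by
            refine Eq.trans ?_ (Category.comp_id _).symm
            rw [← lowerι_w E' F (homOfLE (FinSub.map_mono f h.le))]
            change ((param k d).map ((finSubDiagram E).map h)).app F ≫ _ = _
            rw [← Category.assoc, ← Category.assoc, ← NatTrans.comp_app, ← NatTrans.comp_app,
              ← Functor.map_comp, ← Functor.map_comp]
            rfl } }

lemma lowerι_lowerMap {E E' : GrVect k} (f : E ⟶ E') (F : StrictPoly k d) (S : FinSub E) :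
    lowerι E F S ≫ lowerMap f F =
      ((param k d).map (S.restr f)).app F ≫ lowerι E' F (S.map f) :=
  colimit.ι_desc _ _

variable (k d) in
/-- The lower parametrisation `(E, F) ↦ F_E`. -/
def lower : GrVect k ⥤ StrictPoly k d ⥤ GrStrictPoly k d where
  obj E := lowerAt d E
  map {E E'} f :=
    { app F := lowerMap f F
      naturality F G α := lower_hom_ext fun S => by
        rw [← Category.assoc, lowerι_naturality, Category.assoc, lowerι_lowerMap,
          ← Category.assoc (lowerι E F S), lowerι_lowerMap, Category.assoc, lowerι_naturality,
          ← Category.assoc, ← Category.assoc, NatTrans.naturality] }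
  map_id E := NatTrans.ext <| funext fun F => lower_hom_ext fun S => by
    have h : S ≤ S.map (𝟙 E) := fun i x hx => ⟨x, hx, rfl⟩
    refine (lowerι_lowerMap _ _ _).trans ?_
    refine Eq.trans ?_ (Category.comp_id _).symm
    rw [← lowerι_w E F (homOfLE h)]
    rfl
  map_comp {E E' E''} f g := NatTrans.ext <| funext fun F => lower_hom_ext fun S => by
    have h : S.map (f ≫ g) ≤ (S.map f).map g := by
      rintro i _ ⟨x, hx, rfl⟩
      exact ⟨_, ⟨x, hx, rfl⟩, rfl⟩
    change lowerι E F S ≫ lowerMap (f ≫ g) F = lowerι E F S ≫ lowerMap f F ≫ lowerMap g F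
    rw [lowerι_lowerMap, ← Category.assoc, lowerι_lowerMap, Category.assoc, lowerι_lowerMap,
      ← lowerι_w E'' F (homOfLE h), ← Category.assoc, ← Category.assoc, ← NatTrans.comp_app,
      ← NatTrans.comp_app, ← Functor.map_comp, ← Functor.map_comp]
    rfl

variable (k) in
/-- The graded dual `Hom_k(E, k)`: its component of degree `i` is `Hom_k(E^{-i}, k)`. -/
def grDual : (GrVect k)ᵒᵖ ⥤ GrVect k where
  obj E i := ModuleCat.of k (Module.Dual k (E.unop (-i)))
  map f i := ModuleCat.ofHom (f.unop (-i)).hom.dualMap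
  map_id _ := rfl
  map_comp _ _ := rfl

variable (k d) in
/-- The upper parametrisation `(E, F) ↦ F^E = F_{Hom_k(E, k)}`. -/
def upper : (GrVect k)ᵒᵖ ⥤ StrictPoly k d ⥤ GrStrictPoly k d := grDual k ⋙ lower k d

/-- `E` is degreewise finite-dimensional and zero in negative degrees. -/
structure IsNonnegFinite (E : GrVect k) : Prop where
  finite : ∀ i, Module.Finite k (E i)
  nonneg : ∀ i < 0, Subsingleton (E i)

/-- The graded subspace of `E` which is `E` in degrees `≤ i` and zero in degrees `> i`. -/
def truncSub (E : GrVect k) (i : ℤ) : ∀ j, Submodule k (E j) := fun j => if j ≤ i then ⊤ else ⊥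

/-- A linear functor `Γ^d 𝒱 ⥤ Vect` with finite-dimensional values, as an object of `𝒫_d`. -/
abbrev toStrictPoly (X : StrictPolyVect k d) (hX : hasFiniteValues k (GammaV k d) X.obj) :
    StrictPoly k d := ⟨X.obj, X.property, hX⟩

/-- A morphism between linear functors with finite-dimensional values, as a morphism of `𝒫_d`. -/
abbrev toStrictPolyMap {X Y : StrictPolyVect k d} (f : X ⟶ Y)
    (hX : hasFiniteValues k (GammaV k d) X.obj) (hY : hasFiniteValues k (GammaV k d) Y.obj) :
    toStrictPoly X hX ⟶ toStrictPoly Y hY := ObjectProperty.homMk f.hom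

end Parametrisation

end StrictPolynomial

end

open StrictPolynomial

/-! Parts (1) to (3) come from the weight idempotents. The identity of a graded space `W` of finite
total dimension is the sum of its degree projections `π_a`; expanding `id^{⊗ d}` and grouping the
tuples by their sum gives orthogonal elements `w_j` with sum `1` in `Γ^d End(W)` (`sum_weightHom`,
`weightHom_comp`). A linear functor `F` therefore splits `F(W)` into its weight spaces, and `F(W)^j`
is a retract of `F(W)`, naturally in `W` and in `F`. Hence `F ↦ F(W)^j` is exact, being a retract of
an evaluation functor. The graded subspaces of `E` of finite total dimension form a directed poset,
so degreewise and pointwise `F ↦ F_E` is a filtered colimit of exact functors. When `E` itself has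
finite total dimension the poset has a greatest element, and the colimit is `F(E ⊗ -)`.

If `E` lives in nonnegative degrees, a tuple of degrees of `E` with sum `j` has all its entries at
most `j`. Thus weight `j` only sees the part of `E` in degrees `≤ j`, and the projector onto degrees
`≤ i` acts as the identity on `(F_E)^j` for `j ≤ i` (`lowerMap_apply_eq_id`). The same holds for the
dual of `E` with all signs reversed.

For (4), both `(G_E)^j` and `(F^E)^{-j}` may thus be computed with `U = E^{≤ j}`, of finite total
dimension. Evaluation and coevaluation make `U ⊗ -` left adjoint to `U^∨ ⊗ -`; after applying `Γ^d`,
precomposition makes `F ↦ F(U^∨ ⊗ -)` left adjoint to `G ↦ G(U ⊗ -)`. Evaluation pairs degree `a`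
with degree `-a`, so weight `j` on one side matches weight `-j` on the other (`tensorDuality`), and
the adjunction restricts to the summands `F(U^∨ ⊗ -)^{-j}` and `G(U ⊗ -)^j` (`paramAdjunction`).
Both functors are exact, so the adjunction passes to `Ext` (`adjunctionLinearEquiv`).

No resolutions are used for this last step. A class of positive degree is killed by some epimorphism
onto its source, so every class is built from a morphism by Yoneda products with classes of short
exact sequences (`induction_extClass`). This reduces the naturality of units and counits on `Ext` to
morphisms and short exact sequences. Naturality in `E` follows because the maps induced by `E ⟶ E'`
on the two sides are mates, by dinaturality of the coevaluation. -/

/-! ### Dévissage of `Ext` classes, and adjunctions between exact functors -/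

section ExtDevissage

open DerivedCategory HomologicalComplex

namespace CategoryTheory.Abelian.Ext

universe w w' w'' u₁ v₁ u₂ v₂ u₃ v₃

variable {C : Type u₁} [Category.{v₁} C] [Abelian C]

/-- A quasi-isomorphism from a complex in nonpositive degrees to a single complex in degree `0` is
an epimorphism in degree `0`. -/
lemma epi_f_comp_singleObjXSelf_hom {X : C} {K : CochainComplex C ℤ} [K.IsStrictlyLE 0]
    (π : K ⟶ (single C (ComplexShape.up ℤ) 0).obj X) [QuasiIso π] :
    Epi (π.f 0 ≫ (singleObjXSelf (ComplexShape.up ℤ) 0 X).hom) := by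
  -- `K` vanishes in degree `1`, so all of `K.X 0` consists of cycles; up to isomorphisms the map is
  -- then the projection of cycles onto homology.
  let e := K.iCyclesIso 0 1 (by simp) ((K.isZero_of_isStrictlyLE 0 1 (by simp)).eq_of_tgt _ _)
  have h : e.hom ≫ π.f 0 ≫ (singleObjXSelf (ComplexShape.up ℤ) 0 X).hom =
      K.homologyπ 0 ≫ homologyMap π 0 ≫
        (singleObjHomologySelfIso (ComplexShape.up ℤ) 0 X).hom := by
    rw [homologyπ_naturality_assoc, homologyπ_singleObjHomologySelfIso_hom, ← cancel_mono
      (singleObjXSelf (ComplexShape.up ℤ) 0 X).inv]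
    simp only [Category.assoc, Iso.hom_inv_id, Category.comp_id]
    rw [← Iso.eq_inv_comp, singleObjCyclesSelfIso_hom]
    simp [e]
  have : IsIso (homologyMap π 0) := inferInstance
  have : Epi (e.hom ≫ π.f 0 ≫ (singleObjXSelf (ComplexShape.up ℤ) 0 X).hom) := by
    rw [h]
    exact epi_comp _ _
  exact epi_of_epi e.hom _

/-- A morphism from a single complex in degree `0` to a complex in negative degrees vanishes in the
derived category after precomposition with an epimorphism of the source. -/
lemma exists_epi_Q_map_comp_eq_zero [HasDerivedCategory.{w} C] {X : C} {L : CochainComplex C ℤ}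
    (φ : Q.obj ((single C (ComplexShape.up ℤ) 0).obj X) ⟶ Q.obj L)
    (n : ℤ) (hn : n < 0) [L.IsStrictlyLE n] :
    ∃ (X' : C) (p : X' ⟶ X) (_ : Epi p),
      Q.map ((single C (ComplexShape.up ℤ) 0).map p) ≫ φ = 0 := by
  have : CochainComplex.IsStrictlyLE ((single C (ComplexShape.up ℤ) 0).obj X) 0 :=
    inferInstanceAs (((CochainComplex.singleFunctor C 0).obj X).IsStrictlyLE 0)
  -- Write `φ` as a right fraction whose apex `K` lives in nonpositive degrees, so that `K.X 0`
  -- surjects onto `X`.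
  obtain ⟨K, _, π, h, g, rfl⟩ := right_fac_of_isStrictlyLE φ 0
  have hπ := h
  rw [isIso_Q_map_iff_quasiIso] at h
  -- `K.X 0` is a subcomplex of `K` because the differential leaving degree `0` vanishes. Composed
  -- with the numerator `g` it lands in degree `0` of `L`, which is zero.
  let σ : (single C (ComplexShape.up ℤ) 0).obj (K.X 0) ⟶ K :=
    mkHomFromSingle (𝟙 _) (by
      rintro _ rfl
      exact (K.isZero_of_isStrictlyLE 0 _ (by simp)).eq_of_tgt _ _)
  have hσ : (single C (ComplexShape.up ℤ) 0).map
      (π.f 0 ≫ (singleObjXSelf (ComplexShape.up ℤ) 0 X).hom) = σ ≫ π := by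
    apply HomologicalComplex.from_single_hom_ext
    rw [comp_f, mkHomFromSingle_f, single_map_f_self]
    simp
  have hg : σ ≫ g = 0 :=
    HomologicalComplex.from_single_hom_ext ((L.isZero_of_isStrictlyLE n 0 hn).eq_of_tgt _ _)
  refine ⟨K.X 0, _, epi_f_comp_singleObjXSelf_hom π, ?_⟩
  rw [hσ, Q.map_comp, Category.assoc, IsIso.hom_inv_id_assoc, ← Q.map_comp, hg, Q.map_zero]

variable [HasExt.{w} C]

/-- Positive degree `Ext` classes are killed by an epimorphism onto the source. -/
lemma exists_epi_comp_eq_zero {X Y : C} {n : ℕ} (x : Ext X Y (n + 1)) :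
    ∃ (X' : C) (p : X' ⟶ X) (_ : Epi p), (mk₀ p).comp x (zero_add (n + 1)) = 0 := by
  let := HasDerivedCategory.standard C
  -- The shift of `Y` by `n + 1` is the single complex with `Y` in degree `-(n + 1)`, which is
  -- negative.
  obtain ⟨X', p, hp, h⟩ := exists_epi_Q_map_comp_eq_zero
    (L := (CochainComplex.singleFunctor C (-(n + 1 : ℤ))).obj Y)
    (x.hom ≫ ((singleFunctors C).shiftIso (n + 1) (-(n + 1)) 0 (by lia)).hom.app Y)
    (-(n + 1)) (by lia)
  refine ⟨X', p, hp, homEquiv.injective ?_⟩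
  rw [← cancel_mono (((singleFunctors C).shiftIso (n + 1) (-(n + 1)) 0 (by lia)).hom.app Y)]
  change (mk₀ p |>.comp x _).hom ≫ _ = (0 : Ext X' Y (n + 1)).hom ≫ _
  rw [comp_hom, mk₀_hom, ShiftedHom.mk₀_comp, zero_hom, Limits.zero_comp, Category.assoc]
  exact h

/-- Every property of `Ext` classes which holds for morphisms and is stable under Yoneda product
with the class of a short exact sequence holds for all classes. -/
lemma induction_extClass {motive : ∀ {X Y : C} {n : ℕ}, Ext X Y n → Prop}
    (mk₀ : ∀ {X Y : C} (f : X ⟶ Y), motive (mk₀ f))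
    (comp : ∀ {S : ShortComplex C} (hS : S.ShortExact) {Y : C} {n : ℕ} (x : Ext S.X₁ Y n),
      motive x → motive (hS.extClass.comp x (add_comm 1 n)))
    {X Y : C} {n : ℕ} (x : Ext X Y n) : motive x := by
  induction n generalizing X with
  | zero =>
    obtain ⟨f, rfl⟩ := (mk₀_bijective X Y).2 x
    exact mk₀ f
  | succ n ih =>
    -- Dimension shifting: a class which dies on `X'` is, by the long exact sequence of `0 → ker p →
    -- X' → X → 0`, the product of the extension class with a class on `ker p` of degree one less.
    obtain ⟨X', p, hp, h⟩ := exists_epi_comp_eq_zero x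
    have hS : (ShortComplex.mk _ _ (kernel.condition p)).ShortExact :=
      { exact := ShortComplex.exact_of_f_is_kernel _ (kernelIsKernel p) }
    obtain ⟨y, rfl⟩ := contravariant_sequence_exact₃ hS Y x h (add_comm 1 n)
    exact comp hS y (ih y)

variable {D : Type u₂} [Category.{v₂} D] [Abelian D] [HasExt.{w'} D]

section

variable (F G : C ⥤ D) [F.Additive] [PreservesFiniteLimits F] [PreservesFiniteColimits F]
  [G.Additive] [PreservesFiniteLimits G] [PreservesFiniteColimits G]

-- By dévissage two cases remain: naturality of `τ` on morphisms, and naturality of the class of a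
-- short exact sequence along the morphism of sequences induced by `τ`.
variable {F G} in
lemma mapExactFunctor_comp_mk₀_app (τ : F ⟶ G) {X Y : C} {n : ℕ} (x : Ext X Y n) :
    (x.mapExactFunctor F).comp (mk₀ (τ.app Y)) (add_zero n) =
      (mk₀ (τ.app X)).comp (x.mapExactFunctor G) (zero_add n) := by
  induction x using induction_extClass with
  | mk₀ f => simp [mapExactFunctor_mk₀]
  | @comp S hS _ _ x ih =>
    rw [mapExactFunctor_comp, mapExactFunctor_comp, comp_assoc_of_third_deg_zero, ih,
      mapExactFunctor_extClass, mapExactFunctor_extClass]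
    have h := ShortComplex.ShortExact.extClass_naturality (hS.map_of_exact F) (hS.map_of_exact G)
      (S.mapNatTrans τ)
    refine (comp_assoc_of_second_deg_zero (hS.map_of_exact F).extClass (mk₀ (τ.app S.X₁))
      (x.mapExactFunctor G) (add_comm 1 _)).symm.trans ?_
    refine (congrArg (fun z => comp z (x.mapExactFunctor G) (add_comm 1 _)) h).trans ?_
    exact comp_assoc (mk₀ (τ.app S.X₃)) (hS.map_of_exact G).extClass (x.mapExactFunctor G)
      (zero_add 1) (add_comm 1 _) (by omega)

lemma mapExactFunctor_id {X Y : C} {n : ℕ} (x : Ext X Y n) :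
    x.mapExactFunctor (𝟭 C) = x := by
  induction x using induction_extClass with
  | mk₀ f => simp [mapExactFunctor_mk₀]
  | @comp S hS _ _ x ih =>
    rw [mapExactFunctor_comp, ih, mapExactFunctor_extClass]
    rfl

variable {E : Type u₃} [Category.{v₃} E] [Abelian E] [HasExt.{w''} E] (H : D ⥤ E)
  [H.Additive] [PreservesFiniteLimits H] [PreservesFiniteColimits H]

lemma mapExactFunctor_mapExactFunctor [(F ⋙ H).Additive] [PreservesFiniteLimits (F ⋙ H)]
    [PreservesFiniteColimits (F ⋙ H)] {X Y : C} {n : ℕ} (x : Ext X Y n) :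
    x.mapExactFunctor (F ⋙ H) = (x.mapExactFunctor F).mapExactFunctor H := by
  induction x using induction_extClass with
  | mk₀ f => simp [mapExactFunctor_mk₀]
  | @comp S hS _ _ x ih =>
    rw [mapExactFunctor_comp, mapExactFunctor_comp, mapExactFunctor_comp, ih]
    refine congrArg (fun z => comp z _ (add_comm 1 _)) ?_
    rw [mapExactFunctor_extClass, mapExactFunctor_extClass]
    exact (mapExactFunctor_extClass H (hS.map_of_exact F)).symm

end

section Adjunction

variable {L : D ⥤ C} {R : C ⥤ D} (adj : L ⊣ R)
  [L.Additive] [PreservesFiniteLimits L] [PreservesFiniteColimits L]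
  [R.Additive] [PreservesFiniteLimits R] [PreservesFiniteColimits R]

/-- Naturality of the counit, extended from morphisms to `Ext` classes; with its analogue for the
unit, this allows the usual triangle identity argument to run on `Ext`. -/
lemma mapExactFunctor_comp_counit {X Y : C} {n : ℕ} (x : Ext X Y n) :
    ((x.mapExactFunctor R).mapExactFunctor L).comp (mk₀ (adj.counit.app Y)) (add_zero n) =
      (mk₀ (adj.counit.app X)).comp x (zero_add n) := by
  have h := mapExactFunctor_comp_mk₀_app adj.counit x
  rw [mapExactFunctor_mapExactFunctor, mapExactFunctor_id] at h
  exact h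

lemma unit_comp_mapExactFunctor {X Y : D} {n : ℕ} (x : Ext X Y n) :
    (mk₀ (adj.unit.app X)).comp ((x.mapExactFunctor L).mapExactFunctor R) (zero_add n) =
      x.comp (mk₀ (adj.unit.app Y)) (add_zero n) := by
  have h := mapExactFunctor_comp_mk₀_app adj.unit x
  rw [mapExactFunctor_mapExactFunctor, mapExactFunctor_id] at h
  exact h.symm

variable (k : Type*) [Ring k] [Linear k C] [Linear k D] [R.Linear k]

/-- An adjunction between exact functors induces isomorphisms on `Ext`. -/
noncomputable def adjunctionLinearEquiv (X : D) (Y : C) (n : ℕ) :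
    Ext (L.obj X) Y n ≃ₗ[k] Ext X (R.obj Y) n where
  toFun x := (mk₀ (adj.unit.app X)).comp (x.mapExactFunctor R) (zero_add n)
  map_add' x y := by simp
  map_smul' r x := by rw [Functor.mapExactFunctor_smul, comp_smul, RingHom.id_apply]
  invFun y := (y.mapExactFunctor L).comp (mk₀ (adj.counit.app Y)) (add_zero n)
  left_inv x := by
    dsimp only
    rw [mapExactFunctor_comp, mapExactFunctor_mk₀, comp_assoc_of_third_deg_zero,
      mapExactFunctor_comp_counit, mk₀_comp_mk₀_assoc, adj.left_triangle_components, mk₀_id_comp]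
  right_inv y := by
    dsimp only
    rw [mapExactFunctor_comp, mapExactFunctor_mk₀, ← comp_assoc_of_third_deg_zero,
      unit_comp_mapExactFunctor, comp_assoc_of_third_deg_zero, mk₀_comp_mk₀,
      adj.right_triangle_components, comp_mk₀_id]

lemma adjunctionLinearEquiv_apply {X : D} {Y : C} {n : ℕ} (x : Ext (L.obj X) Y n) :
    adjunctionLinearEquiv adj k X Y n x =
      (mk₀ (adj.unit.app X)).comp (x.mapExactFunctor R) (zero_add n) := rfl

lemma adjunctionLinearEquiv_naturality_left {X' X : D} (f : X' ⟶ X) {Y : C} {n : ℕ}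
    (x : Ext (L.obj X) Y n) :
    adjunctionLinearEquiv adj k X' Y n ((mk₀ (L.map f)).comp x (zero_add n)) =
      (mk₀ f).comp (adjunctionLinearEquiv adj k X Y n x) (zero_add n) := by
  simp only [adjunctionLinearEquiv_apply, mapExactFunctor_comp, mapExactFunctor_mk₀]
  refine (mk₀_comp_mk₀_assoc _ _ _).trans ?_
  refine Eq.trans ?_ (mk₀_comp_mk₀_assoc _ _ _).symm
  exact congrArg (fun z => (mk₀ z).comp _ _) (adj.unit.naturality f).symm

lemma adjunctionLinearEquiv_naturality_right {X : D} {Y Y' : C} (g : Y ⟶ Y') {n : ℕ}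
    (x : Ext (L.obj X) Y n) :
    adjunctionLinearEquiv adj k X Y' n (x.comp (mk₀ g) (add_zero n)) =
      (adjunctionLinearEquiv adj k X Y n x).comp (mk₀ (R.map g)) (add_zero n) := by
  simp only [adjunctionLinearEquiv_apply, mapExactFunctor_comp, mapExactFunctor_mk₀,
    comp_assoc_of_third_deg_zero]

variable {L' : D ⥤ C} {R' : C ⥤ D} (adj' : L' ⊣ R')
  [L'.Additive] [PreservesFiniteLimits L'] [PreservesFiniteColimits L']
  [R'.Additive] [PreservesFiniteLimits R'] [PreservesFiniteColimits R'] [R'.Linear k]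

/-- The hypothesis `h` says that `l` and `r` are mates under the two adjunctions. This is what
naturality in `E` needs, since the adjunction itself varies with `E`. -/
lemma adjunctionLinearEquiv_conjugate (l : L' ⟶ L) (r : R ⟶ R')
    (h : ∀ X, adj.unit.app X ≫ r.app (L.obj X) = adj'.unit.app X ≫ R'.map (l.app X))
    {X : D} {Y : C} {n : ℕ} (x : Ext (L.obj X) Y n) :
    adjunctionLinearEquiv adj' k X Y n ((mk₀ (l.app X)).comp x (zero_add n)) =
      (adjunctionLinearEquiv adj k X Y n x).comp (mk₀ (r.app Y)) (add_zero n) := by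
  simp only [adjunctionLinearEquiv_apply, mapExactFunctor_comp, mapExactFunctor_mk₀,
    comp_assoc_of_third_deg_zero, mapExactFunctor_comp_mk₀_app]
  refine (mk₀_comp_mk₀_assoc _ _ _).trans ?_
  refine Eq.trans ?_ (mk₀_comp_mk₀_assoc _ _ _).symm
  exact congrArg (fun z => (mk₀ z).comp _ _) (h X).symm

end Adjunction

end CategoryTheory.Abelian.Ext

end ExtDevissage

noncomputable section

namespace StrictPolynomial

/-! ### Weight idempotents and the weight decomposition -/

section WeightDecomposition

variable {k : Type u} [Field k] {d : ℕ}

lemma gradProj_comp_self (W : GrFin k) (i : ℤ) : gradProj W i ≫ gradProj W i = gradProj W i :=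
  FGModuleCat.hom_ext <| LinearMap.ext fun (x : ⨁ i, W.obj i) => by
    change DirectSum.lof k ℤ (fun i => W.obj i) i
      ((DirectSum.lof k ℤ (fun i => W.obj i) i (x i)) i) = DirectSum.lof k ℤ _ i (x i)
    simp [DirectSum.lof_eq_of]

lemma gradProj_comp_of_ne (W : GrFin k) {i j : ℤ} (h : i ≠ j) :
    gradProj W i ≫ gradProj W j = 0 :=
  FGModuleCat.hom_ext <| LinearMap.ext fun (x : ⨁ i, W.obj i) => by
    change DirectSum.lof k ℤ (fun i => W.obj i) j
      ((DirectSum.lof k ℤ (fun i => W.obj i) i (x i)) j) = 0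
    exact (congrArg _ (DirectSum.of_eq_of_ne (β := fun i => W.obj i) i j (x i) h.symm)).trans
      (map_zero _)

lemma sum_gradProj (W : GrFin k) : ∑ i ∈ gradSupport W, gradProj W i = 𝟙 ((total k).obj W) := by
  refine FGModuleCat.hom_ext <| DirectSum.linearMap_ext k fun i => LinearMap.ext fun x => ?_
  let ev : ((total k).obj W ⟶ (total k).obj W) →+ ⨁ i, W.obj i :=
    { toFun := fun f => f.hom.hom (DirectSum.lof k ℤ (fun i => W.obj i) i x)
      map_zero' := rfl
      map_add' := fun _ _ => rfl }
  have hev (j : ℤ) : ev (gradProj W j) =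
      if j = i then DirectSum.lof k ℤ (fun i => W.obj i) i x else 0 := by
    change DirectSum.lof k ℤ (fun i => W.obj i) j
      ((DirectSum.lof k ℤ (fun i => W.obj i) i x) j) = _
    split_ifs with h
    · subst h
      simp [DirectSum.lof_eq_of]
    · rw [DirectSum.lof_eq_of, DirectSum.lof_eq_of, DirectSum.of_eq_of_ne _ _ _ h, map_zero]
  change ev (∑ j ∈ gradSupport W, gradProj W j) = DirectSum.lof k ℤ (fun i => W.obj i) i x
  rw [map_sum, Finset.sum_congr rfl fun j _ => hev j, Finset.sum_ite_eq' _ i]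
  split_ifs with h
  · rfl
  -- For `i` outside the support, the vector equals its own projection, and that projection is zero.
  · rw [← hev i |>.trans (if_pos rfl), gradProj_eq_zero h, map_zero]

/-- The set of the weights which may occur in a functor evaluated on `W`. -/
def weightSupport (d : ℕ) (W : GrFin k) : Finset ℤ :=
  (Fintype.piFinset fun _ : Fin d => gradSupport W).image fun a => ∑ m, a m

lemma weightHom_eq_zero {W : GrFin k} {j : ℤ} (hj : j ∉ weightSupport d W) :
    weightHom d W j = 0 := by
  refine Subtype.ext (Finset.sum_eq_zero fun a ha => (hj ?_).elim)
  rw [Finset.mem_filter] at ha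
  exact Finset.mem_image.2 ⟨a, ha.1, ha.2⟩

/-- Expand `(∑ π_a)^{⊗ d}` by multilinearity and group the tuples by their sum. -/
lemma sum_weightHom (W : GrFin k) :
    ∑ j ∈ weightSupport d W, weightHom d W j = 𝟙 _ := by
  refine Subtype.ext ?_
  change (Submodule.subtype _) (∑ j ∈ weightSupport d W, weightHom d W j) =
    PiTensorProduct.tprod k fun _ => 𝟙 ((total k).obj W)
  rw [map_sum, ← sum_gradProj W, MultilinearMap.map_sum_finset]
  exact Finset.sum_fiberwise_of_maps_to (fun a ha => Finset.mem_image_of_mem _ ha) _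

lemma map₂_weightTensor_tprod {X : FGModuleCat.{u} k} (W : GrFin k) (j : ℤ) (s : Finset ℤ)
    (f : Fin d → ((total k).obj W ⟶ X)) :
    PiTensorProduct.map₂ (fun _ => Linear.comp (S := k) _ _ _) (weightTensor d W j s)
      (PiTensorProduct.tprod k f) =
    ∑ a ∈ Fintype.piFinset (fun _ : Fin d => s) with ∑ m, a m = j,
      PiTensorProduct.tprod k fun m => gradProj W (a m) ≫ f m := by
  simp [weightTensor, map_sum, LinearMap.sum_apply, PiTensorProduct.map₂_tprod_tprod]

lemma map₂_tprod_weightTensor {X : FGModuleCat.{u} k} (W : GrFin k) (j : ℤ) (s : Finset ℤ)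
    (f : Fin d → (X ⟶ (total k).obj W)) :
    PiTensorProduct.map₂ (fun _ => Linear.comp (S := k) _ _ _)
      (PiTensorProduct.tprod k f) (weightTensor d W j s) =
    ∑ a ∈ Fintype.piFinset (fun _ : Fin d => s) with ∑ m, a m = j,
      PiTensorProduct.tprod k fun m => f m ≫ gradProj W (a m) := by
  simp [weightTensor, map_sum, PiTensorProduct.map₂_tprod_tprod]

/-- Elementary tensors compose factor by factor, and distinct degree projections compose to zero.
Only pairs of equal tuples survive, and a tuple has only one sum. -/
lemma weightHom_comp (W : GrFin k) (i j : ℤ) :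
    weightHom d W i ≫ weightHom d W j = if i = j then weightHom d W i else 0 := by
  refine Subtype.ext ?_
  have key : (weightHom d W i ≫ weightHom d W j).1 =
      ∑ b ∈ Fintype.piFinset (fun _ : Fin d => gradSupport W) with ∑ m, b m = j,
        if ∑ m, b m = i then PiTensorProduct.tprod k fun m => gradProj W (b m) else 0 := by
    rw [comp_val]
    change PiTensorProduct.map₂ _ (weightTensor d W i _)
      (∑ b ∈ Fintype.piFinset (fun _ : Fin d => gradSupport W) with ∑ m, b m = j,
        PiTensorProduct.tprod k fun m => gradProj W (b m)) = _
    rw [map_sum]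
    refine Finset.sum_congr rfl fun b hb => (map₂_weightTensor_tprod _ _ _ _).trans ?_
    have hne (a : Fin d → ℤ) (hab : a ≠ b) :
        PiTensorProduct.tprod k (fun m => gradProj W (a m) ≫ gradProj W (b m)) = 0 := by
      obtain ⟨m, hm⟩ := Function.ne_iff.1 hab
      exact MultilinearMap.map_coord_zero _ m (gradProj_comp_of_ne W hm)
    split_ifs with h
    · refine (Finset.sum_eq_single_of_mem b
        (Finset.mem_filter.2 ⟨(Finset.mem_filter.1 hb).1, h⟩) fun a _ hab => hne a hab).trans ?_
      exact congrArg _ (funext fun m => gradProj_comp_self W (b m))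
    · refine Finset.sum_eq_zero fun a ha => hne a ?_
      rintro rfl
      exact h (Finset.mem_filter.1 ha).2
  rw [key]
  split_ifs with h
  · subst h
    exact Finset.sum_congr rfl fun b hb => if_pos (Finset.mem_filter.1 hb).2
  · exact Finset.sum_eq_zero fun b hb => if_neg fun h' =>
      h (h'.symm.trans (Finset.mem_filter.1 hb).2)

variable (F : GammaV k d ⥤ ModuleCat.{u} k)

lemma map_weightHom_mem (hF : isLinearFunctor k F) (W : GrFin k) (j : ℤ)
    (v : F.obj ((gammaFunctor d (total k)).obj ⟨W⟩)) :
    (F.map (weightHom d W j)).hom v ∈ weightSpace F W j := fun i => by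
  have := hF.1
  rw [← ModuleCat.comp_apply, ← F.map_comp, weightHom_comp]
  by_cases h : j = i
  · rw [if_pos h, if_pos h.symm]
  · rw [if_neg h, if_neg (Ne.symm h), F.map_zero]
    rfl

lemma map_weightHom_of_mem {W : GrFin k} {j : ℤ}
    {v : F.obj ((gammaFunctor d (total k)).obj ⟨W⟩)} (hv : v ∈ weightSpace F W j) :
    (F.map (weightHom d W j)).hom v = v := (hv j).trans (if_pos rfl)

lemma sum_map_weightHom (hF : isLinearFunctor k F) (W : GrFin k)
    (v : F.obj ((gammaFunctor d (total k)).obj ⟨W⟩)) :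
    ∑ j ∈ weightSupport d W, (F.map (weightHom d W j)).hom v = v := by
  have := hF.1
  have h := congrArg F.map (sum_weightHom (d := d) W)
  rw [F.map_sum, F.map_id] at h
  have := congr($(h).hom v)
  rw [ModuleCat.hom_sum, LinearMap.sum_apply] at this
  exact this

/-- The evaluation of a strict polynomial functor on a graded vector space is the direct sum of its
weight spaces. -/
lemma isInternal_weightSpace (hF : isLinearFunctor k F) (W : GrFin k) :
    DirectSum.IsInternal fun j : ℤ => weightSpace F W j := by
  -- The decomposition map sums the `F(w_j)`, each corestricted to its weight space, over the finite
  -- set of possible weights.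
  have : DirectSum.Decomposition fun j : ℤ => weightSpace F W j :=
    DirectSum.Decomposition.ofLinearMap _
      (∑ j ∈ weightSupport d W, DirectSum.lof k ℤ (fun j => weightSpace F W j) j ∘ₗ
        (F.map (weightHom d W j)).hom.codRestrict _ (map_weightHom_mem F hF W j))
      (LinearMap.ext fun v => by
        simpa [LinearMap.sum_apply] using sum_map_weightHom F hF W v)
      (DirectSum.linearMap_ext k fun i => LinearMap.ext fun v => by
        have hv (j : ℤ) : (F.map (weightHom d W j)).hom.codRestrict _
            (map_weightHom_mem F hF W j) v.1 =
            if h : j = i then ⟨v.1, h ▸ v.2⟩ else 0 := by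
          refine Subtype.ext ((v.2 j).trans ?_)
          split_ifs <;> rfl
        -- On the weight `i` subspace `F(w_i)` is the identity, so this subspace vanishes as soon as
        -- `w_i = 0`.
        have h0 : i ∉ weightSupport d W → v = 0 := fun h => by
          have := hF.1
          refine Subtype.ext ?_
          rw [← map_weightHom_of_mem F v.2, weightHom_eq_zero h, F.map_zero]
          rfl
        simp only [LinearMap.comp_apply, DirectSum.coeLinearMap_lof, LinearMap.sum_apply, hv,
          LinearMap.id_apply]
        rw [Finset.sum_eq_single i]
        · rw [dif_pos rfl]
        · intro j _ hj
          rw [dif_neg hj, map_zero]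
        · intro h
          rw [dif_pos rfl, h0 h]
          exact map_zero _)
  exact DirectSum.Decomposition.isInternal _

/-- The inclusion of the subspace of weight `j`. -/
def weightIncl (j : ℤ) : gradedEval F j ⟶ gammaFunctor d (total k) ⋙ F where
  app W := ModuleCat.ofHom (weightSpace F W.of j).subtype

/-- The projection onto the subspace of weight `j`. -/
def weightProj (hF : isLinearFunctor k F) (j : ℤ) :
    gammaFunctor d (total k) ⋙ F ⟶ gradedEval F j where
  app W := ModuleCat.ofHom <|
    (F.map (weightHom d W.of j)).hom.codRestrict _ (map_weightHom_mem F hF W.of j)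
  naturality W W' x := ModuleCat.hom_ext <| LinearMap.ext fun v => Subtype.ext <| by
    have h := congr($(congrArg F.map (weightHom_comm d x j)).hom v)
    rw [F.map_comp, F.map_comp] at h
    exact h.symm

lemma weightIncl_weightProj (hF : isLinearFunctor k F) (j : ℤ) :
    weightIncl F j ≫ weightProj F hF j = 𝟙 _ :=
  NatTrans.ext <| funext fun W => ModuleCat.hom_ext <| LinearMap.ext fun v => Subtype.ext <|
    map_weightHom_of_mem F v.2

lemma weightProj_weightIncl_app (hF : isLinearFunctor k F) (j : ℤ) (W : GammaCat k d (GrFin k)) :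
    (weightProj F hF j).app W ≫ (weightIncl F j).app W = F.map (weightHom d W.of j) := rfl

variable {F} {G : GammaV k d ⥤ ModuleCat.{u} k} (α : F ⟶ G)

lemma gradedEvalMap_weightIncl (j : ℤ) :
    gradedEvalMap α j ≫ weightIncl G j =
      weightIncl F j ≫ Functor.whiskerLeft (gammaFunctor d (total k)) α := rfl

lemma weightProj_gradedEvalMap (hF : isLinearFunctor k F) (hG : isLinearFunctor k G) (j : ℤ) :
    weightProj F hF j ≫ gradedEvalMap α j =
      Functor.whiskerLeft (gammaFunctor d (total k)) α ≫ weightProj G hG j :=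
  NatTrans.ext <| funext fun W => ModuleCat.hom_ext <| LinearMap.ext fun v => Subtype.ext <|
    congr($(α.naturality (weightHom d W.of j)).hom v)

variable (F)

lemma gammaFunctor_map_diagHom {C D : Type*} [Category.{v} C] [Preadditive C] [Linear k C]
    [Category.{v} D] [Preadditive D] [Linear k D] (G : C ⥤ D) [G.Additive] [G.Linear k]
    {X Y : C} (f : X ⟶ Y) :
    (gammaFunctor (k := k) d G).map (diagHom k d f) = diagHom k d (G.map f) :=
  Subtype.ext (PiTensorProduct.map_tprod _ _)

lemma gradProj_comp_map_congr {W W' : GrFin k} {f g : W ⟶ W'} {i : ℤ} (h : f.hom i = g.hom i) :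
    gradProj W i ≫ (total k).map f = gradProj W i ≫ (total k).map g :=
  FGModuleCat.hom_ext <| LinearMap.ext fun (x : ⨁ i, W.obj i) => by
    change DirectSum.lmap _ (DirectSum.lof k ℤ (fun i => W.obj i) i (x i)) =
      DirectSum.lmap _ (DirectSum.lof k ℤ (fun i => W.obj i) i (x i))
    rw [DirectSum.lmap_lof, DirectSum.lmap_lof, h]

/-- `F(w_j)` is the identity on vectors of weight `j`, so there `F(x)` can be replaced by `F` of
`w_j` followed by `x`. -/
lemma gradedEval_map_congr {W W' : GammaCat k d (GrFin k)} {x y : W ⟶ W'} {j : ℤ}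
    (h : weightHom d W.of j ≫ (gammaFunctor d (total k)).map x =
      weightHom d W.of j ≫ (gammaFunctor d (total k)).map y) :
    (gradedEval F j).map x = (gradedEval F j).map y := by
  have h' := congrArg F.map h
  rw [F.map_comp, F.map_comp] at h'
  refine ModuleCat.hom_ext <| LinearMap.ext fun v => Subtype.ext ?_
  have hv := map_weightHom_of_mem F v.2
  exact (congrArg (F.map ((gammaFunctor d (total k)).map x)).hom hv).symm.trans
    (congr($(h').hom v.1).trans (congrArg (F.map ((gammaFunctor d (total k)).map y)).hom hv))

/-- After expansion of `w_j`, each tensor factor contains `f` only behind a projection `π_{a m}`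
from a tuple `a` of sum `j`. -/
lemma weightHom_comp_diagHom_congr {W : GrFin k} {X : FGModuleCat.{u} k}
    {f g : (total k).obj W ⟶ X} {j : ℤ}
    (h : ∀ a : Fin d → ℤ, (∀ m, a m ∈ gradSupport W) → ∑ m, a m = j →
      ∀ m, gradProj W (a m) ≫ f = gradProj W (a m) ≫ g) :
    weightHom d W j ≫ diagHom k d f = weightHom d W j ≫ diagHom k d g := Subtype.ext <| by
  refine (map₂_weightTensor_tprod W j (gradSupport W) fun _ => f).trans
    (Eq.trans ?_ (map₂_weightTensor_tprod W j (gradSupport W) fun _ => g).symm)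
  refine Finset.sum_congr rfl fun a ha => ?_
  rw [Finset.mem_filter, Fintype.mem_piFinset] at ha
  exact congrArg _ (funext fun m => h a ha.1 ha.2 m)

/-- Two morphisms of graded vector spaces which agree in the degrees that contribute to weight `j`
induce the same map in weight `j`. -/
lemma gradedEval_map_diagHom_congr {W W' : GrFin k} {f g : W ⟶ W'} {j : ℤ}
    (h : ∀ a : Fin d → ℤ, (∀ m, a m ∈ gradSupport W) → ∑ m, a m = j →
      ∀ m, f.hom (a m) = g.hom (a m)) :
    (gradedEval F j).map (diagHom k d f) = (gradedEval F j).map (diagHom k d g) := by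
  refine gradedEval_map_congr F ?_
  rw [gammaFunctor_map_diagHom, gammaFunctor_map_diagHom]
  exact weightHom_comp_diagHom_congr fun a ha hj m => gradProj_comp_map_congr (h a ha hj m)

lemma nontrivial_of_mem_gradSupport {W : GrFin k} {i : ℤ} (h : i ∈ gradSupport W) :
    Nontrivial (W.obj i) := by
  by_contra hn
  rw [not_nontrivial_iff_subsingleton] at hn
  have h' : gradProj W i ≠ 0 := by simpa [gradSupport] using h
  refine h' (FGModuleCat.hom_ext <| LinearMap.ext fun (x : ⨁ i, W.obj i) => ?_)
  change DirectSum.lof k ℤ (fun i => W.obj i) i (x i) = 0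
  rw [Subsingleton.elim (x i) 0, map_zero]

end WeightDecomposition

/-! ### Retracts of functors preserving limits or colimits -/

section Retracts

variable {C D : Type*} [Category* C] [Category* D]

/-- A retract of a functor which preserves limits preserves limits. -/
lemma preservesLimitsOfShape_of_retract {A B : C ⥤ D} (i : A ⟶ B) (p : B ⟶ A) (h : i ≫ p = 𝟙 A)
    (J : Type*) [Category* J] [PreservesLimitsOfShape J B] : PreservesLimitsOfShape J A := by
  have hip (X : C) : i.app X ≫ p.app X = 𝟙 _ := by rw [← NatTrans.comp_app, h, NatTrans.id_app]
  refine ⟨fun {K} => ⟨fun {c} hc => ⟨?_⟩⟩⟩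
  let hB := isLimitOfPreserves B hc
  -- Push the cone along `i`, lift it through the limit cone given by `B`, and come back along `p`.
  let s' (s : Cone (K ⋙ A)) : Cone (K ⋙ B) := (Cone.postcompose (Functor.whiskerLeft K i)).obj s
  refine
    { lift := fun s => hB.lift (s' s) ≫ p.app c.pt
      fac := fun s j => ?_
      uniq := fun s m hm => ?_ }
  · have := hB.fac (s' s) j
    dsimp [s'] at this ⊢
    rw [Category.assoc, ← p.naturality, reassoc_of% this, hip, Category.comp_id]
  · have : m ≫ i.app c.pt = hB.lift (s' s) := hB.hom_ext fun j => by
      rw [hB.fac]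
      dsimp [s']
      rw [Category.assoc, ← i.naturality, ← hm j]
      simp
    rw [← this, Category.assoc, hip]
    exact (Category.comp_id m).symm

/-- A retract of a functor which preserves colimits preserves colimits. -/
lemma preservesColimitsOfShape_of_retract {A B : C ⥤ D} (i : A ⟶ B) (p : B ⟶ A) (h : i ≫ p = 𝟙 A)
    (J : Type*) [Category* J] [PreservesColimitsOfShape J B] : PreservesColimitsOfShape J A := by
  have hip (X : C) : i.app X ≫ p.app X = 𝟙 _ := by rw [← NatTrans.comp_app, h, NatTrans.id_app]
  refine ⟨fun {K} => ⟨fun {c} hc => ⟨?_⟩⟩⟩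
  let hB := isColimitOfPreserves B hc
  let s' (s : Cocone (K ⋙ A)) : Cocone (K ⋙ B) :=
    (Cocone.precompose (Functor.whiskerLeft K p)).obj s
  refine
    { desc := fun s => i.app c.pt ≫ hB.desc (s' s)
      fac := fun s j => ?_
      uniq := fun s m hm => ?_ }
  · have := hB.fac (s' s) j
    dsimp [s'] at this ⊢
    rw [← Category.assoc, i.naturality, Category.assoc, this, ← Category.assoc, hip,
      Category.id_comp]
  · have : p.app c.pt ≫ m = hB.desc (s' s) := hB.hom_ext fun j => by
      rw [hB.fac]
      dsimp [s']
      rw [← Category.assoc, p.naturality, Category.assoc, ← hm j]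
      simp
    rw [← this, ← Category.assoc, hip]
    exact (Category.id_comp m).symm

lemma preservesFiniteLimits_of_retract {A B : C ⥤ D} (i : A ⟶ B) (p : B ⟶ A) (h : i ≫ p = 𝟙 A)
    [PreservesFiniteLimits B] : PreservesFiniteLimits A :=
  ⟨fun J _ _ => preservesLimitsOfShape_of_retract i p h J⟩

lemma preservesFiniteColimits_of_retract {A B : C ⥤ D} (i : A ⟶ B) (p : B ⟶ A) (h : i ≫ p = 𝟙 A)
    [PreservesFiniteColimits B] : PreservesFiniteColimits A :=
  ⟨fun J _ _ => preservesColimitsOfShape_of_retract i p h J⟩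

end Retracts

/-! ### Detecting exactness degreewise and pointwise -/

section JointlyReflect

variable {A B C D : Type*} [Category* A] [Category* B] [Category* C] [Category* D]

/-- A cone in a product category is a limit if all its components are. -/
def isLimitOfPiEval {ι J : Type*} [Category* J] {T : J ⥤ (ι → B)} {c : Cone T}
    (h : ∀ i, IsLimit ((Pi.eval (fun _ : ι => B) i).mapCone c)) : IsLimit c where
  lift s i := (h i).lift ((Pi.eval _ i).mapCone s)
  fac s j := funext fun i => (h i).fac ((Pi.eval _ i).mapCone s) j
  uniq s m hm := funext fun i =>
    (h i).uniq ((Pi.eval _ i).mapCone s) (m i) fun j => congrFun (hm j) i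

/-- A cocone in a product category is a colimit if all its components are. -/
def isColimitOfPiEval {ι J : Type*} [Category* J] {T : J ⥤ (ι → B)} {c : Cocone T}
    (h : ∀ i, IsColimit ((Pi.eval (fun _ : ι => B) i).mapCocone c)) : IsColimit c where
  desc s i := (h i).desc ((Pi.eval _ i).mapCocone s)
  fac s j := funext fun i => (h i).fac ((Pi.eval _ i).mapCocone s) j
  uniq s m hm := funext fun i =>
    (h i).uniq ((Pi.eval _ i).mapCocone s) (m i) fun j => congrFun (hm j) i

lemma preservesFiniteLimits_of_comp_eval {ι : Type*} (K : A ⥤ (ι → B))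
    (h : ∀ i, PreservesFiniteLimits (K ⋙ Pi.eval (fun _ : ι => B) i)) : PreservesFiniteLimits K :=
  ⟨fun J _ _ => ⟨fun {T} => ⟨fun {c} hc => ⟨isLimitOfPiEval
    fun i => isLimitOfPreserves (K ⋙ Pi.eval (fun _ : ι => B) i) hc⟩⟩⟩⟩

lemma preservesFiniteColimits_of_comp_eval {ι : Type*} (K : A ⥤ (ι → B))
    (h : ∀ i, PreservesFiniteColimits (K ⋙ Pi.eval (fun _ : ι => B) i)) :
    PreservesFiniteColimits K :=
  ⟨fun J _ _ => ⟨fun {T} => ⟨fun {c} hc => ⟨isColimitOfPiEval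
    fun i => isColimitOfPreserves (K ⋙ Pi.eval (fun _ : ι => B) i) hc⟩⟩⟩⟩

instance preservesColimitsOfShape_piEval {ι : Type*} (J : Type*) [Category* J]
    [HasColimitsOfShape J B] (i : ι) :
    PreservesColimitsOfShape J (Pi.eval (fun _ : ι => B) i) where
  preservesColimit {K} :=
    let c : Cocone K :=
      { pt := fun i => colimit (K ⋙ Pi.eval (fun _ : ι => B) i)
        ι :=
          { app := fun j i => colimit.ι (K ⋙ Pi.eval (fun _ : ι => B) i) j
            naturality := fun j j' f => funext fun i =>
              (colimit.cocone (K ⋙ Pi.eval (fun _ : ι => B) i)).ι.naturality f } }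
    have hc (i : ι) : IsColimit ((Pi.eval (fun _ : ι => B) i).mapCocone c) :=
      colimit.isColimit (K ⋙ Pi.eval (fun _ : ι => B) i)
    preservesColimit_of_preserves_colimit_cocone (isColimitOfPiEval hc) (hc i)

variable {P : ObjectProperty (C ⥤ D)}

/-- Limits of functors are tested pointwise, and the full inclusion `P.ι` reflects them. -/
lemma preservesFiniteLimits_of_comp_evaluation [HasFiniteLimits D] (K : A ⥤ P.FullSubcategory)
    (h : ∀ X, PreservesFiniteLimits (K ⋙ P.ι ⋙ (evaluation _ _).obj X)) :
    PreservesFiniteLimits K := by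
  have : PreservesFiniteLimits (K ⋙ P.ι) := preservesFiniteLimits_of_evaluation _ h
  exact preservesFiniteLimits_of_reflects_of_preserves K P.ι

lemma preservesFiniteColimits_of_comp_evaluation [HasFiniteColimits D]
    (K : A ⥤ P.FullSubcategory)
    (h : ∀ X, PreservesFiniteColimits (K ⋙ P.ι ⋙ (evaluation _ _).obj X)) :
    PreservesFiniteColimits K := by
  have : PreservesFiniteColimits (K ⋙ P.ι) := preservesFiniteColimits_of_evaluation _ h
  exact ⟨fun J _ _ => preservesColimitsOfShape_of_reflects_of_preserves K P.ι⟩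

end JointlyReflect

/-! ### Exactness of the parametrisations -/

section Exactness

variable {k : Type u} [Field k] {d : ℕ}

/-- As `𝒫_d` is closed under subobjects and quotients, its kernels and cokernels are the pointwise
ones. -/
instance : PreservesFiniteLimits (isStrictPoly k d).ι := by
  have := (isStrictPoly k d).preservesKernels_ι
  exact Functor.preservesFiniteLimits_of_preservesKernels _

instance : PreservesFiniteColimits (isStrictPoly k d).ι := by
  have := (isStrictPoly k d).preservesCokernels_ι
  exact Functor.preservesFiniteColimits_of_preservesCokernels _

/-- The functor `F ↦ F(W)^j`. -/
def gradedEvalFunctor (W : GammaCat k d (GrFin k)) (j : ℤ) : StrictPoly k d ⥤ ModuleCat.{u} k where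
  obj F := (gradedEval F.obj j).obj W
  map α := (gradedEvalMap α.hom j).app W

/-- The inclusion of `F(W)^j` in `F(W)`, naturally in `F`. -/
def gradedEvalFunctorIncl (W : GammaCat k d (GrFin k)) (j : ℤ) :
    gradedEvalFunctor W j ⟶
      (isStrictPoly k d).ι ⋙ (evaluation _ _).obj ((gammaFunctor d (total k)).obj W) where
  app F := (weightIncl F.obj j).app W

/-- The projection of `F(W)` onto `F(W)^j`, naturally in `F`. -/
def gradedEvalFunctorProj (W : GammaCat k d (GrFin k)) (j : ℤ) :
    (isStrictPoly k d).ι ⋙ (evaluation _ _).obj ((gammaFunctor d (total k)).obj W) ⟶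
      gradedEvalFunctor W j where
  app F := (weightProj F.obj F.property.1 j).app W
  naturality F G α :=
    congr($(weightProj_gradedEvalMap α.hom F.property.1 G.property.1 j).app W).symm

lemma gradedEvalFunctorIncl_gradedEvalFunctorProj (W : GammaCat k d (GrFin k)) (j : ℤ) :
    gradedEvalFunctorIncl W j ≫ gradedEvalFunctorProj W j = 𝟙 _ :=
  NatTrans.ext <| funext fun F => congr($(weightIncl_weightProj F.obj F.property.1 j).app W)

instance (W : GammaCat k d (GrFin k)) (j : ℤ) :
    PreservesFiniteLimits (gradedEvalFunctor W j) :=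
  preservesFiniteLimits_of_retract _ _ (gradedEvalFunctorIncl_gradedEvalFunctorProj W j)

instance (W : GammaCat k d (GrFin k)) (j : ℤ) :
    PreservesFiniteColimits (gradedEvalFunctor W j) :=
  preservesFiniteColimits_of_retract _ _ (gradedEvalFunctorIncl_gradedEvalFunctorProj W j)

lemma finite_directSum {W : ℤ → Type*} [∀ i, AddCommMonoid (W i)] [∀ i, Module k (W i)]
    [∀ i, Module.Finite k (W i)] (s : Finset ℤ) (hs : ∀ i ∉ s, Subsingleton (W i)) :
    Module.Finite k (⨁ i, W i) := by
  refine ⟨?_⟩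
  have : (⊤ : Submodule k (⨁ i, W i)) =
      ⨆ i ∈ s, LinearMap.range (DirectSum.lof k ℤ W i) := by
    refine (eq_top_iff.2 fun x _ => ?_).symm
    induction x using DirectSum.induction_on with
    | zero => exact zero_mem _
    | of i x =>
      by_cases hi : i ∈ s
      · exact Submodule.mem_iSup_of_mem i (Submodule.mem_iSup_of_mem hi ⟨x, rfl⟩)
      · have := hs i hi
        rw [Subsingleton.elim x 0, map_zero]
        exact zero_mem _
    | add x y hx hy => exact add_mem (hx trivial) (hy trivial)
  rw [this]
  exact Submodule.fg_biSup _ _ fun i _ =>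
    (LinearMap.range_eq_map (DirectSum.lof k ℤ W i)) ▸ Module.Finite.fg_top.map _

lemma isFinTotal_of_finite {E : GrVect k} (h : ∀ i, Module.Finite k (E i)) (s : Finset ℤ)
    (hs : ∀ i ∉ s, Subsingleton (E i)) : isFinTotal k E :=
  finite_directSum (W := fun i => E i) s hs

lemma subsingleton_of_notMem_gradSupport {W : GrFin k} {i : ℤ} (h : i ∉ gradSupport W) :
    Subsingleton (W.obj i) := by
  refine subsingleton_of_forall_eq 0 fun x => ?_
  have h' := congr($(gradProj_eq_zero h).hom.hom (DirectSum.lof k ℤ (fun i => W.obj i) i x))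
  have h'' : DirectSum.lof k ℤ (fun i => W.obj i) i
      ((DirectSum.lof k ℤ (fun i => W.obj i) i x) i) = 0 := h'
  have := DirectSum.of_injective (β := fun i => W.obj i) i (h''.trans (map_zero _).symm)
  simpa [DirectSum.lof_eq_of] using this

instance finite_obj (W : GrFin k) (i : ℤ) : Module.Finite k (W.obj i) :=
  Module.Finite.of_surjective (DirectSum.component k ℤ (fun i => W.obj i) i)
    fun x => ⟨DirectSum.lof k ℤ _ i x, DirectSum.component.lof_self _ _ _⟩

instance (E : GrVect k) : Nonempty (FinSub E) :=
  ⟨⟨fun _ => ⊥, isFinTotal_of_finite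
    (fun i => inferInstanceAs (Module.Finite k (⊥ : Submodule k (E i)))) ∅
    fun i _ => inferInstanceAs (Subsingleton (⊥ : Submodule k (E i)))⟩⟩

/-- The sum of two such subspaces is supported in the union of their supports. Directedness is what
makes the colimit defining `F_E` filtered, hence left exact. -/
instance (E : GrVect k) : IsDirectedOrder (FinSub E) where
  directed S T := by
    let S' : GrFin k := ⟨_, S.2⟩
    let T' : GrFin k := ⟨_, T.2⟩
    have (i : ℤ) : Module.Finite k (S.1 i) := finite_obj S' i
    have (i : ℤ) : Module.Finite k (T.1 i) := finite_obj T' i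
    refine ⟨⟨fun i => S.1 i ⊔ T.1 i, isFinTotal_of_finite
      (fun i => inferInstanceAs (Module.Finite k ↥(S.1 i ⊔ T.1 i)))
      (gradSupport S' ∪ gradSupport T') fun i hi => ?_⟩,
      fun i => le_sup_left, fun i => le_sup_right⟩
    change Subsingleton ↥(S.1 i ⊔ T.1 i)
    rw [Finset.notMem_union] at hi
    have h₁ : Subsingleton (S.1 i) := subsingleton_of_notMem_gradSupport hi.1
    have h₂ : Subsingleton (T.1 i) := subsingleton_of_notMem_gradSupport hi.2
    rw [Submodule.subsingleton_iff_eq_bot] at h₁ h₂ ⊢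
    rw [h₁, h₂, sup_bot_eq]

/-- The evaluation of graded strict polynomial functors in degree `j`. -/
abbrev degEval (k : Type u) [Field k] (d : ℕ) (j : ℤ) : GrStrictPoly k d ⥤ StrictPolyVect k d :=
  Pi.eval _ j

/-- The functor `F ↦ (S ↦ F(S ⊗ X)^j)`. -/
def finSubEval (E : GrVect k) (j : ℤ) (X : GammaV k d) :
    StrictPoly k d ⥤ FinSub E ⥤ ModuleCat.{u} k :=
  (param k d).flip ⋙ (Functor.whiskeringLeft _ _ _).obj (finSubDiagram E) ⋙
    (Functor.whiskeringRight _ _ _).obj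
      (degEval k d j ⋙ (isLinearFunctor k).ι ⋙ (evaluation _ _).obj X)

instance (E : GrVect k) (j : ℤ) (X : GammaV k d) : PreservesFiniteLimits (finSubEval E j X) :=
  preservesFiniteLimits_of_evaluation _ fun S =>
    inferInstanceAs (PreservesFiniteLimits
      (gradedEvalFunctor (((gammaTensor k d).obj ((finSubDiagram E).obj S)).obj X) j))

instance (E : GrVect k) (j : ℤ) (X : GammaV k d) : PreservesFiniteColimits (finSubEval E j X) :=
  preservesFiniteColimits_of_evaluation _ fun S =>
    inferInstanceAs (PreservesFiniteColimits
      (gradedEvalFunctor (((gammaTensor k d).obj ((finSubDiagram E).obj S)).obj X) j))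

instance (E : GrVect k) (j : ℤ) :
    PreservesColimitsOfShape (FinSub E)
      (degEval k d j) :=
  preservesColimitsOfShape_piEval _ _

instance (J : Type u) [SmallCategory J] :
    PreservesColimitsOfShape J (isLinearFunctor k (C := GammaV k d)).ι :=
  inferInstance

/-- The values of the lower parametrisation are filtered colimits of vector spaces. -/
def lowerAtEvalIso (E : GrVect k) (j : ℤ) (X : GammaV k d) :
    lowerAt d E ⋙ degEval k d j ⋙ (isLinearFunctor k).ι ⋙ (evaluation _ _).obj X ≅
      finSubEval E j X ⋙ colim :=
  Functor.isoWhiskerLeft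
    ((param k d).flip ⋙ (Functor.whiskeringLeft _ _ _).obj (finSubDiagram E))
    (preservesColimitNatIso
      (degEval k d j ⋙ (isLinearFunctor k).ι ⋙ (evaluation _ _).obj X))

/-- In each degree and at each object this is a filtered colimit of the exact functors `F ↦ F(S ⊗
X)^j`, and filtered colimits of vector spaces commute with finite limits. -/
lemma preservesFiniteLimits_lowerAt (E : GrVect k) : PreservesFiniteLimits (lowerAt d E) :=
  preservesFiniteLimits_of_comp_eval _ fun j => preservesFiniteLimits_of_comp_evaluation _ fun X =>
    preservesFiniteLimits_of_natIso (lowerAtEvalIso E j X).symm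

lemma preservesFiniteColimits_lowerAt (E : GrVect k) : PreservesFiniteColimits (lowerAt d E) :=
  preservesFiniteColimits_of_comp_eval _ fun j =>
    preservesFiniteColimits_of_comp_evaluation _ fun X =>
      preservesFiniteColimits_of_natIso (lowerAtEvalIso E j X).symm

end Exactness

/-! ### Parameters of finite total dimension -/

section Lower

variable {k : Type u} [Field k] {d : ℕ}

section FiniteTotal

/-- The largest graded subspace. -/
def topFinSub (E : GrFin k) : FinSub E.obj :=
  ⟨fun _ => ⊤, isFinTotal_of_finite
    (fun i => inferInstanceAs (Module.Finite k (⊤ : Submodule k (E.obj i)))) (gradSupport E)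
    fun i hi => by
      have : Subsingleton (E.obj i) := subsingleton_of_notMem_gradSupport hi
      exact inferInstanceAs (Subsingleton (⊤ : Submodule k (E.obj i)))⟩

/-- The isomorphism of `E` with its largest graded subspace. -/
def toTopFinSub (E : GrFin k) : E ⟶ (finSubDiagram E.obj).obj (topFinSub E) :=
  ⟨fun i => ModuleCat.ofHom (Submodule.topEquiv.symm.toLinearMap : E.obj i →ₗ[k] _)⟩

/-- The inclusion of a graded subspace, as a morphism of graded vector spaces of finite total
dimension. -/
abbrev finSubIncl (E : GrFin k) (S : FinSub E.obj) : (finSubDiagram E.obj).obj S ⟶ E :=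
  ObjectProperty.homMk (subGrIncl E.obj S.1)

/-- The comparison morphism `F_E ⟶ F(E ⊗ -)` for `E` of finite total dimension. -/
def lowerToParam (E : GrFin k) (F : StrictPoly k d) :
    (lowerAt d E.obj).obj F ⟶ ((param k d).obj E).obj F :=
  colimit.desc (finSubDiagram E.obj ⋙ (param k d).flip.obj F)
    { pt := ((param k d).obj E).obj F
      ι :=
        { app S := ((param k d).map (finSubIncl E S)).app F
          naturality S T h := by
            refine Eq.trans ?_ (Category.comp_id _).symm
            change ((param k d).map ((finSubDiagram E.obj).map h)).app F ≫ _ = _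
            rw [← NatTrans.comp_app, ← Functor.map_comp]
            rfl } }

lemma lowerι_lowerToParam (E : GrFin k) (F : StrictPoly k d) (S : FinSub E.obj) :
    lowerι E.obj F S ≫ lowerToParam E F = ((param k d).map (finSubIncl E S)).app F :=
  colimit.ι_desc _ _

/-- The isomorphism `F_E ≅ F(E ⊗ -)` for `E` of finite total dimension. -/
def lowerIsoParam (E : GrFin k) (F : StrictPoly k d) :
    (lowerAt d E.obj).obj F ≅ ((param k d).obj E).obj F where
  hom := lowerToParam E F
  inv := ((param k d).map (toTopFinSub E)).app F ≫ lowerι E.obj F (topFinSub E)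
  hom_inv_id := lower_hom_ext fun S => by
    -- Every canonical map of the colimit factors through that of the greatest subspace, which is
    -- `E` itself.
    have h : S ≤ topFinSub E := fun i => le_top
    rw [← Category.assoc, lowerι_lowerToParam, ← Category.assoc, ← NatTrans.comp_app,
      ← Functor.map_comp]
    refine Eq.trans ?_ (Category.comp_id _).symm
    exact lowerι_w E.obj F (homOfLE h)
  inv_hom_id := by
    rw [Category.assoc, lowerι_lowerToParam, ← NatTrans.comp_app, ← Functor.map_comp]
    have : toTopFinSub E ≫ finSubIncl E (topFinSub E) = 𝟙 E := rfl
    rw [this, CategoryTheory.Functor.map_id, NatTrans.id_app]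

variable (k d) in
/-- The isomorphism `F_E ≅ F(E ⊗ -)`, naturally in `F` and in `E` of finite total dimension. -/
def lowerNatIsoParam : (isFinTotal k).ι ⋙ lower k d ≅ param k d :=
  NatIso.ofComponents
    (fun E => NatIso.ofComponents (fun F => lowerIsoParam E F) fun {F G} α =>
      lower_hom_ext fun S => by
        change lowerι E.obj F S ≫ (lowerAt d E.obj).map α ≫ lowerToParam E G =
          lowerι E.obj F S ≫ lowerToParam E F ≫ ((param k d).obj E).map α
        rw [← Category.assoc, lowerι_naturality, Category.assoc, lowerι_lowerToParam,
          ← Category.assoc, lowerι_lowerToParam, NatTrans.naturality])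
    fun {E E'} f => NatTrans.ext <| funext fun F => lower_hom_ext fun S => by
      change lowerι E.obj F S ≫ lowerMap f.hom F ≫ lowerToParam E' F =
        lowerι E.obj F S ≫ lowerToParam E F ≫ ((param k d).map f).app F
      rw [← Category.assoc, lowerι_lowerMap, Category.assoc, lowerι_lowerToParam,
        ← Category.assoc, lowerι_lowerToParam, ← NatTrans.comp_app, ← NatTrans.comp_app,
        ← Functor.map_comp, ← Functor.map_comp]
      rfl

end FiniteTotal

/-! ### Truncation of the parameter -/

section Truncation

lemma nontrivial_of_mem_gradSupport_tensorObj {E : GrFin k} {V : FGModuleCat.{u} k} {i : ℤ}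
    (h : i ∈ gradSupport (tensorObj E V)) : Nontrivial (E.obj i) := by
  have : Nontrivial (E.obj i ⊗[k] V) := nontrivial_of_mem_gradSupport h
  by_contra hn
  rw [not_nontrivial_iff_subsingleton] at hn
  exact not_subsingleton (E.obj i ⊗[k] V) inferInstance

/-- Two morphisms which agree in the degrees that contribute to weight `j` induce the same map in
weight `j`. -/
lemma paramMap_congr {E E' : GrFin k} {f g : E ⟶ E'} (F : StrictPoly k d) {j : ℤ}
    (h : ∀ a : Fin d → ℤ, (∀ m, Nontrivial (E.obj (a m))) → ∑ m, a m = j →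
      ∀ m, f.hom (a m) = g.hom (a m)) : paramMap f F j = paramMap g F j := by
  refine ObjectProperty.hom_ext _ <| NatTrans.ext <| funext fun V => ?_
  refine gradedEval_map_diagHom_congr F.obj (f := (tensorNatTrans f).app V.of)
    (g := (tensorNatTrans g).app V.of) fun a ha hj m => ?_
  have := h a (fun m => nontrivial_of_mem_gradSupport_tensorObj (ha m)) hj m
  change ModuleCat.ofHom ((f.hom (a m)).hom.rTensor V.of) =
    ModuleCat.ofHom ((g.hom (a m)).hom.rTensor V.of)
  rw [this]

/-- Taking degree `j` preserves the colimit, so the components in that single degree already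
determine a morphism out of it. -/
lemma lower_hom_ext_apply {E : GrVect k} {F : StrictPoly k d} {j : ℤ} {X : StrictPolyVect k d}
    {a b : (lowerAt d E).obj F j ⟶ X} (h : ∀ S, lowerι E F S j ≫ a = lowerι E F S j ≫ b) :
    a = b :=
  (isColimitOfPreserves (degEval k d j)
    (colimit.isColimit (finSubDiagram E ⋙ (param k d).flip.obj F))).hom_ext h

/-- An endomorphism which is the identity in the degrees that contribute to weight `j`, and the
identity or zero in the other degrees, induces the identity in weight `j`. -/
lemma lowerMap_apply_eq_id {E : GrVect k} {p : E ⟶ E} (hp : ∀ i, p i = 𝟙 (E i) ∨ p i = 0) {j : ℤ}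
    (h : ∀ a : Fin d → ℤ, (∀ m, Nontrivial (E (a m))) → ∑ m, a m = j → ∀ m, p (a m) = 𝟙 _)
    (F : StrictPoly k d) : lowerMap p F j = 𝟙 _ := by
  refine lower_hom_ext_apply fun S => ?_
  -- The dichotomy in `hp` makes every graded subspace stable under `p`, so the action of `p` can be
  -- computed inside a fixed `S`.
  have hS : S.map p ≤ S := fun i => by
    rintro _ ⟨x, hx, rfl⟩
    obtain h | h := hp i <;> rw [h]
    · exact hx
    · exact zero_mem _
  refine (congrFun (lowerι_lowerMap p F S) j).trans (Eq.trans ?_ (Category.comp_id _).symm)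
  rw [← lowerι_w E F (homOfLE hS), ← Category.assoc, ← NatTrans.comp_app, ← Functor.map_comp]
  change paramMap (S.restr p ≫ (finSubDiagram E).map (homOfLE hS)) F j ≫ lowerι E F S j = _
  rw [paramMap_congr (g := 𝟙 _) F, paramMap_id]
  · exact Category.id_comp _
  intro a ha hj m
  have hpm := h a (fun m => by
    obtain ⟨x, y, hxy⟩ := ha m
    exact ⟨x.1, y.1, fun h => hxy (Subtype.ext h)⟩) hj m
  refine ModuleCat.hom_ext <| LinearMap.ext fun x => Subtype.ext ?_
  exact congr($(hpm).hom x.1)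

lemma mem_truncSub_of_le (E : GrVect k) {i j : ℤ} (h : j ≤ i) (x : E j) : x ∈ truncSub E i j := by
  unfold truncSub
  rw [if_pos h]
  exact Submodule.mem_top

lemma eq_zero_of_mem_truncSub (E : GrVect k) {i j : ℤ} (h : ¬ j ≤ i) {x : E j}
    (hx : x ∈ truncSub E i j) : x = 0 := by
  unfold truncSub at hx
  rwa [if_neg h] at hx

/-- The projection of `E` onto its part in degrees `≤ i`. -/
def truncProj (E : GrVect k) (i : ℤ) : E ⟶ subGr E (truncSub E i) := fun j =>
  if h : j ≤ i then
    ModuleCat.ofHom (LinearMap.id.codRestrict (truncSub E i j) (mem_truncSub_of_le E h))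
  else 0

lemma truncProj_of_le (E : GrVect k) {i j : ℤ} (h : j ≤ i) : truncProj E i j =
    ModuleCat.ofHom (LinearMap.id.codRestrict (truncSub E i j) (mem_truncSub_of_le E h)) :=
  dif_pos h

lemma truncProj_of_not_le (E : GrVect k) {i j : ℤ} (h : ¬ j ≤ i) : truncProj E i j = 0 :=
  dif_neg h

lemma subGrIncl_truncProj (E : GrVect k) (i : ℤ) :
    subGrIncl E (truncSub E i) ≫ truncProj E i = 𝟙 _ := by
  funext j
  rw [grVect_comp_apply]
  by_cases h : j ≤ i
  · rw [truncProj_of_le E h]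
    rfl
  · refine ModuleCat.hom_ext <| LinearMap.ext fun (x : truncSub E i j) => ?_
    have : x = 0 := Subtype.ext (eq_zero_of_mem_truncSub E h x.2)
    rw [this]
    exact (map_zero _).trans (map_zero _).symm

lemma truncProj_subGrIncl_apply_of_le (E : GrVect k) {i j : ℤ} (h : j ≤ i) :
    (truncProj E i ≫ subGrIncl E (truncSub E i)) j = 𝟙 (E j) := by
  rw [grVect_comp_apply, truncProj_of_le E h]
  rfl

lemma truncProj_subGrIncl_apply_of_not_le (E : GrVect k) {i j : ℤ} (h : ¬ j ≤ i) :
    (truncProj E i ≫ subGrIncl E (truncSub E i)) j = 0 := by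
  rw [grVect_comp_apply, truncProj_of_not_le E h, zero_comp]

/-- The numerical fact behind truncation: among nonnegative degrees of sum `j`, none exceeds `j`. -/
lemma le_of_sum_eq {a : Fin d → ℤ} (ha : ∀ m, 0 ≤ a m) {j : ℤ} (hj : ∑ m, a m = j) (m : Fin d) :
    a m ≤ j :=
  hj ▸ Finset.single_le_sum (fun m _ => ha m) (Finset.mem_univ m)

lemma nonneg_of_nontrivial {E : GrVect k} (hE : IsNonnegFinite E) {i : ℤ}
    (h : Nontrivial (E i)) : 0 ≤ i := by
  by_contra hi
  exact not_subsingleton _ (hE.nonneg i (not_le.1 hi))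

/-- In degrees `≤ i`, the parametrisations by `E` and by its part in degrees `≤ i` agree. -/
lemma lowerMap_truncProj_subGrIncl {E : GrVect k} (hE : IsNonnegFinite E) (F : StrictPoly k d)
    {i j : ℤ} (hj : j ≤ i) :
    lowerMap (truncProj E i ≫ subGrIncl E (truncSub E i)) F j = 𝟙 _ := by
  refine lowerMap_apply_eq_id (fun l => ?_) (fun a ha h m => ?_) F
  · by_cases h : l ≤ i
    · exact Or.inl (truncProj_subGrIncl_apply_of_le E h)
    · exact Or.inr (truncProj_subGrIncl_apply_of_not_le E h)
  · exact truncProj_subGrIncl_apply_of_le E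
      ((le_of_sum_eq (fun m => nonneg_of_nontrivial hE (ha m)) h m).trans hj)

/-- In degrees `≥ -i`, the parametrisations by the dual of `E` and by the dual of its part in
degrees `≤ i` agree. -/
lemma lowerMap_grDual_truncProj_subGrIncl {E : GrVect k} (hE : IsNonnegFinite E)
    (F : StrictPoly k d) {i j : ℤ} (hj : -i ≤ j) :
    lowerMap ((grDual k).map (truncProj E i ≫ subGrIncl E (truncSub E i)).op) F j = 𝟙 _ := by
  refine lowerMap_apply_eq_id (fun l => ?_) (fun a ha h m => ?_) F
  · by_cases h : -l ≤ i
    · refine Or.inl ?_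
      change ModuleCat.ofHom ((truncProj E i ≫ subGrIncl E (truncSub E i)) (-l)).hom.dualMap = _
      rw [truncProj_subGrIncl_apply_of_le E h]
      rfl
    · refine Or.inr ?_
      change ModuleCat.ofHom ((truncProj E i ≫ subGrIncl E (truncSub E i)) (-l)).hom.dualMap = _
      rw [truncProj_subGrIncl_apply_of_not_le E h]
      exact ModuleCat.hom_ext <| LinearMap.ext fun x => LinearMap.ext fun y => map_zero x
  -- A degree of the dual is the negative of a degree of `E`, so the bound is applied to the tuple
  -- `-a`, of sum `-j ≤ i`.
  · have ha' (m : Fin d) : 0 ≤ - a m := by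
      have := ha m
      refine nonneg_of_nontrivial hE ?_
      by_contra hn
      rw [not_nontrivial_iff_subsingleton] at hn
      have : Nontrivial (Module.Dual k (E (-a m))) := ha m
      exact not_subsingleton (Module.Dual k (E (-a m))) inferInstance
    have hm : - a m ≤ i := by
      have := le_of_sum_eq (a := fun m => - a m) ha' (j := -j) (by
        rw [Finset.sum_neg_distrib, h]) m
      omega
    change ModuleCat.ofHom ((truncProj E i ≫ subGrIncl E (truncSub E i)) (-a m)).hom.dualMap = _
    rw [truncProj_subGrIncl_apply_of_le E hm]
    rfl

/-- The inclusion is split by `truncProj`, and functoriality in the parameter preserves the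
splitting. -/
lemma mono_lower_map_subGrIncl (E : GrVect k) (F : StrictPoly k d) (i : ℤ) :
    Mono (((lower k d).map (subGrIncl E (truncSub E i))).app F) := by
  have : IsSplitMono (((lower k d).map (subGrIncl E (truncSub E i))).app F) :=
    IsSplitMono.mk' ⟨((lower k d).map (truncProj E i)).app F, by
      rw [← NatTrans.comp_app, ← Functor.map_comp, subGrIncl_truncProj,
        CategoryTheory.Functor.map_id, NatTrans.id_app]⟩
  infer_instance

/-- Mutually inverse isomorphisms in degree `j` between the lower parametrisations by `E` and `T`,
for `T` a retract of `E`. -/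
def lowerRetractIso {E T : GrVect k} (i : T ⟶ E) (p : E ⟶ T) (hip : i ≫ p = 𝟙 T)
    (F : StrictPoly k d) (j : ℤ) (h : lowerMap (p ≫ i) F j = 𝟙 _) :
    (lowerAt d T).obj F j ≅ (lowerAt d E).obj F j where
  hom := lowerMap i F j
  inv := lowerMap p F j
  hom_inv_id := by
    have : lowerMap i F ≫ lowerMap p F = 𝟙 _ := by
      change ((lower k d).map i).app F ≫ ((lower k d).map p).app F = _
      rw [← NatTrans.comp_app, ← Functor.map_comp, hip]
      exact congr($((lower k d).map_id T).app F)
    exact congrFun this j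
  inv_hom_id := by
    have : lowerMap p F ≫ lowerMap i F = lowerMap (p ≫ i) F := by
      change ((lower k d).map p).app F ≫ ((lower k d).map i).app F = _
      rw [← NatTrans.comp_app, ← Functor.map_comp]
      rfl
    exact (congrFun this j).trans h

lemma isIso_lower_map_subGrIncl_apply {E : GrVect k} (hE : IsNonnegFinite E) (F : StrictPoly k d)
    {i j : ℤ} (hj : j ≤ i) :
    IsIso (((lower k d).map (subGrIncl E (truncSub E i))).app F j) :=
  (lowerRetractIso _ _ (subGrIncl_truncProj E i) F j
    (lowerMap_truncProj_subGrIncl hE F hj)).isIso_hom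

end Truncation

end Lower

/-! ### Evaluation and coevaluation, ungraded and graded -/

section Coevaluation

variable {k : Type u} [Field k]

section Vect

variable (X : Type*) [AddCommGroup X] [Module k X] (V : Type*) [AddCommMonoid V] [Module k V]

/-- The evaluation `X ⊗ (X^∨ ⊗ V) → V`. -/
def evMap : X ⊗[k] (Module.Dual k X ⊗[k] V) →ₗ[k] V :=
  (TensorProduct.lid k V).toLinearMap ∘ₗ (contractRight k X).rTensor V ∘ₗ
    (TensorProduct.assoc k X (Module.Dual k X) V).symm.toLinearMap

@[simp] lemma evMap_tmul (x : X) (ξ : Module.Dual k X) (v : V) :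
    evMap X V (x ⊗ₜ (ξ ⊗ₜ v)) = ξ x • v := by simp [evMap]

variable {V} {W : Type*} [AddCommMonoid W] [Module k W]

lemma evMap_lTensor (f : V →ₗ[k] W) (z : X ⊗[k] (Module.Dual k X ⊗[k] V)) :
    evMap X W ((f.lTensor (Module.Dual k X)).lTensor X z) = f (evMap X V z) := by
  have : evMap X W ∘ₗ (f.lTensor (Module.Dual k X)).lTensor X = f ∘ₗ evMap X V := by
    ext x ξ v
    simp
  exact congr($this z)

variable (V) [Module.Finite k X]

/-- The coevaluation `V → X^∨ ⊗ (X ⊗ V)`. -/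
def coevMap : V →ₗ[k] Module.Dual k X ⊗[k] (X ⊗[k] V) :=
  ∑ i, TensorProduct.mk k _ _ ((Module.finBasis k X).coord i) ∘ₗ
    TensorProduct.mk k X V (Module.finBasis k X i)

lemma coevMap_apply (v : V) : coevMap X V v =
    ∑ i, (Module.finBasis k X).coord i ⊗ₜ[k] (Module.finBasis k X i ⊗ₜ[k] v) := by
  simp [coevMap, LinearMap.sum_apply]

variable {V}

lemma lTensor_coevMap (f : V →ₗ[k] W) (v : V) :
    (f.lTensor X).lTensor (Module.Dual k X) (coevMap X V v) = coevMap X W (f v) := by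
  simp [coevMap_apply, map_sum]

lemma evMap_coevMap (z : X ⊗[k] V) :
    evMap X (X ⊗[k] V) ((coevMap X V).lTensor X z) = z := by
  have : evMap X (X ⊗[k] V) ∘ₗ (coevMap X V).lTensor X = LinearMap.id := by
    ext x v
    simp only [TensorProduct.AlgebraTensorModule.curry_apply, TensorProduct.curry_apply,
      LinearMap.coe_restrictScalars, LinearMap.comp_apply, LinearMap.lTensor_tmul, coevMap_apply,
      TensorProduct.tmul_sum, map_sum, evMap_tmul, LinearMap.id_apply]
    simp only [TensorProduct.smul_tmul', ← TensorProduct.sum_tmul, Module.Basis.coord_apply,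
      Module.Basis.sum_repr]
  exact congr($this z)

lemma lTensor_evMap_coevMap (z : Module.Dual k X ⊗[k] V) :
    (evMap X V).lTensor (Module.Dual k X) (coevMap X (Module.Dual k X ⊗[k] V) z) = z := by
  have : (evMap X V).lTensor (Module.Dual k X) ∘ₗ coevMap X (Module.Dual k X ⊗[k] V) =
      LinearMap.id := by
    ext ξ v
    simp only [TensorProduct.AlgebraTensorModule.curry_apply, TensorProduct.curry_apply,
      LinearMap.coe_restrictScalars, LinearMap.comp_apply, LinearMap.lTensor_tmul, coevMap_apply,
      map_sum, evMap_tmul, LinearMap.id_apply]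
    simp only [TensorProduct.tmul_smul, TensorProduct.smul_tmul', ← TensorProduct.sum_tmul,
      (Module.finBasis k X).sum_dual_apply_smul_coord ξ]
  exact congr($this z)

variable {X} {Y : Type*} [AddCommGroup Y] [Module k Y] [Module.Finite k Y]

/-- With `f_{ji}` the matrix of `f` in the chosen bases `x_i` and `y_j`, both sides are `∑ f_{ji}
x_i^* ⊗ (y_j ⊗ v)`. -/
lemma rTensor_dualMap_coevMap (f : X →ₗ[k] Y) (v : V) :
    f.dualMap.rTensor (Y ⊗[k] V) (coevMap Y V v) =
      (f.rTensor V).lTensor (Module.Dual k X) (coevMap X V v) := by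
  have h₁ (j) : f.dualMap ((Module.finBasis k Y).coord j) =
      ∑ i, (Module.finBasis k Y).coord j (f (Module.finBasis k X i)) •
        (Module.finBasis k X).coord i :=
    ((Module.finBasis k X).sum_dual_apply_smul_coord
      (f.dualMap ((Module.finBasis k Y).coord j))).symm
  have h₂ (i) : f (Module.finBasis k X i) =
      ∑ j, (Module.finBasis k Y).coord j (f (Module.finBasis k X i)) • Module.finBasis k Y j :=
    ((Module.finBasis k Y).sum_repr _).symm
  simp only [coevMap_apply, map_sum, LinearMap.rTensor_tmul, LinearMap.lTensor_tmul, h₁]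
  conv_rhs => enter [2, i]; rw [h₂ i]
  simp only [TensorProduct.sum_tmul, TensorProduct.tmul_sum, ← TensorProduct.smul_tmul',
    TensorProduct.tmul_smul]
  exact Finset.sum_comm

end Vect

section Graded

section Projection

variable (M : ℤ → Type*) [∀ i, AddCommMonoid (M i)] [∀ i, Module k (M i)]

variable (k) in
/-- The projection of a graded vector space onto its component of degree `a`. -/
def degProj (a : ℤ) : (⨁ i, M i) →ₗ[k] ⨁ i, M i :=
  DirectSum.lof k ℤ M a ∘ₗ DirectSum.component k ℤ M a

lemma degProj_comp_lof (a i : ℤ) :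
    degProj k M a ∘ₗ DirectSum.lof k ℤ M i = if i = a then DirectSum.lof k ℤ M i else 0 := by
  unfold degProj
  rw [LinearMap.comp_assoc, DirectSum.component_comp_lof]
  split_ifs with h
  · subst h
    rfl
  · rw [LinearMap.comp_zero]

lemma component_comp_degProj (a i : ℤ) : DirectSum.component k ℤ M i ∘ₗ degProj k M a =
    if i = a then DirectSum.component k ℤ M i else 0 := by
  unfold degProj
  rw [← LinearMap.comp_assoc, DirectSum.component_comp_lof]
  split_ifs with h h' h'
  · subst h
    rfl
  · exact (h' h.symm).elim
  · exact (h h'.symm).elim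
  · rw [LinearMap.zero_comp]

end Projection

variable (X : ℤ → Type u) [∀ i, AddCommGroup (X i)] [∀ i, Module k (X i)] (s : Finset ℤ)
  (V : Type u) [AddCommMonoid V] [Module k V]

variable (k) in
/-- The evaluation `X ⊗ (X^∨ ⊗ V) → V` for graded vector spaces. -/
def gradedEv : (⨁ i, X i ⊗[k] (⨁ l, Module.Dual k (X (-l)) ⊗[k] V)) →ₗ[k] V :=
  ∑ l ∈ s, evMap (X (-l)) V ∘ₗ
    (DirectSum.component k ℤ (fun l => Module.Dual k (X (-l)) ⊗[k] V) l).lTensor _ ∘ₗ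
      DirectSum.component k ℤ (fun i => X i ⊗[k] (⨁ l, Module.Dual k (X (-l)) ⊗[k] V)) (-l)

variable {s V}

/-- The component of `X` in degree `-l` pairs only with the dual component of degree `l`; an index
missing from `s` has a zero source, so it contributes nothing. -/
lemma gradedEv_lof (hs : ∀ l ∉ s, Subsingleton (X (-l))) (l : ℤ)
    (z : X (-l) ⊗[k] (⨁ l, Module.Dual k (X (-l)) ⊗[k] V)) :
    gradedEv k X s V (DirectSum.lof k ℤ
      (fun i => X i ⊗[k] (⨁ l, Module.Dual k (X (-l)) ⊗[k] V)) (-l) z) = evMap (X (-l)) V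
      ((DirectSum.component k ℤ (fun l => Module.Dual k (X (-l)) ⊗[k] V) l).lTensor _ z) := by
  simp only [gradedEv, LinearMap.sum_apply, LinearMap.comp_apply]
  rw [Finset.sum_eq_single l]
  · rw [DirectSum.component.lof_self]
  · intro l' _ h
    rw [DirectSum.component.of, dif_neg (fun h' => h (neg_injective h'.symm)), map_zero, map_zero]
  · intro h
    have := hs l h
    rw [Subsingleton.elim z 0]
    simp only [map_zero]

variable {W : Type u} [AddCommMonoid W] [Module k W]

lemma gradedEv_lmap (hs : ∀ l ∉ s, Subsingleton (X (-l))) (f : V →ₗ[k] W) :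
    gradedEv k X s W ∘ₗ DirectSum.lmap (fun i =>
      (DirectSum.lmap fun l => f.lTensor (Module.Dual k (X (-l)))).lTensor (X i)) =
      f ∘ₗ gradedEv k X s V := by
  refine DirectSum.linearMap_ext k fun i => LinearMap.ext fun z => ?_
  obtain ⟨l, rfl⟩ := neg_surjective i
  simp only [LinearMap.comp_apply, DirectSum.lmap_lof, gradedEv_lof X hs]
  rw [← evMap_lTensor, ← LinearMap.lTensor_comp_apply, ← LinearMap.lTensor_comp_apply]
  rfl

/-- Only the dual component of degree `-a` pairs with `X a`, so selecting `a` outside and selecting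
`-a` inside have the same effect. The exchange of weights `j` and `-j` originates here and in
`degProj_gradedCoev`. -/
lemma gradedEv_degProj (hs : ∀ l ∉ s, Subsingleton (X (-l))) (a : ℤ) :
    gradedEv k X s V ∘ₗ degProj k _ a = gradedEv k X s V ∘ₗ DirectSum.lmap (fun i =>
      (degProj k (fun l => Module.Dual k (X (-l)) ⊗[k] V) (-a)).lTensor (X i)) := by
  refine DirectSum.linearMap_ext k fun i => LinearMap.ext fun z => ?_
  obtain ⟨l, rfl⟩ := neg_surjective i
  rw [LinearMap.comp_assoc, degProj_comp_lof]
  simp only [LinearMap.comp_apply, DirectSum.lmap_lof, gradedEv_lof X hs]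
  rw [← LinearMap.lTensor_comp_apply, component_comp_degProj]
  by_cases h : -l = a
  · rw [if_pos h, if_pos (neg_eq_iff_eq_neg.1 h), gradedEv_lof X hs]
  · rw [if_neg h, if_neg (fun h' => h (neg_eq_iff_eq_neg.2 h'))]
    simp

variable (s V) [∀ i, Module.Finite k (X i)]

/-- The coevaluation `V → X^∨ ⊗ (X ⊗ V)` for graded vector spaces. -/
def gradedCoev : V →ₗ[k] ⨁ l, Module.Dual k (X (-l)) ⊗[k] (⨁ i, X i ⊗[k] V) :=
  ∑ l ∈ s, DirectSum.lof k ℤ (fun l => Module.Dual k (X (-l)) ⊗[k] (⨁ i, X i ⊗[k] V)) l ∘ₗ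
    (DirectSum.lof k ℤ (fun i => X i ⊗[k] V) (-l)).lTensor _ ∘ₗ coevMap (X (-l)) V

variable {s V}

lemma gradedCoev_apply (hs : ∀ l ∉ s, Subsingleton (X (-l))) (l : ℤ) (v : V) :
    gradedCoev X s V v l =
      (DirectSum.lof k ℤ (fun i => X i ⊗[k] V) (-l)).lTensor _ (coevMap (X (-l)) V v) := by
  change DirectSum.component k ℤ (fun l => Module.Dual k (X (-l)) ⊗[k] (⨁ i, X i ⊗[k] V)) l
    (gradedCoev X s V v) = _
  simp only [gradedCoev, LinearMap.sum_apply, LinearMap.comp_apply, map_sum]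
  rw [Finset.sum_eq_single l]
  · exact DirectSum.component.lof_self _ _ _
  · exact fun l' _ h => (DirectSum.component.of _ _ _ _).trans (dif_neg h)
  · intro h
    have := hs l h
    exact Subsingleton.elim _ _

lemma lmap_gradedCoev (hs : ∀ l ∉ s, Subsingleton (X (-l))) (f : V →ₗ[k] W) :
    DirectSum.lmap (fun l => (DirectSum.lmap fun i => f.lTensor (X i)).lTensor
      (Module.Dual k (X (-l)))) ∘ₗ gradedCoev X s V = gradedCoev X s W ∘ₗ f := by
  refine LinearMap.ext fun v => DFinsupp.ext fun l => ?_
  refine (congrArg (LinearMap.lTensor _ _) (gradedCoev_apply X hs l v)).trans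
    (Eq.trans ?_ (gradedCoev_apply X hs l (f v)).symm)
  rw [← lTensor_coevMap, ← LinearMap.lTensor_comp_apply, ← LinearMap.lTensor_comp_apply]
  congr 2
  exact LinearMap.ext fun z => DirectSum.lmap_lof _ _ _

lemma degProj_gradedCoev (hs : ∀ l ∉ s, Subsingleton (X (-l))) (a : ℤ) :
    degProj k _ (-a) ∘ₗ gradedCoev X s V = DirectSum.lmap (fun l =>
      (degProj k (fun i => X i ⊗[k] V) a).lTensor (Module.Dual k (X (-l)))) ∘ₗ
        gradedCoev X s V := by
  refine LinearMap.ext fun v => DFinsupp.ext fun l => ?_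
  refine Eq.trans ?_ (congrArg (LinearMap.lTensor _ _) (gradedCoev_apply X hs l v)).symm
  rw [← LinearMap.lTensor_comp_apply, degProj_comp_lof]
  refine congr($(component_comp_degProj
    (fun l => Module.Dual k (X (-l)) ⊗[k] (⨁ i, X i ⊗[k] V)) (-a) l)
      (gradedCoev X s V v)).trans ?_
  by_cases h : -l = a
  · rw [if_pos h, if_pos (neg_eq_iff_eq_neg.1 h), ← gradedCoev_apply X hs]
    rfl
  · rw [if_neg h, if_neg (fun h' => h (neg_eq_iff_eq_neg.2 h'))]
    simp

lemma gradedEv_lmap_gradedCoev (hs : ∀ l ∉ s, Subsingleton (X (-l))) :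
    gradedEv k X s (⨁ i, X i ⊗[k] V) ∘ₗ
      DirectSum.lmap (fun i => (gradedCoev X s V).lTensor (X i)) = LinearMap.id := by
  refine DirectSum.linearMap_ext k fun i => LinearMap.ext fun z => ?_
  obtain ⟨l, rfl⟩ := neg_surjective i
  simp only [LinearMap.comp_apply, DirectSum.lmap_lof, gradedEv_lof X hs, LinearMap.id_apply]
  rw [← LinearMap.lTensor_comp_apply]
  have : DirectSum.component k ℤ (fun l => Module.Dual k (X (-l)) ⊗[k] (⨁ i, X i ⊗[k] V)) l ∘ₗ
      gradedCoev X s V = (DirectSum.lof k ℤ (fun i => X i ⊗[k] V) (-l)).lTensor _ ∘ₗ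
        coevMap (X (-l)) V := LinearMap.ext fun v => gradedCoev_apply X hs l v
  rw [this, LinearMap.lTensor_comp_apply, evMap_lTensor, evMap_coevMap]

lemma lmap_gradedEv_gradedCoev (hs : ∀ l ∉ s, Subsingleton (X (-l))) :
    DirectSum.lmap (fun l => (gradedEv k X s V).lTensor (Module.Dual k (X (-l)))) ∘ₗ
      gradedCoev X s (⨁ l, Module.Dual k (X (-l)) ⊗[k] V) = LinearMap.id := by
  refine LinearMap.ext fun y => DFinsupp.ext fun l => ?_
  refine (congrArg (LinearMap.lTensor _ _) (gradedCoev_apply X hs l y)).trans ?_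
  rw [← LinearMap.lTensor_comp_apply]
  have : gradedEv k X s V ∘ₗ DirectSum.lof k ℤ
      (fun i => X i ⊗[k] (⨁ l, Module.Dual k (X (-l)) ⊗[k] V)) (-l) = evMap (X (-l)) V ∘ₗ
        (DirectSum.component k ℤ (fun l => Module.Dual k (X (-l)) ⊗[k] V) l).lTensor _ :=
    LinearMap.ext fun z => gradedEv_lof X hs l z
  rw [this, LinearMap.lTensor_comp_apply, lTensor_coevMap, lTensor_evMap_coevMap]
  rfl

variable {X} {Y : ℤ → Type u} [∀ i, AddCommGroup (Y i)] [∀ i, Module k (Y i)]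
  [∀ i, Module.Finite k (Y i)] {t : Finset ℤ}

/-- Since `f` preserves degrees, this reduces in each degree `l` to `rTensor_dualMap_coevMap` for `f
(-l)`. -/
lemma lmap_dualMap_gradedCoev (hs : ∀ l ∉ s, Subsingleton (X (-l)))
    (ht : ∀ l ∉ t, Subsingleton (Y (-l))) (f : ∀ i, X i →ₗ[k] Y i) :
    DirectSum.lmap (fun l => (f (-l)).dualMap.rTensor (⨁ i, Y i ⊗[k] V)) ∘ₗ gradedCoev Y t V =
      DirectSum.lmap (fun l => (DirectSum.lmap fun i => (f i).rTensor V).lTensor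
        (Module.Dual k (X (-l)))) ∘ₗ gradedCoev X s V := by
  refine LinearMap.ext fun v => DFinsupp.ext fun l => ?_
  refine (congrArg (LinearMap.rTensor _ _) (gradedCoev_apply Y ht l v)).trans
    (Eq.trans ?_ (congrArg (LinearMap.lTensor _ _) (gradedCoev_apply X hs l v)).symm)
  rw [← LinearMap.lTensor_comp_apply, ← LinearMap.comp_apply, LinearMap.rTensor_comp_lTensor,
    ← LinearMap.lTensor_comp_rTensor, LinearMap.comp_apply, rTensor_dualMap_coevMap,
    ← LinearMap.lTensor_comp_apply]
  congr 2
  exact LinearMap.ext fun z =>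
    (DirectSum.lmap_lof (fun i => (f i).rTensor V) (-l) z).symm

end Graded

end Coevaluation

/-! ### Duality between `U ⊗ -` and `U^∨ ⊗ -` -/

section DualAdjunction

variable {k : Type u} [Field k]

/-- The dual of a graded vector space of finite total dimension. -/
def dualFin (U : GrFin k) : GrFin k :=
  ⟨(grDual k).obj (op U.obj), isFinTotal_of_finite
    (fun i => inferInstanceAs (Module.Finite k (Module.Dual k (U.obj (-i)))))
    ((gradSupport U).map (Equiv.neg ℤ).toEmbedding) fun i hi => by
      have : Subsingleton (U.obj (-i)) := subsingleton_of_notMem_gradSupport fun h =>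
        hi (Finset.mem_map_equiv.2 h)
      exact inferInstanceAs (Subsingleton (Module.Dual k (U.obj (-i))))⟩

/-- The dual of a morphism of graded vector spaces of finite total dimension. -/
def dualFinMap {U U' : GrFin k} (f : U ⟶ U') : dualFin U' ⟶ dualFin U :=
  ⟨(grDual k).map f.hom.op⟩

/-- The functor `V ↦ U ⊗ V`, with the grading forgotten. -/
abbrev tensorTotal (U : GrFin k) : FGModuleCat.{u} k ⥤ FGModuleCat.{u} k :=
  tensorFunctor U ⋙ total k

lemma subsingleton_of_notMem_neg_gradSupport (U : GrFin k) (l : ℤ)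
    (hl : l ∉ (gradSupport U).map (Equiv.neg ℤ).toEmbedding) : Subsingleton (U.obj (-l)) :=
  subsingleton_of_notMem_gradSupport fun h => hl (Finset.mem_map_equiv.2 h)

/-- The coevaluation `V ⟶ U^∨ ⊗ (U ⊗ V)`. -/
def coev (U : GrFin k) : 𝟭 (FGModuleCat.{u} k) ⟶ tensorTotal U ⋙ tensorTotal (dualFin U) where
  app V := FGModuleCat.ofHom (gradedCoev (fun i => U.obj i)
    ((gradSupport U).map (Equiv.neg ℤ).toEmbedding) V)
  naturality V W f := FGModuleCat.hom_ext
    (lmap_gradedCoev _ (subsingleton_of_notMem_neg_gradSupport U) f.hom.hom).symm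

/-- The evaluation `U ⊗ (U^∨ ⊗ V) ⟶ V`. -/
def ev (U : GrFin k) : tensorTotal (dualFin U) ⋙ tensorTotal U ⟶ 𝟭 (FGModuleCat.{u} k) where
  app V := FGModuleCat.ofHom (gradedEv k (fun i => U.obj i)
    ((gradSupport U).map (Equiv.neg ℤ).toEmbedding) V)
  naturality V W f := FGModuleCat.hom_ext
    (gradedEv_lmap _ (subsingleton_of_notMem_neg_gradSupport U) f.hom.hom)

lemma map_coev_ev (U : GrFin k) (V : FGModuleCat.{u} k) :
    (tensorTotal U).map ((coev U).app V) ≫ (ev U).app ((tensorTotal U).obj V) = 𝟙 _ :=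
  FGModuleCat.hom_ext (gradedEv_lmap_gradedCoev _ (subsingleton_of_notMem_neg_gradSupport U))

lemma coev_map_ev (U : GrFin k) (V : FGModuleCat.{u} k) :
    (coev U).app ((tensorTotal (dualFin U)).obj V) ≫
      (tensorTotal (dualFin U)).map ((ev U).app V) = 𝟙 _ :=
  FGModuleCat.hom_ext (lmap_gradedEv_gradedCoev (V := V) (fun i => U.obj i)
    (subsingleton_of_notMem_neg_gradSupport U))

lemma coev_gradProj (U : GrFin k) (V : FGModuleCat.{u} k) (a : ℤ) :
    (coev U).app V ≫ gradProj (tensorObj (dualFin U) ((tensorTotal U).obj V)) (-a) =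
      (coev U).app V ≫ (tensorTotal (dualFin U)).map (gradProj (tensorObj U V) a) :=
  FGModuleCat.hom_ext (degProj_gradedCoev _ (subsingleton_of_notMem_neg_gradSupport U) a)

lemma gradProj_ev (U : GrFin k) (V : FGModuleCat.{u} k) (a : ℤ) :
    gradProj (tensorObj U ((tensorTotal (dualFin U)).obj V)) a ≫ (ev U).app V =
      (tensorTotal U).map (gradProj (tensorObj (dualFin U) V) (-a)) ≫ (ev U).app V :=
  FGModuleCat.hom_ext (gradedEv_degProj _ (subsingleton_of_notMem_neg_gradSupport U) a)

lemma coev_dinatural {U U' : GrFin k} (f : U ⟶ U') (V : FGModuleCat.{u} k) :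
    (coev U').app V ≫
        (total k).map ((tensorNatTrans (dualFinMap f)).app ((tensorTotal U').obj V)) =
      (coev U).app V ≫
        (tensorTotal (dualFin U)).map ((total k).map ((tensorNatTrans f).app V)) :=
  FGModuleCat.hom_ext (lmap_dualMap_gradedCoev (subsingleton_of_notMem_neg_gradSupport U)
    (subsingleton_of_notMem_neg_gradSupport U') fun i => (f.hom i).hom)

end DualAdjunction

/-! ### Compatibility of `Γ^d` with identities and composites -/

section Gamma

variable {k : Type u} [Field k] {d : ℕ}

section

variable {C D E : Type*} [Category.{v} C] [Preadditive C] [Linear k C]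
  [Category.{v} D] [Preadditive D] [Linear k D] [Category.{v} E] [Preadditive E] [Linear k E]

lemma gammaFunctor_id_map {X Y : GammaCat k d C} (x : X ⟶ Y) :
    (gammaFunctor (k := k) d (𝟭 C)).map x = x :=
  Subtype.ext congr($(PiTensorProduct.map_id) x.1)

lemma gammaFunctor_comp_map (G : C ⥤ D) [G.Additive] [G.Linear k] (H : D ⥤ E) [H.Additive]
    [H.Linear k] {X Y : GammaCat k d C} (x : X ⟶ Y) :
    (gammaFunctor (k := k) d (G ⋙ H)).map x =
      (gammaFunctor d H).map ((gammaFunctor d G).map x) :=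
  Subtype.ext congr($(PiTensorProduct.map_comp (fun _ : Fin d => H.mapLinearMap k)
    (fun _ => (G.mapLinearMap k : (X.of ⟶ Y.of) →ₗ[k] _))) x.1)

end

end Gamma

/-! ### Adjunctions restricted to direct summands -/

section WeightedAdjunction

variable {C D M : Type*} [Category* C] [Category* D] [Category* M]
  {A B : C ⥤ D} {P : D ⥤ C} (η : 𝟭 C ⟶ (A ⋙ P) ⋙ (B ⋙ P)) (ε : (B ⋙ P) ⋙ (A ⋙ P) ⟶ 𝟭 C)
  {F G : C ⥤ M} {K N : D ⥤ M} (iF : K ⟶ P ⋙ F) (pF : P ⋙ F ⟶ K) (iG : N ⟶ P ⋙ G)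
  (pG : P ⋙ G ⟶ N)

/-- The morphism `F ⟶ A ⋙ N` adjoint to a morphism `B ⋙ K ⟶ G`. -/
def weightedTranspose (α : B ⋙ K ⟶ G) : F ⟶ A ⋙ N where
  app X := F.map (η.app X) ≫ pF.app (B.obj (P.obj (A.obj X))) ≫ α.app (P.obj (A.obj X)) ≫
    pG.app (A.obj X)
  naturality X Y f := by
    have h₁ := congrArg F.map (η.naturality f)
    have h₂ := pF.naturality (B.map (P.map (A.map f)))
    have h₃ := α.naturality (P.map (A.map f))
    have h₄ := pG.naturality (A.map f)
    simp only [Functor.comp_map, Functor.map_comp, Functor.id_map] at h₁ h₂ h₃ h₄ ⊢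
    simp only [Category.assoc]
    rw [← h₄, reassoc_of% h₁, reassoc_of% h₂, reassoc_of% h₃]

/-- The morphism `B ⋙ K ⟶ G` adjoint to a morphism `F ⟶ A ⋙ N`. -/
def weightedTransposeInv (β : F ⟶ A ⋙ N) : B ⋙ K ⟶ G where
  app X := iF.app (B.obj X) ≫ β.app (P.obj (B.obj X)) ≫ iG.app (A.obj (P.obj (B.obj X))) ≫
    G.map (ε.app X)
  naturality X Y f := by
    have h₁ := congrArg G.map (ε.naturality f)
    have h₂ := iF.naturality (B.map f)
    have h₃ := β.naturality (P.map (B.map f))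
    have h₄ := iG.naturality (A.map (P.map (B.map f)))
    simp only [Functor.comp_map, Functor.map_comp, Functor.id_map] at h₁ h₂ h₃ h₄ ⊢
    simp only [Category.assoc]
    rw [← h₁, reassoc_of% h₂, reassoc_of% h₃, reassoc_of% h₄]

/-- An adjunction of `A ⋙ P` and `B ⋙ P`, under which the endomorphisms `w` and `w'` of `P`
correspond to each other. -/
structure WeightedDuality (A B : C ⥤ D) (P : D ⥤ C) (w w' : P ⟶ P) where
  /-- the unit -/
  η : 𝟭 C ⟶ (A ⋙ P) ⋙ (B ⋙ P)
  /-- the counit -/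
  ε : (B ⋙ P) ⋙ (A ⋙ P) ⟶ 𝟭 C
  map_η_ε (X : C) : P.map (A.map (η.app X)) ≫ ε.app (P.obj (A.obj X)) = 𝟙 (P.obj (A.obj X))
  η_map_ε (X : C) : η.app (P.obj (B.obj X)) ≫ P.map (B.map (ε.app X)) = 𝟙 (P.obj (B.obj X))
  η_w (X : C) : η.app X ≫ w'.app (B.obj (P.obj (A.obj X))) =
    η.app X ≫ P.map (B.map (w.app (A.obj X)))
  w_ε (X : C) : w.app (A.obj (P.obj (B.obj X))) ≫ ε.app X =
    P.map (A.map (w'.app (B.obj X))) ≫ ε.app X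

variable {w w' : P ⟶ P} (T : WeightedDuality A B P w w') {iF pF iG pG}

/-- The bijection between the morphisms `B ⋙ K ⟶ G` and `F ⟶ A ⋙ N`, where `K` and `N` are the
direct summands of `P ⋙ F` and `P ⋙ G` cut out by `w'` and `w`. -/
def WeightedDuality.homEquiv (hF : iF ≫ pF = 𝟙 K) (hG : iG ≫ pG = 𝟙 N)
    (hF' : ∀ Y, pF.app Y ≫ iF.app Y = F.map (w'.app Y))
    (hG' : ∀ Y, pG.app Y ≫ iG.app Y = G.map (w.app Y)) :
    (B ⋙ K ⟶ G) ≃ (F ⟶ A ⋙ N) where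
  toFun := weightedTranspose T.η pF pG
  invFun := weightedTransposeInv T.ε iF iG
  left_inv α := by
    ext X
    have e₁ := α.naturality (P.map (A.map (w'.app (B.obj X))) ≫ T.ε.app X)
    have e₂ := pF.naturality (B.map (P.map (A.map (w'.app (B.obj X))) ≫ T.ε.app X))
    have e₃ := T.η.naturality (w'.app (B.obj X))
    have e₄ := congr($(hF).app (B.obj X))
    -- Naturality of the unit pulls `w'` in front of it; a triangle identity then removes unit and
    -- counit.
    have e₅ : F.map (T.η.app (P.obj (B.obj X))) ≫ F.map (P.map (B.map (P.map (A.map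
        (w'.app (B.obj X))) ≫ T.ε.app X))) = F.map (w'.app (B.obj X)) := by
      rw [← F.map_comp, B.map_comp, P.map_comp]
      simp only [Functor.comp_map, Functor.id_map] at e₃
      rw [← reassoc_of% e₃, T.η_map_ε]
      exact congrArg F.map (Category.comp_id _)
    simp only [Functor.comp_map, NatTrans.comp_app, NatTrans.id_app] at e₁ e₂ e₄
    simp only [weightedTransposeInv, weightedTranspose, Category.assoc]
    -- The round trip inserts `pG ≫ iG = G(w)` in the middle. The relation `w_ε` turns it into `w'`
    -- on the other side, where `F(w') = pF ≫ iF` is absorbed because `iF ≫ pF = 𝟙`.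
    rw [reassoc_of% (hG' (A.obj (P.obj (B.obj X)))), ← G.map_comp, T.w_ε, ← e₁, ← reassoc_of% e₂,
      reassoc_of% e₅, ← reassoc_of% (hF' (B.obj X)), reassoc_of% e₄, reassoc_of% e₄]
    rfl
  right_inv β := by
    ext X
    have e₁ := β.naturality (T.η.app X ≫ P.map (B.map (w.app (A.obj X))))
    have e₂ := iG.naturality (A.map (T.η.app X ≫ P.map (B.map (w.app (A.obj X)))))
    have e₃ := T.ε.naturality (w.app (A.obj X))
    have e₄ := congr($(hG).app (A.obj X))
    have e₅ : G.map (P.map (A.map (T.η.app X ≫ P.map (B.map (w.app (A.obj X)))))) ≫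
        G.map (T.ε.app (P.obj (A.obj X))) = G.map (w.app (A.obj X)) := by
      rw [← G.map_comp, A.map_comp, P.map_comp]
      simp only [Functor.comp_map, Functor.id_map] at e₃
      rw [Category.assoc, e₃, reassoc_of% (T.map_η_ε X)]
    simp only [Functor.comp_map, NatTrans.comp_app, NatTrans.id_app] at e₁ e₂ e₄
    simp only [weightedTransposeInv, weightedTranspose, Category.assoc]
    -- The mirror argument: `η_w` turns the middle projector `F(w')` into `G(w)`, which cancels
    -- between `iG` and `pG`.
    rw [reassoc_of% (hF' (B.obj (P.obj (A.obj X)))), ← F.map_comp_assoc, T.η_w, reassoc_of% e₁,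
      reassoc_of% e₂, reassoc_of% e₅, ← hG' (A.obj X), Category.assoc, e₄, Category.comp_id, e₄,
      Category.comp_id]

lemma weightedTranspose_comp {G' : C ⥤ M} {N' : D ⥤ M} {pG' : P ⋙ G' ⟶ N'} (g : G ⟶ G')
    (n : N ⟶ N') (h : pG ≫ n = Functor.whiskerLeft P g ≫ pG') (α : B ⋙ K ⟶ G) :
    weightedTranspose η pF pG' (α ≫ g) =
      weightedTranspose η pF pG α ≫ Functor.whiskerLeft A n := by
  ext X
  have e := congr($(h).app (A.obj X))
  simp only [NatTrans.comp_app, Functor.whiskerLeft_app] at e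
  simp only [weightedTranspose, NatTrans.comp_app, Functor.whiskerLeft_app, Category.assoc, e]

lemma weightedTransposeInv_comp {F' : C ⥤ M} {K' : D ⥤ M} {iF' : K' ⟶ P ⋙ F'} (f : F' ⟶ F)
    (m : K' ⟶ K) (h : m ≫ iF = iF' ≫ Functor.whiskerLeft P f) (β : F ⟶ A ⋙ N) :
    weightedTransposeInv ε iF' iG (f ≫ β) =
      Functor.whiskerLeft B m ≫ weightedTransposeInv ε iF iG β := by
  ext X
  have e := congr($(h).app (B.obj X))
  simp only [NatTrans.comp_app, Functor.whiskerLeft_app] at e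
  simp only [weightedTransposeInv, NatTrans.comp_app, Functor.whiskerLeft_app, Category.assoc,
    reassoc_of% e]

/-- Naturality of `pG`, `α` and `pF` carries both `a` and `b` next to the units, where `h` exchanges
them. -/
lemma weightedTranspose_dinatural {A' B' : C ⥤ D} {η' : 𝟭 C ⟶ (A' ⋙ P) ⋙ (B' ⋙ P)}
    (a : A ⟶ A') (b : B' ⟶ B)
    (h : ∀ X, η'.app X ≫ P.map (b.app (P.obj (A'.obj X))) =
      η.app X ≫ P.map (B.map (P.map (a.app X)))) (α : B ⋙ K ⟶ G) :
    weightedTranspose η pF pG α ≫ Functor.whiskerRight a N =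
      weightedTranspose η' pF pG (Functor.whiskerRight b K ≫ α) := by
  ext X
  have e₁ := pG.naturality (a.app X)
  have e₂ := α.naturality (P.map (a.app X))
  have e₃ := pF.naturality (B.map (P.map (a.app X)))
  have e₄ := pF.naturality (b.app (P.obj (A'.obj X)))
  have e₅ := congrArg F.map (h X)
  simp only [Functor.comp_map, Functor.map_comp] at e₁ e₂ e₃ e₄ e₅
  simp only [weightedTranspose, NatTrans.comp_app, Functor.whiskerRight_app, Category.assoc]
  rw [← e₁, ← reassoc_of% e₂, ← reassoc_of% e₃, ← reassoc_of% e₄, reassoc_of% e₅]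

end WeightedAdjunction

/-! ### Dualities on `Γ^d C` induced from `C` -/

section GammaUnit

variable {k : Type u} [Field k] {d : ℕ}

variable {C D : Type*} [Category.{v} C] [Preadditive C] [Linear k C]
  [Category.{v} D] [Preadditive D] [Linear k D]
  {A B : C ⥤ D} {P : D ⥤ C} [A.Additive] [A.Linear k] [B.Additive] [B.Linear k]
  [P.Additive] [P.Linear k]

/-- Needed because a unit on `C` gives a natural transformation into `Γ^d` of a composite, while the
duality is phrased with the composite of the `Γ^d`s. -/
lemma gammaFunctor_four_map {X Y : GammaCat k d C} (x : X ⟶ Y) :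
    (gammaFunctor (k := k) d ((A ⋙ P) ⋙ (B ⋙ P))).map x =
      ((gammaFunctor (k := k) d A ⋙ gammaFunctor d P) ⋙
        (gammaFunctor d B ⋙ gammaFunctor d P)).map x :=
  (gammaFunctor_comp_map (A ⋙ P) (B ⋙ P) x).trans <|
    (gammaFunctor_comp_map B P _).trans <|
      congrArg (fun z => (gammaFunctor d P).map ((gammaFunctor d B).map z))
        (gammaFunctor_comp_map A P x)

variable (k d) in
/-- The natural transformation of `Γ^d C` induced by a natural transformation from the identity
to a composition. -/
def gammaUnit (η : 𝟭 C ⟶ (A ⋙ P) ⋙ (B ⋙ P)) :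
    𝟭 (GammaCat k d C) ⟶ (gammaFunctor d A ⋙ gammaFunctor d P) ⋙
      (gammaFunctor d B ⋙ gammaFunctor d P) where
  app X := diagHom k d (η.app X.of)
  naturality X Y x := (congrArg (· ≫ diagHom k d (η.app Y.of)) (gammaFunctor_id_map x).symm).trans
    (((gammaNatTrans k d η).naturality x).trans
      (congrArg (diagHom k d (η.app X.of) ≫ ·) (gammaFunctor_four_map x)))

variable (k d) in
/-- The natural transformation of `Γ^d C` induced by a natural transformation from a composition
to the identity. -/
def gammaCounit (ε : (A ⋙ P) ⋙ (B ⋙ P) ⟶ 𝟭 C) :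
    (gammaFunctor d A ⋙ gammaFunctor d P) ⋙ (gammaFunctor d B ⋙ gammaFunctor d P) ⟶
      𝟭 (GammaCat k d C) where
  app X := diagHom k d (ε.app X.of)
  naturality X Y x := (congrArg (· ≫ diagHom k d (ε.app Y.of)) (gammaFunctor_four_map x).symm).trans
    (((gammaNatTrans k d ε).naturality x).trans
      (congrArg (diagHom k d (ε.app X.of) ≫ ·) (gammaFunctor_id_map x)))

lemma gammaFunctor_comp_map_diagHom {X Y : C} (f : X ⟶ Y) :
    (gammaFunctor (k := k) d A ⋙ gammaFunctor d P).map (diagHom k d f) =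
      diagHom k d (P.map (A.map f)) :=
  (congrArg (gammaFunctor d P).map (gammaFunctor_map_diagHom A f)).trans
    (gammaFunctor_map_diagHom P (A.map f))

variable (η : 𝟭 C ⟶ (A ⋙ P) ⋙ (B ⋙ P)) (ε : (B ⋙ P) ⋙ (A ⋙ P) ⟶ 𝟭 C)

variable (k d) in
/-- The duality on `Γ^d C` induced by an adjunction of functors on `C`. -/
def gammaDuality {w w' : gammaFunctor (k := k) d P ⟶ gammaFunctor d P}
    (h₁ : ∀ V, P.map (A.map (η.app V)) ≫ ε.app (P.obj (A.obj V)) = 𝟙 (P.obj (A.obj V)))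
    (h₂ : ∀ V, η.app (P.obj (B.obj V)) ≫ P.map (B.map (ε.app V)) = 𝟙 (P.obj (B.obj V)))
    (hη : ∀ V, PiTensorProduct.map₂ (fun _ => Linear.comp (S := k) _ _ _)
        (PiTensorProduct.tprod k fun _ => η.app V) (w'.app ⟨B.obj (P.obj (A.obj V))⟩).1 =
      PiTensorProduct.map₂ (fun _ => Linear.comp (S := k) _ _ _)
        (PiTensorProduct.tprod k fun _ => η.app V)
        (PiTensorProduct.map (fun _ => (B ⋙ P).mapLinearMap k) (w.app ⟨A.obj V⟩).1))
    (hε : ∀ V, PiTensorProduct.map₂ (fun _ => Linear.comp (S := k) _ _ _)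
        (w.app ⟨A.obj (P.obj (B.obj V))⟩).1 (PiTensorProduct.tprod k fun _ => ε.app V) =
      PiTensorProduct.map₂ (fun _ => Linear.comp (S := k) _ _ _)
        (PiTensorProduct.map (fun _ => (A ⋙ P).mapLinearMap k) (w'.app ⟨B.obj V⟩).1)
        (PiTensorProduct.tprod k fun _ => ε.app V)) :
    WeightedDuality (gammaFunctor (k := k) d A) (gammaFunctor d B) (gammaFunctor d P) w w' where
  η := gammaUnit k d η
  ε := gammaCounit k d ε
  map_η_ε X := (congrArg (· ≫ _)
    (gammaFunctor_comp_map_diagHom (A := A) (P := P) (η.app X.of))).trans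
      ((diagHom_comp _ _).symm.trans (congrArg (diagHom k d) (h₁ X.of)))
  η_map_ε X := (congrArg (_ ≫ ·)
    (gammaFunctor_comp_map_diagHom (A := B) (P := P) (ε.app X.of))).trans
      ((diagHom_comp _ _).symm.trans (congrArg (diagHom k d) (h₂ X.of)))
  η_w X := (Subtype.ext (hη X.of)).trans (congrArg (diagHom k d (η.app X.of) ≫ ·)
    (gammaFunctor_comp_map B P (w.app ⟨A.obj X.of⟩)))
  w_ε X := (Subtype.ext (hε X.of)).trans (congrArg (· ≫ diagHom k d (ε.app X.of))
    (gammaFunctor_comp_map A P (w'.app ⟨B.obj X.of⟩)))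

variable {A' B' : C ⥤ D} [A'.Additive] [A'.Linear k] [B'.Additive] [B'.Linear k]
  (η' : 𝟭 C ⟶ (A' ⋙ P) ⋙ (B' ⋙ P)) (a : A ⟶ A') (b : B' ⟶ B)

lemma gammaUnit_dinatural (h : ∀ V, η'.app V ≫ P.map (b.app (P.obj (A'.obj V))) =
      η.app V ≫ P.map (B.map (P.map (a.app V)))) (X : GammaCat k d C) :
    (gammaUnit k d η').app X ≫ (gammaFunctor d P).map
        ((gammaNatTrans k d b).app ((gammaFunctor (k := k) d A' ⋙ gammaFunctor d P).obj X)) =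
      (gammaUnit k d η).app X ≫ (gammaFunctor (k := k) d B ⋙ gammaFunctor d P).map
        ((gammaFunctor d P).map ((gammaNatTrans k d a).app X)) := by
  refine (congrArg (_ ≫ ·) (gammaFunctor_map_diagHom P _)).trans
    ((diagHom_comp _ _).symm.trans ?_)
  refine Eq.trans ?_ (congrArg (fun z => (gammaUnit k d η).app X ≫
    (gammaFunctor (k := k) d B ⋙ gammaFunctor d P).map z)
      (gammaFunctor_map_diagHom P (a.app X.of)).symm)
  refine Eq.trans ?_ (congrArg (_ ≫ ·)
    (gammaFunctor_comp_map_diagHom (A := B) (P := P) (P.map (a.app X.of))).symm)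
  exact (congrArg (diagHom k d) (h X.of)).trans (diagHom_comp _ _)

variable (d) in
/-- A natural endomorphism of `Γ^d P`, from a family of elements of `Γ^d Hom(P W, P W)`. -/
def gammaNatEnd (w : ∀ W : D, gammaPow k d (P.obj W ⟶ P.obj W))
    (h : ∀ (W W' : D) (x : gammaPow k d (W ⟶ W')),
      PiTensorProduct.map₂ (fun _ => Linear.comp (S := k) _ _ _) (w W).1
        (PiTensorProduct.map (fun _ => (P.mapLinearMap k : (W ⟶ W') →ₗ[k] _)) x.1) =
      PiTensorProduct.map₂ (fun _ => Linear.comp (S := k) _ _ _)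
        (PiTensorProduct.map (fun _ => (P.mapLinearMap k : (W ⟶ W') →ₗ[k] _)) x.1) (w W').1) :
    gammaFunctor (k := k) d P ⟶ gammaFunctor d P where
  app W := w W.of
  naturality W W' x := Subtype.ext (h W.of W'.of x).symm

end GammaUnit

/-! ### Weights `j` and `-j` under duality -/

section GammaWeight

variable {k : Type u} [Field k] {d : ℕ}

lemma sum_piFinset_neg {M : Type*} [AddCommMonoid M] (s : Finset ℤ) (j : ℤ)
    (g : (Fin d → ℤ) → M) :
    ∑ a ∈ Fintype.piFinset (fun _ : Fin d => s.map (Equiv.neg ℤ).toEmbedding) with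
        ∑ m, a m = -j, g a =
      ∑ a ∈ Fintype.piFinset (fun _ : Fin d => s) with ∑ m, a m = j, g fun m => - a m := by
  refine Finset.sum_equiv (Equiv.neg _) (fun a => ?_) fun a _ => ?_
  · simp only [Finset.mem_filter, Fintype.mem_piFinset, Finset.mem_map_equiv]
    refine and_congr (Iff.rfl) ?_
    change _ ↔ ∑ m, - a m = j
    rw [Finset.sum_neg_distrib, neg_eq_iff_eq_neg]
  · exact congrArg g (funext fun m => (neg_neg (a m)).symm)

lemma map_weightTensor {X : FGModuleCat.{u} k} (W : GrFin k)
    (G : ((total k).obj W ⟶ (total k).obj W) →ₗ[k] (X ⟶ X)) (j : ℤ) (s : Finset ℤ) :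
    PiTensorProduct.map (fun _ => G) (weightTensor d W j s) =
      ∑ a ∈ Fintype.piFinset (fun _ : Fin d => s) with ∑ m, a m = j,
        PiTensorProduct.tprod k fun m => G (gradProj W (a m)) := by
  simp only [weightTensor, map_sum, PiTensorProduct.map_tprod]

/-- With one index set serving `W`, and its negative serving `W'`, the weight tensors become sums
over matching tuples; enlarging the index set is harmless by `weightTensor_eq`. -/
lemma exists_symm_support (W W' : GrFin k) : ∃ s : Finset ℤ, gradSupport W ⊆ s ∧
    gradSupport W' ⊆ s.map (Equiv.neg ℤ).toEmbedding := by
  refine ⟨gradSupport W ∪ (gradSupport W').map (Equiv.neg ℤ).toEmbedding,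
    Finset.subset_union_left, fun i hi => ?_⟩
  rw [Finset.mem_map_equiv]
  refine Finset.mem_union_right _ (Finset.mem_map_equiv.2 ?_)
  simpa using hi

/-- After the substitution `a ↦ -a` the two sums agree term by term, by `h` in each tensor factor.
-/
lemma map₂_tprod_weightHom_neg {X : FGModuleCat.{u} k} {W W' : GrFin k}
    (G : ((total k).obj W ⟶ (total k).obj W) →ₗ[k] ((total k).obj W' ⟶ (total k).obj W'))
    (f : X ⟶ (total k).obj W') (j : ℤ)
    (h : ∀ a, f ≫ gradProj W' (-a) = f ≫ G (gradProj W a)) :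
    PiTensorProduct.map₂ (fun _ => Linear.comp (S := k) _ _ _)
        (PiTensorProduct.tprod k fun _ => f) (weightHom d W' (-j)).1 =
      PiTensorProduct.map₂ (fun _ => Linear.comp (S := k) _ _ _)
        (PiTensorProduct.tprod k fun _ => f)
        (PiTensorProduct.map (fun _ => G) (weightHom d W j).1) := by
  obtain ⟨s, hs, hs'⟩ := exists_symm_support W W'
  refine (congrArg (PiTensorProduct.map₂ _ _) (weightTensor_eq d (-j) hs').symm).trans ?_
  refine Eq.trans ?_ (congrArg (fun z => PiTensorProduct.map₂ _ _ (PiTensorProduct.map _ z))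
    (weightTensor_eq d j hs))
  refine (map₂_tprod_weightTensor _ (-j) _ fun _ => f).trans ?_
  rw [map_weightTensor, map_sum, sum_piFinset_neg]
  refine Finset.sum_congr rfl fun a _ => ?_
  refine Eq.trans ?_ (PiTensorProduct.map₂_tprod_tprod _ _ _).symm
  exact congrArg _ (funext fun m => h (a m))

lemma map₂_weightHom_tprod {X : FGModuleCat.{u} k} {W W' : GrFin k}
    (G : ((total k).obj W' ⟶ (total k).obj W') →ₗ[k] ((total k).obj W ⟶ (total k).obj W))
    (f : (total k).obj W ⟶ X) (j : ℤ)
    (h : ∀ a, gradProj W a ≫ f = G (gradProj W' (-a)) ≫ f) :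
    PiTensorProduct.map₂ (fun _ => Linear.comp (S := k) _ _ _)
        (weightHom d W j).1 (PiTensorProduct.tprod k fun _ => f) =
      PiTensorProduct.map₂ (fun _ => Linear.comp (S := k) _ _ _)
        (PiTensorProduct.map (fun _ => G) (weightHom d W' (-j)).1)
        (PiTensorProduct.tprod k fun _ => f) := by
  obtain ⟨s, hs, hs'⟩ := exists_symm_support W W'
  refine (congrArg (fun z => PiTensorProduct.map₂ _ z _) (weightTensor_eq d j hs).symm).trans ?_
  refine Eq.trans ?_ (congrArg (fun z => PiTensorProduct.map₂ _ (PiTensorProduct.map _ z) _)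
    (weightTensor_eq d (-j) hs'))
  refine (map₂_weightTensor_tprod _ j _ fun _ => f).trans ?_
  rw [map_weightTensor, map_sum, LinearMap.sum_apply, sum_piFinset_neg]
  refine Finset.sum_congr rfl fun a _ => ?_
  refine Eq.trans ?_ (PiTensorProduct.map₂_tprod_tprod _ _ _).symm
  exact congrArg _ (funext fun m => h (a m))

variable (k d) in
/-- The morphisms `weightHom`, as a natural transformation. -/
def weightNat (j : ℤ) :
    gammaFunctor (k := k) d (total k) ⟶ gammaFunctor (k := k) d (total k) :=
  gammaNatEnd d (fun W => weightHom d W j)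
    fun W W' x => by
      have h := map₂_weightTensor_comm d j (gradSupport W ∪ gradSupport W') x.1
      rw [weightTensor_eq d j Finset.subset_union_left,
        weightTensor_eq d j Finset.subset_union_right] at h
      exact h

variable (d) in
/-- The duality between `U ⊗ -` and `U^∨ ⊗ -`, under which the weights `j` and `-j` correspond to
each other. -/
def tensorDuality (U : GrFin k) (j : ℤ) :
    WeightedDuality ((gammaTensor k d).obj U) ((gammaTensor k d).obj (dualFin U))
      (gammaFunctor (k := k) d (total k)) (weightNat k d j) (weightNat k d (-j)) :=
  gammaDuality k d (A := tensorFunctor U) (B := tensorFunctor (dualFin U)) (P := total k)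
    (coev U) (ev U) (by exact map_coev_ev U) (by exact coev_map_ev U)
    (by
      intro V
      exact map₂_tprod_weightHom_neg ((tensorTotal (dualFin U)).mapLinearMap k)
        ((coev U).app V) j (coev_gradProj U V))
    (by
      intro V
      exact map₂_weightHom_tprod ((tensorTotal U).mapLinearMap k) ((ev U).app V) j
        (gradProj_ev U V))

-- The image under `Γ^d` of `coev_dinatural`.
set_option maxHeartbeats 1000000 in
lemma tensorDuality_dinatural {U U' : GrFin k} (f : U ⟶ U') (j : ℤ) (X : GammaV k d) :
    (tensorDuality d U' j).η.app X ≫ (gammaFunctor d (total k)).map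
        (((gammaTensor k d).map (dualFinMap f)).app
          ((gammaFunctor d (total k)).obj (((gammaTensor k d).obj U').obj X))) =
      (tensorDuality d U j).η.app X ≫ (gammaFunctor d (total k)).map
        (((gammaTensor k d).obj (dualFin U)).map
          ((gammaFunctor d (total k)).map (((gammaTensor k d).map f).app X))) := by
  have e := gammaUnit_dinatural (k := k) (d := d) (coev U) (coev U') (tensorNatTrans f)
    (tensorNatTrans (dualFinMap f)) (by exact coev_dinatural f) X
  change (gammaUnit k d (coev U')).app X ≫ _ = (gammaUnit k d (coev U)).app X ≫ _
  exact e

end GammaWeight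

/-! ### The adjunction between weight components on `𝒫_d` -/

section ParamFunctor

variable {k : Type u} [Field k] {d : ℕ}

lemma hasFiniteValues_paramObj (U : GrFin k) (F : StrictPoly k d) (j : ℤ) :
    hasFiniteValues k (GammaV k d) (paramObj U F j).obj := fun X => by
  have := F.property.2 ((gammaFunctor d (total k)).obj (((gammaTensor k d).obj U).obj X))
  exact inferInstanceAs (Module.Finite k
    (weightSpace F.obj (((gammaTensor k d).obj U).obj X).of j))

/-- The functor `F ↦ F(U ⊗ -)^j` on strict polynomial functors. -/
def paramFunctor (U : GrFin k) (j : ℤ) : StrictPoly k d ⥤ StrictPoly k d where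
  obj F := toStrictPoly (paramObj U F j) (hasFiniteValues_paramObj U F j)
  map {F G} α := toStrictPolyMap (paramObjMap U α j) _ _
  map_id F := ObjectProperty.hom_ext _
    congr($(paramObjMap_id U F j).hom)
  map_comp α β := ObjectProperty.hom_ext _
    congr($(paramObjMap_comp U α β j).hom)

instance (U : GrFin k) (j : ℤ) : (paramFunctor (d := d) U j).Additive where
  map_add := rfl

instance (U : GrFin k) (j : ℤ) : (paramFunctor (d := d) U j).Linear k where
  map_smul _ _ := rfl

instance (U : GrFin k) (j : ℤ) : PreservesFiniteLimits (paramFunctor (d := d) U j) :=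
  preservesFiniteLimits_of_comp_evaluation _ fun X =>
    inferInstanceAs (PreservesFiniteLimits
      (gradedEvalFunctor (((gammaTensor k d).obj U).obj X) j))

instance (U : GrFin k) (j : ℤ) : PreservesFiniteColimits (paramFunctor (d := d) U j) :=
  preservesFiniteColimits_of_comp_evaluation _ fun X =>
    inferInstanceAs (PreservesFiniteColimits
      (gradedEvalFunctor (((gammaTensor k d).obj U).obj X) j))

/-- The natural transformation `F(U ⊗ -)^j ⟶ F(U' ⊗ -)^j` induced by `f : U ⟶ U'`. -/
def paramFunctorMap {U U' : GrFin k} (f : U ⟶ U') (j : ℤ) :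
    paramFunctor (d := d) U j ⟶ paramFunctor U' j where
  app F := toStrictPolyMap (paramMap f F j) (hasFiniteValues_paramObj U F j)
    (hasFiniteValues_paramObj U' F j)
  naturality F G α := ObjectProperty.hom_ext _
    congr($(paramMap_naturality f α j).hom)

/-- The bijection between the morphisms `F(U^∨ ⊗ -)^{-j} ⟶ G` and `F ⟶ G(U ⊗ -)^j`. -/
def paramHomEquiv (U : GrFin k) (j : ℤ) (F G : StrictPoly k d) :
    ((gammaTensor k d).obj (dualFin U) ⋙ gradedEval F.obj (-j) ⟶ G.obj) ≃
      (F.obj ⟶ (gammaTensor k d).obj U ⋙ gradedEval G.obj j) :=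
  (tensorDuality d U j).homEquiv (weightIncl_weightProj F.obj F.property.1 (-j))
    (weightIncl_weightProj G.obj G.property.1 j)
    (by exact weightProj_weightIncl_app F.obj F.property.1 (-j))
    (by exact weightProj_weightIncl_app G.obj G.property.1 j)

lemma paramHomEquiv_comp (U : GrFin k) (j : ℤ) (F : StrictPoly k d) {G G' : StrictPoly k d}
    (α : (gammaTensor k d).obj (dualFin U) ⋙ gradedEval F.obj (-j) ⟶ G.obj) (g : G ⟶ G') :
    paramHomEquiv U j F G' (α ≫ g.hom) = paramHomEquiv U j F G α ≫
      Functor.whiskerLeft ((gammaTensor k d).obj U) (gradedEvalMap g.hom j) :=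
  weightedTranspose_comp _ g.hom _
    (weightProj_gradedEvalMap g.hom G.property.1 G'.property.1 j) α

lemma paramHomEquiv_symm_comp (U : GrFin k) (j : ℤ) {F F' : StrictPoly k d} (G : StrictPoly k d)
    (f : F' ⟶ F) (β : F.obj ⟶ (gammaTensor k d).obj U ⋙ gradedEval G.obj j) :
    (paramHomEquiv U j F' G).symm (f.hom ≫ β) =
      Functor.whiskerLeft ((gammaTensor k d).obj (dualFin U)) (gradedEvalMap f.hom (-j)) ≫
        (paramHomEquiv U j F G).symm β :=
  weightedTransposeInv_comp _ f.hom _ (gradedEvalMap_weightIncl f.hom (-j)) β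

lemma paramHomEquiv_dinatural {U U' : GrFin k} (f : U ⟶ U') (j : ℤ) (F G : StrictPoly k d)
    (α : (gammaTensor k d).obj (dualFin U) ⋙ gradedEval F.obj (-j) ⟶ G.obj) :
    paramHomEquiv U j F G α ≫
        Functor.whiskerRight ((gammaTensor k d).map f) (gradedEval G.obj j) =
      paramHomEquiv U' j F G (Functor.whiskerRight ((gammaTensor k d).map (dualFinMap f))
        (gradedEval F.obj (-j)) ≫ α) :=
  weightedTranspose_dinatural _ _ _ (tensorDuality_dinatural f j) α

/-- The functor `F ↦ F(U^∨ ⊗ -)^{-j}` is left adjoint to `G ↦ G(U ⊗ -)^j`. -/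
def paramAdjunction (U : GrFin k) (j : ℤ) :
    paramFunctor (d := d) (dualFin U) (-j) ⊣ paramFunctor U j :=
  Adjunction.mkOfHomEquiv
    { homEquiv F G :=
        { toFun α := ObjectProperty.homMk (paramHomEquiv U j F G α.hom)
          invFun β := ObjectProperty.homMk ((paramHomEquiv U j F G).symm β.hom)
          left_inv α := ObjectProperty.hom_ext _ ((paramHomEquiv U j F G).symm_apply_apply α.hom)
          right_inv β := ObjectProperty.hom_ext _ ((paramHomEquiv U j F G).apply_symm_apply β.hom) }
      homEquiv_naturality_left_symm {F' F G} f β :=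
        ObjectProperty.hom_ext _ (paramHomEquiv_symm_comp U j G f β.hom)
      homEquiv_naturality_right {F G G'} α g :=
        ObjectProperty.hom_ext _ (paramHomEquiv_comp U j F α.hom g) }

/-- The unit is the transpose of an identity. Dinaturality and naturality of transposition identify
both sides with the transpose of the map induced by `dualFinMap f`, so the transformations induced
by `f` and its dual are mates. -/
lemma paramAdjunction_unit_dinatural {U U' : GrFin k} (f : U ⟶ U') (j : ℤ) (F : StrictPoly k d) :
    (paramAdjunction U j).unit.app F ≫
        (paramFunctorMap f j).app ((paramFunctor (dualFin U) (-j)).obj F) =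
      (paramAdjunction U' j).unit.app F ≫
        (paramFunctor U' j).map ((paramFunctorMap (dualFinMap f) (-j)).app F) := by
  refine ObjectProperty.hom_ext _ ?_
  have h₁ := paramHomEquiv_dinatural f j F ((paramFunctor (dualFin U) (-j)).obj F) (𝟙 _)
  have h₂ := paramHomEquiv_comp U' j F (𝟙 ((paramFunctor (dualFin U') (-j)).obj F).obj)
    ((paramFunctorMap (dualFinMap f) (-j)).app F)
  exact h₁.trans ((congrArg (paramHomEquiv U' j F ((paramFunctor (dualFin U) (-j)).obj F))
    ((Category.comp_id _).trans (Category.id_comp _).symm)).trans h₂)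

end ParamFunctor

/-! ### Comparing a parameter with its finite truncations -/

section Comparison

variable {k : Type u} [Field k] {d : ℕ}

/-- The morphism `F(U ⊗ -) ⟶ F_E` induced by a morphism `U ⟶ E`, for `U` of finite total
dimension. -/
def paramToLower {U : GrFin k} {E : GrVect k} (i : U.obj ⟶ E) :
    (param k d).obj U ⟶ (lower k d).obj E :=
  (lowerNatIsoParam k d).inv.app U ≫ (lower k d).map i

lemma paramToLower_comp {U U' : GrFin k} {E E' : GrVect k} (i : U.obj ⟶ E) (i' : U'.obj ⟶ E')
    (u : U ⟶ U') (f : E ⟶ E') (h : i ≫ f = u.hom ≫ i') :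
    paramToLower (d := d) i ≫ (lower k d).map f = (param k d).map u ≫ paramToLower i' := by
  have h₁ : (param k d).map u ≫ (lowerNatIsoParam k d).inv.app U' =
      (lowerNatIsoParam k d).inv.app U ≫ (lower k d).map u.hom :=
    (lowerNatIsoParam k d).inv.naturality u
  unfold paramToLower
  rw [Category.assoc, ← Functor.map_comp, h, Functor.map_comp, ← Category.assoc, ← Category.assoc,
    h₁]

lemma isIso_paramToLower_app {U : GrFin k} {E : GrVect k} (i : U.obj ⟶ E) (p : E ⟶ U.obj)
    (hip : i ≫ p = 𝟙 _) (F : StrictPoly k d) (j : ℤ) (h : lowerMap (p ≫ i) F j = 𝟙 _) :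
    IsIso ((paramToLower i).app F j) := by
  have : IsIso (((lowerNatIsoParam k d).inv.app U).app F j) :=
    ((degEval k d j).mapIso (lowerIsoParam U F)).isIso_inv
  have : IsIso (lowerMap i F j) := (lowerRetractIso i p hip F j h).isIso_hom
  exact IsIso.comp_isIso' (f := ((lowerNatIsoParam k d).inv.app U).app F j) ‹_› ‹_›

variable {E E' : GrVect k} (hE : IsNonnegFinite E) (hE' : IsNonnegFinite E')

/-- The part of `E` in degrees `≤ i`. -/
def truncFin (i : ℤ) : GrFin k :=
  ⟨subGr E (truncSub E i), isFinTotal_of_finite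
    (fun l => by
      have := hE.finite l
      exact inferInstanceAs (Module.Finite k (truncSub E i l)))
    -- Degrees below `0` vanish by the assumption on `E`, and degrees above `i` by truncation.
    (Finset.Icc 0 i) fun l hl => by
      refine ⟨fun x y => ?_⟩
      by_cases h : l ≤ i
      · have := hE.nonneg l (by
          rw [Finset.mem_Icc] at hl
          omega)
        exact Subtype.ext (Subsingleton.elim _ _)
      · exact Subtype.ext ((eq_zero_of_mem_truncSub E h x.2).trans
          (eq_zero_of_mem_truncSub E h y.2).symm)⟩

/-- The inclusion of the part in degrees `≤ i`. -/
def truncFinIncl (i : ℤ) : (truncFin hE i).obj ⟶ E := subGrIncl E (truncSub E i)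

/-- The inclusion of the dual of the part in degrees `≤ i` into the dual. -/
def dualTruncFinIncl (i : ℤ) : (dualFin (truncFin hE i)).obj ⟶ (grDual k).obj (op E) :=
  (grDual k).map (truncProj E i).op

/-- The restriction of a morphism to the parts in degrees `≤ i`. -/
def truncFinMap (f : E ⟶ E') (i : ℤ) : truncFin hE i ⟶ truncFin hE' i :=
  ⟨subGrIncl E (truncSub E i) ≫ f ≫ truncProj E' i⟩

/-- A degree-preserving map carries the part in degrees `≤ i` into the corresponding part of the
target, so projecting there loses nothing. -/
lemma truncFinIncl_comp (f : E ⟶ E') (i : ℤ) :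
    truncFinIncl hE i ≫ f = (truncFinMap hE hE' f i).hom ≫ truncFinIncl hE' i := by
  funext l
  by_cases h : l ≤ i
  · have := truncProj_subGrIncl_apply_of_le E' h
    rw [grVect_comp_apply] at this
    change subGrIncl E (truncSub E i) l ≫ f l =
      (subGrIncl E (truncSub E i) l ≫ f l ≫ truncProj E' i l) ≫ subGrIncl E' (truncSub E' i) l
    rw [Category.assoc, Category.assoc, this, Category.comp_id]
  · refine ModuleCat.hom_ext <| LinearMap.ext fun (x : truncSub E i l) => ?_
    have : x = 0 := Subtype.ext (eq_zero_of_mem_truncSub E h x.2)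
    rw [this]
    exact (map_zero _).trans (map_zero _).symm

lemma truncProj_truncFinMap (f : E ⟶ E') (i : ℤ) :
    f ≫ truncProj E' i = truncProj E i ≫ (truncFinMap hE hE' f i).hom := by
  funext l
  change f l ≫ truncProj E' i l =
    truncProj E i l ≫ subGrIncl E (truncSub E i) l ≫ f l ≫ truncProj E' i l
  by_cases h : l ≤ i
  · have := truncProj_subGrIncl_apply_of_le E h
    rw [grVect_comp_apply] at this
    rw [← Category.assoc (truncProj E i l), this, Category.id_comp]
  · rw [truncProj_of_not_le E' h]
    simp only [comp_zero]

lemma dualTruncFinIncl_comp (f : E ⟶ E') (i : ℤ) :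
    dualTruncFinIncl hE' i ≫ (grDual k).map f.op =
      (dualFinMap (truncFinMap hE hE' f i)).hom ≫ dualTruncFinIncl hE i := by
  refine ((grDual k).map_comp _ _).symm.trans (Eq.trans ?_ ((grDual k).map_comp _ _))
  exact congrArg (fun z => (grDual k).map (Quiver.Hom.op z)) (truncProj_truncFinMap hE hE' f i)

lemma isIso_paramToLower_truncFinIncl (F : StrictPoly k d) (j : ℤ) :
    IsIso ((paramToLower (truncFinIncl hE j)).app F j) :=
  isIso_paramToLower_app (U := truncFin hE j) (truncFinIncl hE j) (truncProj E j)
    (subGrIncl_truncProj E j) F j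
    (lowerMap_truncProj_subGrIncl hE F le_rfl)

lemma isIso_paramToLower_dualTruncFinIncl (F : StrictPoly k d) (j : ℤ) :
    IsIso ((paramToLower (dualTruncFinIncl hE j)).app F (-j)) :=
  isIso_paramToLower_app (U := dualFin (truncFin hE j)) (dualTruncFinIncl hE j)
    ((grDual k).map (subGrIncl E (truncSub E j)).op)
    (by
      refine ((grDual k).map_comp _ _).symm.trans (Eq.trans ?_ ((grDual k).map_id _))
      exact congrArg (fun z => (grDual k).map (Quiver.Hom.op z)) (subGrIncl_truncProj E j))
    F (-j) (lowerMap_grDual_truncProj_subGrIncl hE F le_rfl)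

lemma hasFiniteValues_of_isIso {X Y : StrictPolyVect k d} (f : X ⟶ Y) [IsIso f]
    (hX : hasFiniteValues k (GammaV k d) X.obj) : hasFiniteValues k (GammaV k d) Y.obj :=
  fun X => by
    have := hX X
    have : IsIso f.hom := inferInstanceAs (IsIso ((isLinearFunctor k).ι.map f))
    exact Module.Finite.of_surjective (f.hom.app X).hom
      ((ModuleCat.epi_iff_surjective _).1 inferInstance)

end Comparison

/-! ### Transport of `Ext` along isomorphisms -/

section ExtIso

open Abelian

variable {C : Type*} [Category* C] [Abelian C] [HasExt.{v} C] (k : Type*) [Ring k] [Linear k C]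

/-- The isomorphism on `Ext` given by an isomorphism of the first argument. -/
def extIsoLeft {X X' : C} (e : X ≅ X') (Y : C) (n : ℕ) : Ext X' Y n ≃ₗ[k] Ext X Y n where
  toFun x := (Ext.mk₀ e.hom).comp x (zero_add n)
  map_add' x y := by simp
  map_smul' r x := by simp
  invFun x := (Ext.mk₀ e.inv).comp x (zero_add n)
  left_inv x := by simp
  right_inv x := by simp

/-- The isomorphism on `Ext` given by an isomorphism of the second argument. -/
def extIsoRight (X : C) {Y Y' : C} (e : Y ≅ Y') (n : ℕ) : Ext X Y n ≃ₗ[k] Ext X Y' n where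
  toFun x := x.comp (Ext.mk₀ e.hom) (add_zero n)
  map_add' x y := by simp
  map_smul' r x := by simp
  invFun x := x.comp (Ext.mk₀ e.inv) (add_zero n)
  left_inv x := by simp
  right_inv x := by simp

end ExtIso

/-! ### The `Ext` isomorphism and its naturality -/

section Main

variable {k : Type u} [Field k] {d : ℕ}

lemma isIso_toStrictPolyMap {X Y : StrictPolyVect k d} (f : X ⟶ Y) [IsIso f]
    (hX : hasFiniteValues k (GammaV k d) X.obj) (hY : hasFiniteValues k (GammaV k d) Y.obj) :
    IsIso (toStrictPolyMap f hX hY) :=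
  ⟨toStrictPolyMap (inv f) hY hX, ObjectProperty.hom_ext _ congr($(IsIso.hom_inv_id f).hom),
    ObjectProperty.hom_ext _ congr($(IsIso.inv_hom_id f).hom)⟩

variable {E E' : GrVect k}

/-- In degree `j`, `E` may be replaced by its part in degrees `≤ j`, where the value is a weight
space of a finite-dimensional space. -/
lemma hasFiniteValues_lower (hE : IsNonnegFinite E) (F : StrictPoly k d) (j : ℤ) :
    hasFiniteValues k (GammaV k d) (((lower k d).obj E).obj F j).obj :=
  have := isIso_paramToLower_truncFinIncl hE F j
  hasFiniteValues_of_isIso ((paramToLower (truncFinIncl hE j)).app F j)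
    (hasFiniteValues_paramObj _ F j)

lemma hasFiniteValues_upper_neg (hE : IsNonnegFinite E) (F : StrictPoly k d) (j : ℤ) :
    hasFiniteValues k (GammaV k d) (((upper k d).obj (op E)).obj F (-j)).obj :=
  have := isIso_paramToLower_dualTruncFinIncl hE F j
  hasFiniteValues_of_isIso (Y := ((lower k d).obj ((grDual k).obj (op E))).obj F (-j))
    ((paramToLower (dualTruncFinIncl hE j)).app F (-j)) (hasFiniteValues_paramObj _ F (-j))

lemma hasFiniteValues_upper (hE : IsNonnegFinite E) (F : StrictPoly k d) (j : ℤ) :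
    hasFiniteValues k (GammaV k d) (((upper k d).obj (op E)).obj F j).obj := by
  rw [← neg_neg j]
  exact hasFiniteValues_upper_neg hE F (-j)

variable (hE : IsNonnegFinite E) (hE' : IsNonnegFinite E')

/-- The isomorphism of `G(T ⊗ -)^j` with `(G_E)^j`, where `T` is the part of `E` in degrees
`≤ j`. -/
def paramIsoLower (G : StrictPoly k d) (j : ℤ) :
    (paramFunctor (truncFin hE j) j).obj G ≅ toStrictPoly _ (hasFiniteValues_lower hE G j) :=
  @asIso _ _ _ _ (toStrictPolyMap ((paramToLower (truncFinIncl hE j)).app G j)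
    (hasFiniteValues_paramObj _ G j) (hasFiniteValues_lower hE G j))
    (@isIso_toStrictPolyMap _ _ _ _ _ _ (isIso_paramToLower_truncFinIncl hE G j) _ _)

/-- The isomorphism of `F(T^∨ ⊗ -)^{-j}` with `(F^E)^{-j}`, where `T` is the part of `E` in degrees
`≤ j`. -/
def paramIsoUpper (F : StrictPoly k d) (j : ℤ) :
    (paramFunctor (dualFin (truncFin hE j)) (-j)).obj F ≅
      toStrictPoly _ (hasFiniteValues_upper hE F (-j)) :=
  @asIso _ _ _ _ (toStrictPolyMap ((paramToLower (dualTruncFinIncl hE j)).app F (-j))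
    (hasFiniteValues_paramObj _ F (-j)) (hasFiniteValues_upper hE F (-j)))
    (@isIso_toStrictPolyMap _ _ _ _ _ _ (isIso_paramToLower_dualTruncFinIncl hE F j) _ _)

lemma paramIsoLower_hom_naturality {G G' : StrictPoly k d} (β : G ⟶ G') (j : ℤ) :
    (paramIsoLower hE G j).hom ≫ toStrictPolyMap (((lower k d).obj E).map β j)
        (hasFiniteValues_lower hE G j) (hasFiniteValues_lower hE G' j) =
      (paramFunctor (truncFin hE j) j).map β ≫ (paramIsoLower hE G' j).hom :=
  ObjectProperty.hom_ext _
    congr($(congrFun ((paramToLower (truncFinIncl hE j)).naturality β) j).hom).symm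

lemma paramIsoUpper_hom_naturality {F F' : StrictPoly k d} (α : F' ⟶ F) (j : ℤ) :
    (paramIsoUpper hE F' j).hom ≫ toStrictPolyMap (((upper k d).obj (op E)).map α (-j))
        (hasFiniteValues_upper hE F' (-j)) (hasFiniteValues_upper hE F (-j)) =
      (paramFunctor (dualFin (truncFin hE j)) (-j)).map α ≫ (paramIsoUpper hE F j).hom :=
  ObjectProperty.hom_ext _
    congr($(congrFun ((paramToLower (dualTruncFinIncl hE j)).naturality α) (-j)).hom).symm

lemma paramIsoLower_hom_comp (f : E ⟶ E') (G : StrictPoly k d) (j : ℤ) :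
    (paramIsoLower hE G j).hom ≫ toStrictPolyMap (((lower k d).map f).app G j)
        (hasFiniteValues_lower hE G j) (hasFiniteValues_lower hE' G j) =
      (paramFunctorMap (truncFinMap hE hE' f j) j).app G ≫ (paramIsoLower hE' G j).hom :=
  ObjectProperty.hom_ext _ congr(($(paramToLower_comp (d := d) _ _ _ f
    (truncFinIncl_comp hE hE' f j)).app G j).hom)

lemma paramIsoUpper_hom_comp (f : E ⟶ E') (F : StrictPoly k d) (j : ℤ) :
    (paramIsoUpper hE' F j).hom ≫ toStrictPolyMap (((upper k d).map f.op).app F (-j))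
        (hasFiniteValues_upper hE' F (-j)) (hasFiniteValues_upper hE F (-j)) =
      (paramFunctorMap (dualFinMap (truncFinMap hE hE' f j)) (-j)).app F ≫
        (paramIsoUpper hE F j).hom :=
  ObjectProperty.hom_ext _ congr(($(paramToLower_comp (d := d) _ _ _ _
    (dualTruncFinIncl_comp hE hE' f j)).app F (-j)).hom)

/-- The isomorphism `Ext^i((F^E)^{-j}, G) ≃ Ext^i(F, (G_E)^j)`. -/
def extEquiv (F G : StrictPoly k d) (i : ℕ) (j : ℤ) :
    Abelian.Ext (toStrictPoly _ (hasFiniteValues_upper hE F (-j))) G i ≃ₗ[k]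
      Abelian.Ext F (toStrictPoly _ (hasFiniteValues_lower hE G j)) i :=
  extIsoLeft k (paramIsoUpper hE F j) G i ≪≫ₗ
    Abelian.Ext.adjunctionLinearEquiv (paramAdjunction (truncFin hE j) j) k F G i ≪≫ₗ
      extIsoRight k F (paramIsoLower hE G j) i

lemma extEquiv_apply (F G : StrictPoly k d) (i : ℕ) (j : ℤ)
    (x : Abelian.Ext (toStrictPoly _ (hasFiniteValues_upper hE F (-j))) G i) :
    extEquiv hE F G i j x = (Abelian.Ext.adjunctionLinearEquiv
      (paramAdjunction (truncFin hE j) j) k F G i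
        ((Abelian.Ext.mk₀ (paramIsoUpper hE F j).hom).comp x (zero_add i))).comp
          (Abelian.Ext.mk₀ (paramIsoLower hE G j).hom) (add_zero i) := rfl

lemma extEquiv_naturality_left {F F' : StrictPoly k d} (G : StrictPoly k d) (α : F' ⟶ F)
    (i : ℕ) (j : ℤ) (x : Abelian.Ext (toStrictPoly _ (hasFiniteValues_upper hE F (-j))) G i) :
    extEquiv hE F' G i j ((Abelian.Ext.mk₀ (toStrictPolyMap
        (((upper k d).obj (op E)).map α (-j)) (hasFiniteValues_upper hE F' (-j))
        (hasFiniteValues_upper hE F (-j)))).comp x (zero_add i)) =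
      (Abelian.Ext.mk₀ α).comp (extEquiv hE F G i j x) (zero_add i) := by
  rw [extEquiv_apply, extEquiv_apply, Abelian.Ext.mk₀_comp_mk₀_assoc,
    paramIsoUpper_hom_naturality, ← Abelian.Ext.mk₀_comp_mk₀_assoc,
    Abelian.Ext.adjunctionLinearEquiv_naturality_left, Abelian.Ext.comp_assoc_of_third_deg_zero]

lemma extEquiv_naturality_right (F : StrictPoly k d) {G G' : StrictPoly k d} (β : G ⟶ G')
    (i : ℕ) (j : ℤ) (x : Abelian.Ext (toStrictPoly _ (hasFiniteValues_upper hE F (-j))) G i) :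
    extEquiv hE F G' i j (x.comp (Abelian.Ext.mk₀ β) (add_zero i)) =
      (extEquiv hE F G i j x).comp (Abelian.Ext.mk₀ (toStrictPolyMap
        (((lower k d).obj E).map β j) (hasFiniteValues_lower hE G j)
        (hasFiniteValues_lower hE G' j))) (add_zero i) := by
  rw [extEquiv_apply, extEquiv_apply, Abelian.Ext.comp_assoc_of_third_deg_zero,
    Abelian.Ext.mk₀_comp_mk₀, paramIsoLower_hom_naturality, ← Abelian.Ext.mk₀_comp_mk₀,
    ← Abelian.Ext.comp_assoc_of_third_deg_zero, ← Abelian.Ext.comp_assoc_of_third_deg_zero,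
    Abelian.Ext.adjunctionLinearEquiv_naturality_right]

/-- Each of the three isomorphisms composing `extEquiv` depends on `E`. The outer two are natural
along `truncFinMap`; the middle one passes between different adjunctions, related by mates through
`paramAdjunction_unit_dinatural`. -/
lemma extEquiv_dinatural (f : E ⟶ E') (F G : StrictPoly k d) (i : ℕ) (j : ℤ)
    (x : Abelian.Ext (toStrictPoly _ (hasFiniteValues_upper hE F (-j))) G i) :
    extEquiv hE' F G i j ((Abelian.Ext.mk₀ (toStrictPolyMap
        (((upper k d).map f.op).app F (-j)) (hasFiniteValues_upper hE' F (-j))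
        (hasFiniteValues_upper hE F (-j)))).comp x (zero_add i)) =
      (extEquiv hE F G i j x).comp (Abelian.Ext.mk₀ (toStrictPolyMap
        (((lower k d).map f).app G j) (hasFiniteValues_lower hE G j)
        (hasFiniteValues_lower hE' G j))) (add_zero i) := by
  rw [extEquiv_apply, extEquiv_apply, Abelian.Ext.mk₀_comp_mk₀_assoc,
    paramIsoUpper_hom_comp, ← Abelian.Ext.mk₀_comp_mk₀_assoc,
    Abelian.Ext.adjunctionLinearEquiv_conjugate (paramAdjunction (truncFin hE j) j) k
      (paramAdjunction (truncFin hE' j) j) _ (paramFunctorMap (truncFinMap hE hE' f j) j)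
      (paramAdjunction_unit_dinatural (truncFinMap hE hE' f j) j),
    Abelian.Ext.comp_assoc_of_third_deg_zero, Abelian.Ext.comp_assoc_of_third_deg_zero,
    Abelian.Ext.mk₀_comp_mk₀, Abelian.Ext.mk₀_comp_mk₀, paramIsoLower_hom_comp]

end Main

end StrictPolynomial

end

theorem mainTheorem4 (k : Type u) [Field k] (d : ℕ) :
    -- (1) exactness, and naturality in `E`
    ((∀ E : GrVect k,
        (PreservesFiniteLimits ((lower k d).obj E) ∧
          PreservesFiniteColimits ((lower k d).obj E)) ∧
        (PreservesFiniteLimits ((upper k d).obj (op E)) ∧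
          PreservesFiniteColimits ((upper k d).obj (op E)))) ∧
      (∀ (E E' : GrVect k) (f : E ⟶ E') (F : StrictPoly k d) (S : FinSub E),
        lowerι E F S ≫ ((lower k d).map f).app F =
          ((param k d).map (S.restr f)).app F ≫ lowerι E' F (S.map f))) ∧
    -- (2) comparison with the evaluation, for `E` of finite total dimension
    ((∀ (E : GrFin k) (F : StrictPoly k d) (V : FGModuleCat.{u} k),
        DirectSum.IsInternal fun j : ℤ => weightSpace F.obj (tensorObj E V) j) ∧
      (∃ e : (isFinTotal k).ι ⋙ lower k d ≅ param k d,
        ∀ (E : GrFin k) (F : StrictPoly k d) (S : FinSub E.obj),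
          lowerι E.obj F S ≫ (e.hom.app E).app F =
            ((param k d).map (ObjectProperty.homMk (subGrIncl E.obj S.1) :
              (finSubDiagram E.obj).obj S ⟶ E)).app F)) ∧
    -- (3) truncation
    (∀ E : GrVect k, IsNonnegFinite E → ∀ (F : StrictPoly k d) (i : ℤ),
      Mono (((lower k d).map (subGrIncl E (truncSub E i))).app F) ∧
        ∀ j ≤ i, IsIso (((lower k d).map (subGrIncl E (truncSub E i))).app F j)) ∧
    -- (4) the isomorphism of `Ext`, in bidegree `(i, j)`
    (∃ (hU : ∀ E : GrVect k, IsNonnegFinite E → ∀ (F : StrictPoly k d) (j : ℤ),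
          hasFiniteValues k (GammaV k d) (((upper k d).obj (op E)).obj F j).obj)
        (hL : ∀ E : GrVect k, IsNonnegFinite E → ∀ (F : StrictPoly k d) (j : ℤ),
          hasFiniteValues k (GammaV k d) (((lower k d).obj E).obj F j).obj)
        (φ : ∀ (E : GrVect k) (hE : IsNonnegFinite E) (F G : StrictPoly k d) (i : ℕ) (j : ℤ),
          Abelian.Ext (toStrictPoly _ (hU E hE F (-j))) G i ≃ₗ[k]
            Abelian.Ext F (toStrictPoly _ (hL E hE G j)) i),
        (∀ (E : GrVect k) (hE : IsNonnegFinite E) (F F' G : StrictPoly k d) (α : F' ⟶ F)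
            (i : ℕ) (j : ℤ) (x : Abelian.Ext (toStrictPoly _ (hU E hE F (-j))) G i),
          φ E hE F' G i j ((Abelian.Ext.mk₀ (toStrictPolyMap
              (((upper k d).obj (op E)).map α (-j)) (hU E hE F' (-j)) (hU E hE F (-j)))).comp x
                (zero_add i)) =
            (Abelian.Ext.mk₀ α).comp (φ E hE F G i j x) (zero_add i)) ∧
        (∀ (E : GrVect k) (hE : IsNonnegFinite E) (F G G' : StrictPoly k d) (β : G ⟶ G')
            (i : ℕ) (j : ℤ) (x : Abelian.Ext (toStrictPoly _ (hU E hE F (-j))) G i),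
          φ E hE F G' i j (x.comp (Abelian.Ext.mk₀ β) (add_zero i)) =
            (φ E hE F G i j x).comp (Abelian.Ext.mk₀ (toStrictPolyMap
              (((lower k d).obj E).map β j) (hL E hE G j) (hL E hE G' j))) (add_zero i)) ∧
        (∀ (E E' : GrVect k) (hE : IsNonnegFinite E) (hE' : IsNonnegFinite E') (f : E ⟶ E')
            (F G : StrictPoly k d) (i : ℕ) (j : ℤ)
            (x : Abelian.Ext (toStrictPoly _ (hU E hE F (-j))) G i),
          φ E' hE' F G i j ((Abelian.Ext.mk₀ (toStrictPolyMap
              (((upper k d).map f.op).app F (-j)) (hU E' hE' F (-j)) (hU E hE F (-j)))).comp x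
                (zero_add i)) =
            (φ E hE F G i j x).comp (Abelian.Ext.mk₀ (toStrictPolyMap
              (((lower k d).map f).app G j) (hL E hE G j) (hL E' hE' G j))) (add_zero i))) := by
  refine ⟨⟨fun E => ⟨⟨preservesFiniteLimits_lowerAt E, preservesFiniteColimits_lowerAt E⟩,
      preservesFiniteLimits_lowerAt ((grDual k).obj (op E)),
      preservesFiniteColimits_lowerAt ((grDual k).obj (op E))⟩,
    fun E E' f F S => lowerι_lowerMap f F S⟩,
    ⟨fun E F V => isInternal_weightSpace F.obj F.property.1 (tensorObj E V),
      lowerNatIsoParam k d, fun E F S => lowerι_lowerToParam E F S⟩,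
    fun E hE F i => ⟨mono_lower_map_subGrIncl E F i,
      fun j hj => isIso_lower_map_subGrIncl_apply hE F hj⟩,
    fun E hE F j => hasFiniteValues_upper hE F j, fun E hE F j => hasFiniteValues_lower hE F j,
    fun E hE F G i j => extEquiv hE F G i j, ?_, ?_, ?_⟩
  · exact fun E hE F F' G α i j x => extEquiv_naturality_left hE G α i j x
  · exact fun E hE F G G' β i j x => extEquiv_naturality_right hE F β i j x
  · exact fun E E' hE hE' f F G i j x => extEquiv_dinatural hE hE' f F G i j x
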